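/- Let $R=[0,W]\times[-1,0]$ and let $s=(s_x,0)$ be a point on its top side, $0<s_x\le W$. Give the interior of $R$ the weight $\alpha>0$, the exterior of $R$ the weight $1$, and the boundary $\partial R$ the weight $\min\{1,\alpha\}$. The weighted length of a polygonal path is the integral of the weight along it with respect to Euclidean length. A path from $s$ to $t$ is *shortest* if no polygonal path from $s$ to $t$ has smaller weighted length. Consider targets $t=(t_x,t_y)\notin\partial R$ with $t_x\le s_x$, and the following types of polygonal paths from $s$ to $t$ (listed by their intermediate vertices): 1. no vertex, $t_y>0$; 2. $(b,0)$ with $0<b<s_x$, $t_y>0$; 3. $(0,0)$, $t_x<0<t_y$; 4. $(0,0)$, $t_x<0$, $t_y<0$; 5. $(b_1,0),(0,b_2)$ with $0<b_1<s_x$, $-1<b_2<0$, $t_x<0$; 6. $(0,w)$ with $-1<w<0$, $t_x<0$; 7. $(0,b),(0,-1)$ with $-1<b<0$, $t_x>0$, $t_y<-1$; 8. $(0,b_1),(0,b_2),(b_3,-1)$ with $-1<b_2<b_1<0$, $0<b_3<W$, $t_y<-1$; 9. $(0,-1)$, $t_x<0$, $t_y<-1$; 10. $(w,-1)$ with $0<w<W$,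 $t_y<-1$; 11. $(b,0)$ with $0<b<s_x$, $t$ in the interior of $R$; 12. no vertex, $t$ in the interior of $R$; 13. $(0,b_1),(0,b_2)$ with $-1<b_2<b_1<0$, $t$ in the interior of $R$. Let $d_i(s,t)$ be the length of the shortest path among the paths of type $i$ from $s$ to $t$, defined on the set $D_i$ of those $t$ for which such a path exists. The bisector $B_{i,j}$ is the set of the points $q\notin\partial R$ at which $d_i(s,\cdot)$ and $d_j(s,\cdot)$, extended by continuity to $\overline{D_i}$ and $\overline{D_j}$, are both defined and equal. (More precisely: some value $d$ is such that $(q,d)$ lies in the closures of the graphs of both functions.) The cell $C_i$ of the Shortest Path Map (SPM) is the set of the targets $t$ for which some path of type $i$ is shortest among all paths, and $E_{i,j}=(\overline{C_i}\cap\overline{C_j})\setminus\partial R$ is the common boundary of two cells. **Case $0<\alpha<1$.** For each pair $(i,j)$ in the following list, $B_{i,j}$ is the part of the curve $y=b_{i,j}(x)$ in $(\overline{D_i}\cap\overline{D_j})\setminus\partial R$, and $E_{i,j}=B_{i,j}$: $$\begin{aligned} b_{1,2}(x)&=\tfrac{\sqrt{1-\alpha^2}}{\alpha}(s_x-x), &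 b_{2,3}(x)&=-\tfrac{\sqrt{1-\alpha^2}}{\alpha}x, & b_{3,6}(x)&=0,\\ b_{3,9}(x)&=0, & b_{6,9}(x)&=-1+\tfrac{\alpha}{\sqrt{s_x^2+1-\alpha^2}}x, & b_{9,10}(x)&=-1+\tfrac{\sqrt{1-(\alpha^2-1)s_x^2}}{\alpha s_x}x. \end{aligned}$$ (For $(3,9)$ both sets are empty, as $\overline{D_3}$ and $\overline{D_9}$ are disjoint.) If $i<j$, neither is $10$, and $E_{i,j}\neq\emptyset$, then $(i,j)$ is in this list. **Case $1<\alpha<\sqrt2$.** For each pair $(i,j)$ in the following list, $B_{i,j}$ is the part of the curve $y=b_{i,j}(x)$ (of the line $x=0$ for $(6,7)$) in $(\overline{D_i}\cap\overline{D_j})\setminus\partial R$, and $E_{i,j}\subseteq B_{i,j}$: $$\begin{aligned} b_{1,4}(x)&=0, & b_{4,5}(x)&=\tfrac{\sqrt{\alpha^2-1}}{\sqrt{2-\alpha^2}}x, & b_{5,6}(x)&=\tfrac{\sqrt{\alpha^2-1}}{\sqrt{2-\alpha^2}}x-\sqrt{\alpha^2-1}\,s_x,\\ b_{6,7}&:\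 x=0, & b_{7,8}(x)&=-1-\tfrac{\sqrt{2-\alpha^2}}{\sqrt{\alpha^2-1}}x, & b_{11,12}(x)&=-\sqrt{\alpha^2-1}\,(s_x-x),\\ b_{12,13}(x)&=-\tfrac{(s_x+x)+2\alpha\sqrt{s_xx}}{\sqrt{\alpha^2-1}}. \end{aligned}$$ Moreover, for every listed pair other than $(12,13)$, all points of $B_{i,j}$ with $y>-1$ belong to $E_{i,j}$. If $i<j$, neither is $10$, and $E_{i,j}\neq\emptyset$, then $(i,j)$ is in this list. -/

import Mathlib

namespace WeightedRectangle

noncomputable section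

/-- The rectangle of unit height and width `W` whose top-left corner is the origin. -/
def rect (W : ℝ) : Set (ℝ × ℝ) := Set.Icc 0 W ×ˢ Set.Icc (-1) 0

open Classical in
/-- Cost per unit of Euclidean length: `α` in the interior of the rectangle, `1` outside it, and
the smaller of the two on the edges between the two regions. -/
def weight (α W : ℝ) (p : ℝ × ℝ) : ℝ :=
  if p ∈ interior (rect W) then α else if p ∈ frontier (rect W) then min 1 α else 1

/-- Euclidean distance in the plane (the `dist` of `ℝ × ℝ` is the sup distance). -/
def euclid (p q : ℝ × ℝ) : ℝ := √((p.1 - q.1) ^ 2 + (p.2 - q.2) ^ 2)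

/-- Weighted length of the straight segment from `p` to `q`: the Euclidean length of each part of
the segment is multiplied by the weight that holds there. -/
def segLength (α W : ℝ) (p q : ℝ × ℝ) : ℝ :=
  euclid p q * ∫ τ in (0 : ℝ)..1, weight α W (AffineMap.lineMap p q τ)

/-- Weighted length of a polygonal chain, given by the list of its vertices. -/
def chainLength (α W : ℝ) : List (ℝ × ℝ) → ℝ
  | [] => 0
  | [_] => 0
  | p :: q :: l => segLength α W p q + chainLength α W (q :: l)

/-- Weighted length of the polygonal path from `(sx, 0)` to `t` with intermediate vertices `v`. -/
def pathLength (α W sx : ℝ) (t : ℝ × ℝ) (v : List (ℝ × ℝ)) : ℝ :=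
  chainLength α W ((sx, 0) :: (v ++ [t]))

/-- The path with intermediate vertices `v` is a shortest one among all paths
from `(sx, 0)` to `t`. -/
def IsShortest (α W sx : ℝ) (t : ℝ × ℝ) (v : List (ℝ × ℝ)) : Prop :=
  ∀ v' : List (ℝ × ℝ), pathLength α W sx t v ≤ pathLength α W sx t v'

/-- The thirteen combinatorial types of paths from `(sx, 0)` to a target `t` that is not to the
right of the vertical line through `(sx, 0)`; a path is given by its intermediate vertices. The
types 1 to 10 lead to targets outside the rectangle, the types 11 to 13 to targets inside it. -/
def pathsOfType (W sx : ℝ) (t : ℝ × ℝ) : ℕ → Set (List (ℝ × ℝ))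
  -- directly, above the line of the top side
  | 1 => {v | 0 < t.2 ∧ v = []}
  -- along the top side, then up
  | 2 => {v | 0 < t.2 ∧ ∃ b, 0 < b ∧ b < sx ∧ v = [(b, 0)]}
  -- along the top side to its left end, then up to the left
  | 3 => {v | t.1 < 0 ∧ 0 < t.2 ∧ v = [(0, 0)]}
  -- along the top side to its left end, then down to the left
  | 4 => {v | t.1 < 0 ∧ t.2 < 0 ∧ v = [(0, 0)]}
  -- along the top side, through the rectangle, out at the left side
  | 5 => {v | t.1 < 0 ∧ ∃ b₁ b₂, 0 < b₁ ∧ b₁ < sx ∧ -1 < b₂ ∧ b₂ < 0 ∧ v = [(b₁, 0), (0, b₂)]}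
  -- through the rectangle, out at the left side
  | 6 => {v | t.1 < 0 ∧ ∃ w, -1 < w ∧ w < 0 ∧ v = [(0, w)]}
  -- through the rectangle to the left side, along it to its lower end, then down to the right
  | 7 => {v | 0 < t.1 ∧ t.2 < -1 ∧ ∃ b, -1 < b ∧ b < 0 ∧ v = [(0, b), (0, -1)]}
  -- through the rectangle to the left side, along it, again through the rectangle,
  -- out at the bottom side
  | 8 => {v | t.2 < -1 ∧ ∃ b₁ b₂ b₃, -1 < b₂ ∧ b₂ < b₁ ∧ b₁ < 0 ∧ 0 < b₃ ∧ b₃ < W ∧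
      v = [(0, b₁), (0, b₂), (b₃, -1)]}
  -- through the rectangle to the lower left corner, then down to the left
  | 9 => {v | t.1 < 0 ∧ t.2 < -1 ∧ v = [(0, -1)]}
  -- through the rectangle, out at the bottom side
  | 10 => {v | t.2 < -1 ∧ ∃ w, 0 < w ∧ w < W ∧ v = [(w, -1)]}
  -- along the top side, then into the rectangle
  | 11 => {v | t ∈ interior (rect W) ∧ ∃ b, 0 < b ∧ b < sx ∧ v = [(b, 0)]}
  -- directly, inside the rectangle
  | 12 => {v | t ∈ interior (rect W) ∧ v = []}
  -- through the rectangle to the left side, along it, again into the rectangle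
  | 13 => {v | t ∈ interior (rect W) ∧ ∃ b₁ b₂, -1 < b₂ ∧ b₂ < b₁ ∧ b₁ < 0 ∧
      v = [(0, b₁), (0, b₂)]}
  | _ => ∅

/-- The graph of the function `d i`, which sends a target `t` to the length of the shortest path
of type `i` from `(sx, 0)` to `t`; it is defined where such a path exists. -/
def typeGraph (α W sx : ℝ) (i : ℕ) : Set ((ℝ × ℝ) × ℝ) :=
  {z | z.1.1 ≤ sx ∧ IsLeast (pathLength α W sx z.1 '' pathsOfType W sx z.1 i) z.2}

/-- The targets for which there is a shortest path of type `i`, among the paths of type `i`. -/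
def typeDomain (α W sx : ℝ) (i : ℕ) : Set (ℝ × ℝ) :=
  {t | ∃ d : ℝ, (t, d) ∈ typeGraph α W sx i}

/-- The bisector of the types `i` and `j`: the points off the boundary of the rectangle where
`d i` and `d j`, extended by continuity to the closures of their domains, have a common value.
(On a bisector one of the paths usually degenerates into the other, for instance because an edge
of it shrinks to a point.) -/
def bisector (α W sx : ℝ) (i j : ℕ) : Set (ℝ × ℝ) :=
  {q | q ∉ frontier (rect W) ∧
    ∃ d : ℝ, (q, d) ∈ closure (typeGraph α W sx i) ∧ (q, d) ∈ closure (typeGraph α W sx j)}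

/-- The cell of type `i` of the Shortest Path Map: the targets that are reached from `(sx, 0)` by
a path of type `i` which is shortest among all paths. -/
def cell (α W sx : ℝ) (i : ℕ) : Set (ℝ × ℝ) :=
  {t | t.1 ≤ sx ∧ ∃ v ∈ pathsOfType W sx t i, IsShortest α W sx t v}

/-- The common boundary of the cells of types `i` and `j` of the Shortest Path Map, off the
boundary of the rectangle. -/
def spmEdge (α W sx : ℝ) (i j : ℕ) : Set (ℝ × ℝ) :=
  {q | q ∉ frontier (rect W) ∧ q ∈ closure (cell α W sx i) ∧ q ∈ closure (cell α W sx j)}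

/-- The points off the boundary of the rectangle that lie on the set `C` and in the closures of
the domains of both `d i` and `d j`. -/
def curvePart (α W sx : ℝ) (i j : ℕ) (C : Set (ℝ × ℝ)) : Set (ℝ × ℝ) :=
  {q | q ∉ frontier (rect W) ∧ q ∈ closure (typeDomain α W sx i) ∧
    q ∈ closure (typeDomain α W sx j) ∧ q ∈ C}

/-- The relevant pairs of types for `α < 1`. -/
def lightPairs : Set (ℕ × ℕ) := {(1, 2), (2, 3), (3, 6), (3, 9), (6, 9), (9, 10)}

/-- The curves `b i j` for `α < 1`. -/
def lightCurve (α sx : ℝ) : ℕ × ℕ → Set (ℝ × ℝ)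
  | (1, 2) => {q | q.2 = √(1 - α ^ 2) / α * (sx - q.1)}
  | (2, 3) => {q | q.2 = -(√(1 - α ^ 2) / α) * q.1}
  | (3, 6) => {q | q.2 = 0}
  | (3, 9) => {q | q.2 = 0}
  | (6, 9) => {q | q.2 = -1 + α / √(sx ^ 2 + 1 - α ^ 2) * q.1}
  | (9, 10) => {q | q.2 = -1 + √(1 - (α ^ 2 - 1) * sx ^ 2) / (α * sx) * q.1}
  | _ => ∅

/-- The relevant pairs of types for `1 < α < √2`, without most of those that involve type 10. -/
def heavyPairs : Set (ℕ × ℕ) := {(1, 4), (4, 5), (5, 6), (6, 7), (7, 8), (11, 12), (12, 13)}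

/-- The curves `b i j` for `1 < α < √2`. -/
def heavyCurve (α sx : ℝ) : ℕ × ℕ → Set (ℝ × ℝ)
  | (1, 4) => {q | q.2 = 0}
  | (4, 5) => {q | q.2 = √(α ^ 2 - 1) / √(2 - α ^ 2) * q.1}
  | (5, 6) => {q | q.2 = √(α ^ 2 - 1) / √(2 - α ^ 2) * q.1 - √(α ^ 2 - 1) * sx}
  | (6, 7) => {q | q.1 = 0}
  | (7, 8) => {q | q.2 = -1 - √(2 - α ^ 2) / √(α ^ 2 - 1) * q.1}
  | (11, 12) => {q | q.2 = -√(α ^ 2 - 1) * (sx - q.1)}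
  | (12, 13) => {q | q.2 = -((sx + q.1 + 2 * α * √(sx * q.1)) / √(α ^ 2 - 1))}
  | _ => ∅

end

end WeightedRectangle

/-! Lower bounds come from calibrations. A function A(x) + B(y), piecewise linear with kinks only on
the lines x = 0, x = W, y = -1 and y = 0, has a constant gradient on each of nine boxes. If the
gradient has norm at most α on the middle box and at most 1 on the other eight, the function grows
along a path by no more than the weighted length (`IsCalibration.le_pathLength`). A path is
therefore shortest as soon as some calibration grows by exactly its length. The slopes are read off
from the directions of the path; Snell's law makes the tangential slope agree on both sides of a
crossed edge.

Minimality within a type makes the derivatives in the free vertices vanish. These equations give a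
formula for d_i (linear in t for the types that use an edge at the critical angle, a minimum over
one crossing point for types 6 and 10) and closed inequalities that confine the domain. As the
formulas are continuous, extension by continuity is evaluation of the formula on the closed domain
(`mem_closure_typeGraph_iff`), and a bisector is the solution set of f = g there
(`bisector_eq_curvePart`). Often a linear length meets a norm, so that the bisector is the equality
case of the Cauchy–Schwarz inequality. For (6,9) and (9,10) a derivative at the corner is set
against the domain inequality, and (12,13) is a quadratic equation whose branch is selected by the
domain.

The distance `spDist` is Lipschitz and equals d_i on the closure of the i-th cell, so every edge
lies in the bisector (`spmEdge_subset_bisector`). Conversely, calibrations put points of the curve,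
or points arbitrarily close to it, into both cells. For a heavy rectangle the calibrations for
targets on the left are evaluated only in the strip -1 ≤ y ≤ 0; this is the origin of the
restriction y > -1.

The remaining pairs have no edge. Some cells are empty because a shortcut or a perturbed vertex is
cheaper. Many closed domains are disjoint or meet only on the frontier, or on a line where one of
the two lengths is visibly too large. For (1,3) in the light case and (4,6) in the heavy case,
averaging the vertices of two equally long paths gives a strictly shorter one. -/

open Set MeasureTheory Filter Topology

namespace WeightedRectangle

section

/-! ### The rectangle, its weight, and the weighted length of a segment -/

theorem interior_rect (W : ℝ) : interior (rect W) = Ioo 0 W ×ˢ Ioo (-1) 0 := by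
  rw [rect, interior_prod_eq, interior_Icc, interior_Icc]

theorem isClosed_rect (W : ℝ) : IsClosed (rect W) := isClosed_Icc.prod isClosed_Icc

theorem mem_interior_rect {W : ℝ} {p : ℝ × ℝ} :
    p ∈ interior (rect W) ↔ (0 < p.1 ∧ p.1 < W) ∧ -1 < p.2 ∧ p.2 < 0 := by
  rw [interior_rect]; rfl

theorem mem_frontier_rect {W : ℝ} {p : ℝ × ℝ} :
    p ∈ frontier (rect W) ↔ ((0 ≤ p.1 ∧ p.1 ≤ W) ∧ -1 ≤ p.2 ∧ p.2 ≤ 0) ∧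
      ¬ ((0 < p.1 ∧ p.1 < W) ∧ -1 < p.2 ∧ p.2 < 0) := by
  rw [(isClosed_rect W).frontier_eq, Set.mem_sdiff, mem_interior_rect]; rfl

theorem weight_of_inside {α W x y : ℝ} (h1 : 0 < x) (h2 : x < W) (h3 : -1 < y) (h4 : y < 0) :
    weight α W (x, y) = α :=
  if_pos (mem_interior_rect.2 ⟨⟨h1, h2⟩, h3, h4⟩)

theorem weight_of_outside {α W x y : ℝ} (h : ¬ ((0 ≤ x ∧ x ≤ W) ∧ -1 ≤ y ∧ y ≤ 0)) :
    weight α W (x, y) = 1 := by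
  have h1 : (x, y) ∉ interior (rect W) := fun h' => h (interior_subset (s := rect W) h')
  have h2 : (x, y) ∉ frontier (rect W) := fun h' => h (mem_frontier_rect.1 h').1
  rw [weight, if_neg h1, if_neg h2]

theorem weight_of_edge {α W x y : ℝ} (h : (0 ≤ x ∧ x ≤ W) ∧ -1 ≤ y ∧ y ≤ 0)
    (h' : ¬ ((0 < x ∧ x < W) ∧ -1 < y ∧ y < 0)) : weight α W (x, y) = min 1 α := by
  rw [weight, if_neg (fun hc => h' (mem_interior_rect.1 hc)),
    if_pos (mem_frontier_rect.2 ⟨h, h'⟩)]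

theorem weight_of_not_inside {α W x y : ℝ} (hα : 1 ≤ α)
    (h' : ¬ ((0 < x ∧ x < W) ∧ -1 < y ∧ y < 0)) : weight α W (x, y) = 1 := by
  by_cases h : (0 ≤ x ∧ x ≤ W) ∧ -1 ≤ y ∧ y ≤ 0
  · rw [weight_of_edge h h', min_eq_left hα]
  · exact weight_of_outside h

theorem measurable_weight (α W : ℝ) : Measurable (weight α W) := by
  classical
  unfold weight
  refine Measurable.ite isOpen_interior.measurableSet measurable_const ?_
  exact Measurable.ite isClosed_frontier.measurableSet measurable_const measurable_const

theorem weight_nonneg {α W : ℝ} (hα : 0 < α) (p : ℝ × ℝ) : 0 ≤ weight α W p := by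
  unfold weight
  split_ifs
  · exact hα.le
  · exact le_min zero_le_one hα.le
  · exact zero_le_one

theorem weight_le {α W : ℝ} (p : ℝ × ℝ) : weight α W p ≤ max 1 α := by
  unfold weight
  split_ifs
  · exact le_max_right _ _
  · exact (min_le_left _ _).trans (le_max_left _ _)
  · exact le_max_left _ _

theorem intervalIntegrable_of_measurable_of_bound {f : ℝ → ℝ} (hf : Measurable f) {C : ℝ}
    (hC : ∀ x, |f x| ≤ C) (a b : ℝ) : IntervalIntegrable f volume a b := by
  rw [intervalIntegrable_iff]
  exact Measure.integrableOn_of_bounded (M := C) (by simp) hf.aestronglyMeasurable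
    (Eventually.of_forall hC)

theorem intervalIntegrable_weight {α W : ℝ} (hα : 0 < α) (p q : ℝ × ℝ) :
    IntervalIntegrable (fun τ : ℝ => weight α W (AffineMap.lineMap p q τ)) volume 0 1 := by
  refine intervalIntegrable_of_measurable_of_bound
    ((measurable_weight α W).comp (AffineMap.lineMap_continuous.measurable)) (C := max 1 α)
    (fun τ => ?_) 0 1
  exact (abs_of_nonneg (weight_nonneg hα _)).le.trans (weight_le _)

theorem lineMap_eq (p q : ℝ × ℝ) (τ : ℝ) : AffineMap.lineMap p q τ =
    (p.1 + τ * (q.1 - p.1), p.2 + τ * (q.2 - p.2)) := by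
  ext <;> simp [AffineMap.lineMap_apply] <;> ring

theorem euclid_nonneg (p q : ℝ × ℝ) : 0 ≤ euclid p q := Real.sqrt_nonneg _

theorem euclid_comm (p q : ℝ × ℝ) : euclid p q = euclid q p := by
  unfold euclid; congr 1; ring

theorem segLength_nonneg {α W : ℝ} (hα : 0 < α) (p q : ℝ × ℝ) : 0 ≤ segLength α W p q :=
  mul_nonneg (euclid_nonneg _ _)
    (intervalIntegral.integral_nonneg zero_le_one fun _ _ => weight_nonneg hα _)

theorem segLength_le {α W : ℝ} (hα : 0 < α) (p q : ℝ × ℝ) :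
    segLength α W p q ≤ max 1 α * euclid p q := by
  rw [mul_comm]
  refine mul_le_mul_of_nonneg_left ?_ (euclid_nonneg _ _)
  have := intervalIntegral.integral_mono_on zero_le_one (intervalIntegrable_weight (W := W) hα p q)
    (intervalIntegrable_const (c := max 1 α)) (fun τ _ => weight_le _)
  simpa using this

/-- Endpoints are null sets, so only the open segment matters. A segment may start and end on the
frontier and still carry a single weight. -/
theorem segLength_of_weight_eq {α W c : ℝ} {p q : ℝ × ℝ}
    (h : ∀ τ : ℝ, 0 < τ → τ < 1 →
      weight α W (p.1 + τ * (q.1 - p.1), p.2 + τ * (q.2 - p.2)) = c) :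
    segLength α W p q = c * euclid p q := by
  rw [segLength, mul_comm]
  congr 1
  have : ∫ τ in (0 : ℝ)..1, weight α W (AffineMap.lineMap p q τ) = ∫ _ in (0 : ℝ)..1, c := by
    refine intervalIntegral.integral_congr_ae ?_
    filter_upwards [(countable_singleton (1 : ℝ)).ae_notMem volume] with τ hτ hτ'
    rw [uIoc_of_le zero_le_one] at hτ'
    rw [lineMap_eq]
    exact h τ hτ'.1 (lt_of_le_of_ne hτ'.2 hτ)
  rw [this]; simp

/-! ### Calibrations -/

/-- The continuous function with slopes `l`, `m`, `r` to the left of `c₁`, between `c₁` and `c₂`,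
and to the right of `c₂`. -/
noncomputable def ramp (c₁ c₂ l m r x : ℝ) : ℝ :=
  m * (x - c₁) + (l - m) * min (x - c₁) 0 + (r - m) * max (x - c₂) 0

open Classical in
/-- The slope of `ramp`. -/
noncomputable def rampSlope (c₁ c₂ l m r x : ℝ) : ℝ := if x < c₁ then l else if x < c₂ then m else r

theorem continuous_ramp (c₁ c₂ l m r : ℝ) : Continuous (ramp c₁ c₂ l m r) := by
  unfold ramp; fun_prop

theorem hasDerivAt_ramp {c₁ c₂ : ℝ} (hc : c₁ ≤ c₂) (l m r : ℝ) {x : ℝ} (h1 : x ≠ c₁)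
    (h2 : x ≠ c₂) : HasDerivAt (ramp c₁ c₂ l m r) (rampSlope c₁ c₂ l m r x) x := by
  have key : ∀ a b : ℝ, HasDerivAt (fun z => a * (z - b)) a x := fun a b => by
    simpa using ((hasDerivAt_id x).sub_const b).const_mul a
  rcases lt_or_gt_of_ne h1 with h | h
  · rw [rampSlope, if_pos h]
    refine (key l c₁).congr_of_eventuallyEq ?_
    filter_upwards [Iio_mem_nhds h] with z hz
    have hz : z < c₁ := hz
    rw [ramp, min_eq_left (by linarith), max_eq_right (by linarith)]; ring
  · rcases lt_or_gt_of_ne h2 with h' | h'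
    · rw [rampSlope, if_neg h.le.not_gt, if_pos h']
      refine (key m c₁).congr_of_eventuallyEq ?_
      filter_upwards [Ioo_mem_nhds h h'] with z hz
      rw [ramp, min_eq_right (by linarith [hz.1]), max_eq_right (by linarith [hz.2])]; ring
    · rw [rampSlope, if_neg h.le.not_gt, if_neg h'.le.not_gt]
      have := (key r c₂).add_const (m * (c₂ - c₁))
      refine this.congr_of_eventuallyEq ?_
      filter_upwards [Ioi_mem_nhds h'] with z hz
      have hz : c₂ < z := hz
      rw [ramp, min_eq_right (by linarith), max_eq_left (by linarith)]; ring

theorem measurable_rampSlope (c₁ c₂ l m r : ℝ) : Measurable (rampSlope c₁ c₂ l m r) := by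
  classical
  unfold rampSlope
  refine Measurable.ite measurableSet_Iio measurable_const ?_
  exact Measurable.ite measurableSet_Iio measurable_const measurable_const

theorem abs_rampSlope_le (c₁ c₂ l m r x : ℝ) : |rampSlope c₁ c₂ l m r x| ≤ |l| + |m| + |r| := by
  unfold rampSlope
  split_ifs <;> linarith [abs_nonneg l, abs_nonneg m, abs_nonneg r]

/-- If `d = 0` the composite is constant. Thus a segment that runs along a kink does no harm:
whatever value the slope takes there, it is multiplied by zero. -/
theorem hasDerivAt_ramp_comp {c₁ c₂ : ℝ} (hc : c₁ ≤ c₂) (l m r x d : ℝ) {τ : ℝ}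
    (h : d = 0 ∨ (x + τ * d ≠ c₁ ∧ x + τ * d ≠ c₂)) :
    HasDerivAt (fun z => ramp c₁ c₂ l m r (x + z * d)) (rampSlope c₁ c₂ l m r (x + τ * d) * d) τ := by
  rcases h with rfl | ⟨h1, h2⟩
  · simpa using hasDerivAt_const τ (ramp c₁ c₂ l m r x)
  · have := ((hasDerivAt_id τ).mul_const d).const_add x
    simp only [id, one_mul] at this
    exact (hasDerivAt_ramp hc l m r h1 h2).comp τ this

/-- Without `d ≠ 0` a coordinate that stays equal to `c` would contribute every parameter. -/
theorem countable_hits (x d c : ℝ) : {τ : ℝ | d ≠ 0 ∧ x + τ * d = c}.Countable := by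
  by_cases hd : d = 0
  · simp [hd]
  · refine (countable_singleton ((c - x) / d)).mono ?_
    rintro τ ⟨_, h⟩
    rw [mem_singleton_iff, eq_div_iff hd]; linarith

/-- The Euclidean norm of a vector, in coordinates. -/
noncomputable def hyp (a b : ℝ) : ℝ := √(a ^ 2 + b ^ 2)

theorem hyp_nonneg (a b : ℝ) : 0 ≤ hyp a b := Real.sqrt_nonneg _

theorem hyp_sq (a b : ℝ) : hyp a b ^ 2 = a ^ 2 + b ^ 2 := Real.sq_sqrt (by positivity)

/-- Cauchy–Schwarz, by Lagrange's identity. -/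
theorem mul_add_mul_le_hyp {a b c d e : ℝ} (he : 0 ≤ e) (h : a ^ 2 + b ^ 2 ≤ e ^ 2) :
    a * c + b * d ≤ e * hyp c d := by
  refine le_of_sq_le_sq ?_ (mul_nonneg he (hyp_nonneg c d))
  rw [mul_pow, hyp_sq]
  nlinarith [sq_nonneg (a * d - b * c),
    mul_le_mul_of_nonneg_right h (by positivity : 0 ≤ c ^ 2 + d ^ 2)]

/-- Slopes of a function `A x + B y` that does not grow faster than the weighted length. -/
structure IsCalibration (α l m r b₁ b₂ b₃ : ℝ) : Prop where
  lb : l ^ 2 + b₁ ^ 2 ≤ 1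
  lm : l ^ 2 + b₂ ^ 2 ≤ 1
  lt : l ^ 2 + b₃ ^ 2 ≤ 1
  mb : m ^ 2 + b₁ ^ 2 ≤ 1
  mm : m ^ 2 + b₂ ^ 2 ≤ α ^ 2
  mt : m ^ 2 + b₃ ^ 2 ≤ 1
  rb : r ^ 2 + b₁ ^ 2 ≤ 1
  rm : r ^ 2 + b₂ ^ 2 ≤ 1
  rt : r ^ 2 + b₃ ^ 2 ≤ 1

/-- Off the edges this is Cauchy–Schwarz on one box. Motion along an edge only feels the slope in
the direction of that edge, which is `m` or `b₂`. Its square is at most α² by `mm` and at most 1 by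
a neighbouring box, hence at most the square of the edge weight. -/
theorem IsCalibration.mul_le {α l m r b₁ b₂ b₃ : ℝ} (h : IsCalibration α l m r b₁ b₂ b₃)
    (hα : 0 < α) {W x y c d : ℝ} (hx : c = 0 ∨ (x ≠ 0 ∧ x ≠ W)) (hy : d = 0 ∨ (y ≠ -1 ∧ y ≠ 0)) :
    rampSlope 0 W l m r x * c + rampSlope (-1) 0 b₁ b₂ b₃ y * d ≤ hyp c d * weight α W (x, y) := by
  obtain ⟨h1, h2, h3, h4, h5, h6, h7, h8, h9⟩ := h
  have hw : 0 ≤ weight α W (x, y) := weight_nonneg hα _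
  have key : ∀ a b : ℝ, a ^ 2 + b ^ 2 ≤ 1 → weight α W (x, y) = 1 →
      a * c + b * d ≤ hyp c d * weight α W (x, y) := fun a b hab he => by
    rw [he, mul_one]
    have := mul_add_mul_le_hyp (c := c) (d := d) zero_le_one (hab.trans (one_pow 2).ge)
    linarith
  have key' : m * c + b₂ * d ≤ hyp c d * α := by
    rw [mul_comm _ α]
    exact mul_add_mul_le_hyp hα.le h5
  have hm : m ^ 2 ≤ (min 1 α) ^ 2 := by
    rcases min_choice 1 α with h | h <;> rw [h] <;> nlinarith [sq_nonneg b₂, sq_nonneg b₁]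
  have hb : b₂ ^ 2 ≤ (min 1 α) ^ 2 := by
    rcases min_choice 1 α with h | h <;> rw [h] <;> nlinarith [sq_nonneg m, sq_nonneg l]
  have hmin : 0 ≤ min 1 α := le_min zero_le_one hα.le
  have key2 : d = 0 → (0 ≤ x ∧ x ≤ W) ∧ -1 ≤ y ∧ y ≤ 0 →
      m * c ≤ hyp c d * weight α W (x, y) := fun hd hr => by
    by_cases hi : (0 < x ∧ x < W) ∧ -1 < y ∧ y < 0
    · rw [weight_of_inside hi.1.1 hi.1.2 hi.2.1 hi.2.2]
      simpa [hd] using key'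
    · rw [weight_of_edge hr hi, mul_comm _ (min 1 α)]
      simpa using mul_add_mul_le_hyp (a := m) (b := 0) (c := c) (d := d) hmin (by simpa using hm)
  have key3 : c = 0 → (0 ≤ x ∧ x ≤ W) ∧ -1 ≤ y ∧ y ≤ 0 →
      b₂ * d ≤ hyp c d * weight α W (x, y) := fun hd hr => by
    by_cases hi : (0 < x ∧ x < W) ∧ -1 < y ∧ y < 0
    · rw [weight_of_inside hi.1.1 hi.1.2 hi.2.1 hi.2.2]
      simpa [hd] using key'
    · rw [weight_of_edge hr hi, mul_comm _ (min 1 α)]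
      simpa using mul_add_mul_le_hyp (a := 0) (b := b₂) (c := c) (d := d) hmin (by simpa using hb)
  rcases hx with rfl | ⟨hx1, hx2⟩ <;> rcases hy with rfl | ⟨hy1, hy2⟩
  · simpa using mul_nonneg (hyp_nonneg _ _) hw
  · by_cases hr : (0 ≤ x ∧ x ≤ W) ∧ -1 ≤ y ∧ y ≤ 0
    · rw [rampSlope, rampSlope, if_neg hr.2.1.not_gt, if_pos (lt_of_le_of_ne hr.2.2 hy2), mul_zero,
        zero_add]
      exact key3 rfl hr
    · rw [mul_zero, zero_add]
      have := key 0 (rampSlope (-1) 0 b₁ b₂ b₃ y) (by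
        unfold rampSlope; split_ifs <;> nlinarith) (weight_of_outside hr)
      simpa using this
  · by_cases hr : (0 ≤ x ∧ x ≤ W) ∧ -1 ≤ y ∧ y ≤ 0
    · rw [rampSlope, if_neg hr.1.1.not_gt, if_pos (lt_of_le_of_ne hr.1.2 hx2), mul_zero, add_zero]
      exact key2 rfl hr
    · rw [mul_zero, add_zero]
      have := key (rampSlope 0 W l m r x) 0 (by
        unfold rampSlope; split_ifs <;> nlinarith) (weight_of_outside hr)
      simpa using this
  · by_cases hr : (0 ≤ x ∧ x ≤ W) ∧ -1 ≤ y ∧ y ≤ 0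
    · have e1 := lt_of_le_of_ne hr.1.2 hx2
      have e2 := lt_of_le_of_ne hr.2.2 hy2
      rw [rampSlope, if_neg hr.1.1.not_gt, if_pos e1, rampSlope, if_neg hr.2.1.not_gt, if_pos e2,
        weight_of_inside (lt_of_le_of_ne hr.1.1 hx1.symm) e1
          (lt_of_le_of_ne hr.2.1 hy1.symm) e2]
      exact key'
    · refine key _ _ ?_ (weight_of_outside hr)
      unfold rampSlope
      split_ifs with g1 g2 g3 g4 g5 g6 g7 g8 <;> try assumption
      exact absurd ⟨⟨not_lt.1 g1, g4.le⟩, not_lt.1 g5, g6.le⟩ hr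

/-- The function with the slopes of a calibration. -/
noncomputable def potential (W l m r b₁ b₂ b₃ : ℝ) (p : ℝ × ℝ) : ℝ :=
  ramp 0 W l m r p.1 + ramp (-1) 0 b₁ b₂ b₃ p.2

/-- The fundamental theorem of calculus along the segment: the potential is continuous, and
differentiable except at the countably many parameters where a kink is crossed. -/
theorem IsCalibration.sub_le_segLength {α l m r b₁ b₂ b₃ : ℝ}
    (h : IsCalibration α l m r b₁ b₂ b₃) (hα : 0 < α) {W : ℝ} (hW : 0 ≤ W) (p q : ℝ × ℝ) :
    potential W l m r b₁ b₂ b₃ q - potential W l m r b₁ b₂ b₃ p ≤ segLength α W p q := by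
  set c := q.1 - p.1 with hc
  set d := q.2 - p.2 with hd
  set f' : ℝ → ℝ := fun τ => rampSlope 0 W l m r (p.1 + τ * c) * c +
    rampSlope (-1) 0 b₁ b₂ b₃ (p.2 + τ * d) * d with hf'
  set f : ℝ → ℝ := fun τ => ramp 0 W l m r (p.1 + τ * c) + ramp (-1) 0 b₁ b₂ b₃ (p.2 + τ * d)
    with hf
  set S : Set ℝ := ({τ | c ≠ 0 ∧ p.1 + τ * c = 0} ∪ {τ | c ≠ 0 ∧ p.1 + τ * c = W}) ∪
    ({τ | d ≠ 0 ∧ p.2 + τ * d = -1} ∪ {τ | d ≠ 0 ∧ p.2 + τ * d = 0}) with hS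
  have hcount : S.Countable := ((countable_hits _ _ _).union (countable_hits _ _ _)).union
    ((countable_hits _ _ _).union (countable_hits _ _ _))
  have hgood : ∀ τ ∉ S, (c = 0 ∨ (p.1 + τ * c ≠ 0 ∧ p.1 + τ * c ≠ W)) ∧
      (d = 0 ∨ (p.2 + τ * d ≠ -1 ∧ p.2 + τ * d ≠ 0)) := by
    intro τ hτ
    simp only [hS, mem_union, mem_ofPred_eq] at hτ
    tauto
  have hmeas : Measurable f' := by
    have h1 := (measurable_rampSlope 0 W l m r).comp
      (by fun_prop : Measurable fun τ : ℝ => p.1 + τ * c)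
    have h2 := (measurable_rampSlope (-1) 0 b₁ b₂ b₃).comp
      (by fun_prop : Measurable fun τ : ℝ => p.2 + τ * d)
    exact (h1.mul_const c).add (h2.mul_const d)
  have hint : IntervalIntegrable f' volume 0 1 := by
    refine intervalIntegrable_of_measurable_of_bound hmeas
      (C := (|l| + |m| + |r|) * |c| + (|b₁| + |b₂| + |b₃|) * |d|) (fun τ => ?_) 0 1
    refine (abs_add_le _ _).trans ?_
    rw [abs_mul, abs_mul]
    gcongr <;> exact abs_rampSlope_le _ _ _ _ _ _
  have hcont : Continuous f := by
    have h1 := (continuous_ramp 0 W l m r).comp (by fun_prop : Continuous fun τ : ℝ => p.1 + τ * c)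
    have h2 := (continuous_ramp (-1) 0 b₁ b₂ b₃).comp
      (by fun_prop : Continuous fun τ : ℝ => p.2 + τ * d)
    exact h1.add h2
  have hftc := MeasureTheory.integral_eq_of_hasDerivAt_off_countable f f' hcount
    hcont.continuousOn (a := 0) (b := 1) (fun τ hτ => by
      obtain ⟨g1, g2⟩ := hgood τ hτ.2
      exact (hasDerivAt_ramp_comp hW l m r p.1 c g1).add
        (hasDerivAt_ramp_comp (by norm_num) b₁ b₂ b₃ p.2 d g2)) hint
  have e1 : f 1 - f 0 = potential W l m r b₁ b₂ b₃ q - potential W l m r b₁ b₂ b₃ p := by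
    simp only [hf, potential, hc, hd]; congr 1 <;> congr 1 <;> congr 1 <;> ring
  rw [← e1, ← hftc, segLength, ← intervalIntegral.integral_const_mul]
  refine intervalIntegral.integral_mono_ae_restrict zero_le_one hint
    ((intervalIntegrable_weight hα p q).const_mul _) ?_
  refine ae_restrict_of_ae ?_
  filter_upwards [hcount.ae_notMem volume] with τ hτ
  obtain ⟨g1, g2⟩ := hgood τ hτ
  rw [lineMap_eq, euclid_comm]
  exact h.mul_le hα g1 g2

theorem IsCalibration.sub_le_chainLength {α l m r b₁ b₂ b₃ : ℝ}
    (h : IsCalibration α l m r b₁ b₂ b₃) (hα : 0 < α) {W : ℝ} (hW : 0 ≤ W) (q : ℝ × ℝ) :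
    ∀ (v : List (ℝ × ℝ)) (p : ℝ × ℝ),
    potential W l m r b₁ b₂ b₃ q - potential W l m r b₁ b₂ b₃ p ≤ chainLength α W (p :: (v ++ [q]))
  | [], p => by
      simpa [chainLength] using h.sub_le_segLength hα hW p q
  | z :: v, p => by
      have h1 := h.sub_le_segLength hα hW p z
      have h2 := h.sub_le_chainLength hα hW q v z
      simp only [List.cons_append, chainLength]
      linarith

/-- The subtracted terms are the potential at the source: both ramps vanish at the lower left
corner, and the source lies `sx` to the right of it and one unit above. -/
theorem IsCalibration.le_pathLength {α l m r b₁ b₂ b₃ : ℝ}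
    (h : IsCalibration α l m r b₁ b₂ b₃) (hα : 0 < α) {W sx : ℝ} (hsx : 0 ≤ sx) (hW : sx ≤ W)
    (t : ℝ × ℝ) (v : List (ℝ × ℝ)) :
    potential W l m r b₁ b₂ b₃ t - m * sx - b₂ ≤ pathLength α W sx t v := by
  have h1 := h.sub_le_chainLength hα (hsx.trans hW) t v (sx, 0)
  have h2 : potential W l m r b₁ b₂ b₃ (sx, 0) = m * sx + b₂ := by
    simp [potential, ramp, hsx, hW]
  rw [h2] at h1
  unfold pathLength
  linarith

/-! ### The distance in the weighted plane -/

/-- The infimum of the lengths of the paths from `(sx, 0)` to `t`. -/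
noncomputable def spDist (α W sx : ℝ) (t : ℝ × ℝ) : ℝ :=
  ⨅ v : List (ℝ × ℝ), pathLength α W sx t v

theorem chainLength_nonneg {α W : ℝ} (hα : 0 < α) : ∀ v, 0 ≤ chainLength α W v
  | [] => le_rfl
  | [_] => le_rfl
  | p :: q :: l => add_nonneg (segLength_nonneg hα p q) (chainLength_nonneg hα (q :: l))

theorem chainLength_append {α W : ℝ} (q t : ℝ × ℝ) : ∀ (v : List (ℝ × ℝ)) (p : ℝ × ℝ),
    chainLength α W (p :: (v ++ [q] ++ [t])) =
      chainLength α W (p :: (v ++ [q])) + segLength α W q t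
  | [], p => by simp [chainLength]
  | z :: v, p => by
      have := chainLength_append (α := α) (W := W) q t v z
      simp only [List.cons_append, chainLength] at this ⊢
      rw [this]; ring

variable {α W sx : ℝ}

theorem bddBelow_pathLength (hα : 0 < α) (t : ℝ × ℝ) :
    BddBelow (range (pathLength α W sx t)) :=
  ⟨0, by rintro _ ⟨v, rfl⟩; exact chainLength_nonneg hα _⟩

theorem spDist_le (hα : 0 < α) (t : ℝ × ℝ) (v : List (ℝ × ℝ)) :
    spDist α W sx t ≤ pathLength α W sx t v := ciInf_le (bddBelow_pathLength hα t) v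

theorem IsShortest.eq_spDist (hα : 0 < α) {t : ℝ × ℝ} {v : List (ℝ × ℝ)}
    (h : IsShortest α W sx t v) : pathLength α W sx t v = spDist α W sx t :=
  le_antisymm (le_ciInf h) (spDist_le hα t v)

/-- Any path to `q` can be prolonged by the segment from `q` to `t`. -/
theorem spDist_le_add (hα : 0 < α) (t q : ℝ × ℝ) :
    spDist α W sx t ≤ spDist α W sx q + max 1 α * euclid q t := by
  rw [← sub_le_iff_le_add]
  refine le_ciInf fun v => ?_
  have h1 := spDist_le (W := W) (sx := sx) hα t (v ++ [q])
  have h2 := segLength_le (W := W) hα q t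
  rw [pathLength, chainLength_append] at h1
  rw [pathLength]
  linarith

theorem euclid_le_dist (p q : ℝ × ℝ) : euclid p q ≤ 2 * dist p q := by
  have h1 : |p.1 - q.1| ≤ dist p q := (Real.dist_eq p.1 q.1).symm.le.trans (le_max_left _ _)
  have h2 : |p.2 - q.2| ≤ dist p q := (Real.dist_eq p.2 q.2).symm.le.trans (le_max_right _ _)
  have h3 : 0 ≤ dist p q := dist_nonneg
  refine Real.sqrt_le_iff.2 ⟨by positivity, ?_⟩
  have h4 := sq_le_sq' (by linarith [abs_nonneg (p.1 - q.1)]) h1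
  have h5 := sq_le_sq' (by linarith [abs_nonneg (p.2 - q.2)]) h2
  rw [sq_abs] at h4 h5
  nlinarith

theorem continuous_spDist (hα : 0 < α) : Continuous (spDist α W sx) := by
  have hm : 0 ≤ max 1 α := zero_le_one.trans (le_max_left _ _)
  refine (LipschitzWith.of_dist_le_mul (K := NNReal.mk (max 1 α * 2) (by positivity)) fun p q => ?_).continuous
  have h1 := spDist_le_add (W := W) (sx := sx) hα p q
  have h2 := spDist_le_add (W := W) (sx := sx) hα q p
  have h3 := mul_le_mul_of_nonneg_left (euclid_le_dist p q) hm
  rw [euclid_comm q p] at h1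
  rw [Real.dist_eq, abs_sub_le_iff, NNReal.coe_mk]
  constructor <;> linarith

/-! ### Bisectors and edges of functions given by formulas -/

variable {i j : ℕ} {f g : ℝ × ℝ → ℝ}

/-- The condition `d = f t` is closed, so it passes to the closure of the graph; conversely `t ↦ (t,
f t)` is continuous and maps the domain into the graph. -/
theorem mem_closure_typeGraph_iff (hf : Continuous f)
    (h : ∀ t d, (t, d) ∈ typeGraph α W sx i → d = f t) {q : ℝ × ℝ} {d : ℝ} :
    (q, d) ∈ closure (typeGraph α W sx i) ↔ q ∈ closure (typeDomain α W sx i) ∧ d = f q := by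
  constructor
  · intro hq
    refine ⟨map_mem_closure continuous_fst hq ?_, ?_⟩
    · rintro ⟨t, d⟩ ht; exact ⟨d, ht⟩
    · exact closure_minimal (t := {z : (ℝ × ℝ) × ℝ | z.2 = f z.1}) (fun z hz => h z.1 z.2 hz)
        (isClosed_eq continuous_snd (hf.comp continuous_fst)) hq
  · rintro ⟨hq, rfl⟩
    refine map_mem_closure (f := fun t => (t, f t)) (by fun_prop) hq ?_
    rintro t ⟨d, ht⟩
    obtain rfl := h t d ht
    exact ht

theorem mem_bisector_iff (hf : Continuous f) (hg : Continuous g)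
    (h : ∀ t d, (t, d) ∈ typeGraph α W sx i → d = f t)
    (h' : ∀ t d, (t, d) ∈ typeGraph α W sx j → d = g t) {q : ℝ × ℝ} :
    q ∈ bisector α W sx i j ↔ q ∉ frontier (rect W) ∧ q ∈ closure (typeDomain α W sx i) ∧
      q ∈ closure (typeDomain α W sx j) ∧ f q = g q := by
  simp only [bisector, mem_ofPred_eq, mem_closure_typeGraph_iff hf h,
    mem_closure_typeGraph_iff hg h']
  constructor
  · rintro ⟨h1, d, ⟨h2, h3⟩, h4, h5⟩
    exact ⟨h1, h2, h4, h3.symm.trans h5⟩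
  · rintro ⟨h1, h2, h3, h4⟩
    exact ⟨h1, _, ⟨h2, rfl⟩, h3, h4⟩

theorem bisector_eq_curvePart (hf : Continuous f) (hg : Continuous g)
    (h : ∀ t d, (t, d) ∈ typeGraph α W sx i → d = f t)
    (h' : ∀ t d, (t, d) ∈ typeGraph α W sx j → d = g t) {C : Set (ℝ × ℝ)}
    (hC : ∀ q, q ∉ frontier (rect W) → q ∈ closure (typeDomain α W sx i) →
      q ∈ closure (typeDomain α W sx j) → (f q = g q ↔ q ∈ C)) :
    bisector α W sx i j = curvePart α W sx i j C := by
  ext q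
  rw [mem_bisector_iff hf hg h h']
  constructor
  · rintro ⟨h1, h2, h3, h4⟩
    exact ⟨h1, h2, h3, (hC q h1 h2 h3).1 h4⟩
  · rintro ⟨h1, h2, h3, h4⟩
    exact ⟨h1, h2, h3, (hC q h1 h2 h3).2 h4⟩

theorem mem_typeGraph_of_mem_cell (hα : 0 < α) {t : ℝ × ℝ} (h : t ∈ cell α W sx i) :
    (t, spDist α W sx t) ∈ typeGraph α W sx i := by
  obtain ⟨h1, v, hv, h2⟩ := h
  refine ⟨h1, ⟨v, hv, h2.eq_spDist hα⟩, ?_⟩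
  rintro _ ⟨w, _, rfl⟩
  exact spDist_le hα t w

theorem cell_subset_typeDomain (hα : 0 < α) : cell α W sx i ⊆ typeDomain α W sx i :=
  fun _ h => ⟨_, mem_typeGraph_of_mem_cell hα h⟩

/-- Two continuous functions that agree on the cell agree on its closure. Besides placing edges on
bisectors, this excludes edges, by comparing lengths at a single point. -/
theorem eq_spDist_of_mem_closure_cell (hα : 0 < α) (hf : Continuous f)
    (h : ∀ t d, (t, d) ∈ typeGraph α W sx i → d = f t) {q : ℝ × ℝ}
    (hq : q ∈ closure (cell α W sx i)) : spDist α W sx q = f q :=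
  closure_minimal (t := {z | spDist α W sx z = f z})
    (fun _ hz => h _ _ (mem_typeGraph_of_mem_cell hα hz))
    (isClosed_eq (continuous_spDist hα) hf) hq

theorem spmEdge_subset_bisector (hα : 0 < α) (hf : Continuous f) (hg : Continuous g)
    (h : ∀ t d, (t, d) ∈ typeGraph α W sx i → d = f t)
    (h' : ∀ t d, (t, d) ∈ typeGraph α W sx j → d = g t) :
    spmEdge α W sx i j ⊆ bisector α W sx i j := by
  rintro q ⟨h1, h2, h3⟩
  rw [mem_bisector_iff hf hg h h']
  exact ⟨h1, closure_mono (cell_subset_typeDomain hα) h2,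
    closure_mono (cell_subset_typeDomain hα) h3,
    (eq_spDist_of_mem_closure_cell hα hf h h2).symm.trans
      (eq_spDist_of_mem_closure_cell hα hg h' h3)⟩

end

section

/-! ### Calculus of the Euclidean norm -/

@[fun_prop]
theorem Continuous.hyp {X : Type*} [TopologicalSpace X] {f g : X → ℝ} (hf : Continuous f)
    (hg : Continuous g) : Continuous fun x => hyp (f x) (g x) := by
  unfold WeightedRectangle.hyp; fun_prop

theorem hyp_neg_left (a b : ℝ) : hyp (-a) b = hyp a b := by simp [hyp]

theorem hyp_neg_right (a b : ℝ) : hyp a (-b) = hyp a b := by simp [hyp]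

theorem hyp_sub_left (a b c : ℝ) : hyp (a - b) c = hyp (b - a) c := by
  rw [← neg_sub, hyp_neg_left]

theorem hyp_sub_right (a b c : ℝ) : hyp c (a - b) = hyp c (b - a) := by
  rw [← neg_sub, hyp_neg_right]

theorem hyp_zero_right (a : ℝ) : hyp a 0 = |a| := by simp [hyp, Real.sqrt_sq_eq_abs]

theorem hyp_zero_left (a : ℝ) : hyp 0 a = |a| := by simp [hyp, Real.sqrt_sq_eq_abs]

theorem hyp_comm (a b : ℝ) : hyp a b = hyp b a := by unfold hyp; rw [add_comm]

theorem hyp_pos_left {a : ℝ} (b : ℝ) (h : a ≠ 0) : 0 < hyp a b :=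
  Real.sqrt_pos.2 (by positivity)

theorem hyp_pos_right (a : ℝ) {b : ℝ} (h : b ≠ 0) : 0 < hyp a b :=
  Real.sqrt_pos.2 (by positivity)

theorem hyp_eq_of_sq {a b c : ℝ} (hc : 0 ≤ c) (h : a ^ 2 + b ^ 2 = c ^ 2) : hyp a b = c := by
  rw [hyp, h, Real.sqrt_sq hc]

theorem hyp_mul {r : ℝ} (hr : 0 ≤ r) (a b : ℝ) : hyp (r * a) (r * b) = r * hyp a b := by
  refine hyp_eq_of_sq (mul_nonneg hr (hyp_nonneg a b)) ?_
  rw [mul_pow _ (hyp a b), hyp_sq]; ring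

/-- Equality in Cauchy–Schwarz: by Lagrange's identity the determinant has square zero. -/
theorem mul_add_mul_eq_hyp {a b c d e : ℝ} (h : a ^ 2 + b ^ 2 = e ^ 2)
    (h' : a * c + b * d = e * hyp c d) : a * d = b * c := by
  have h1 := hyp_sq c d
  have h2 : (a * c + b * d) ^ 2 = (a ^ 2 + b ^ 2) * (c ^ 2 + d ^ 2) := by
    rw [h', h, ← h1]; ring
  have : (a * d - b * c) ^ 2 = 0 := by linear_combination -h2
  linarith [pow_eq_zero_iff (two_ne_zero) |>.1 this]

theorem hyp_add_le (a b c d : ℝ) : hyp (a + c) (b + d) ≤ hyp a b + hyp c d := by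
  have h1 := mul_add_mul_le_hyp (a := a) (b := b) (c := c) (d := d) (hyp_nonneg a b)
    (hyp_sq a b).ge
  refine le_of_sq_le_sq ?_ (add_nonneg (hyp_nonneg _ _) (hyp_nonneg _ _))
  rw [add_sq, hyp_sq, hyp_sq, hyp_sq]
  linarith

/-- The strict triangle inequality, with non-parallelism expressed by a nonzero determinant. -/
theorem hyp_add_lt {a b c d : ℝ} (h : a * d ≠ b * c) : hyp (a + c) (b + d) < hyp a b + hyp c d := by
  refine lt_of_le_of_ne (hyp_add_le a b c d) fun he => h ?_
  refine mul_add_mul_eq_hyp (hyp_sq a b).symm ?_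
  have h1 := congrArg (· ^ 2) he
  simp only [add_sq, hyp_sq] at h1
  linarith

theorem hasDerivAt_hyp_left (a : ℝ) {b : ℝ} (h : hyp a b ≠ 0) :
    HasDerivAt (fun u => hyp u b) (a / hyp a b) a := by
  have h0 : a ^ 2 + b ^ 2 ≠ 0 := by rw [← hyp_sq]; positivity
  have h1 : HasDerivAt (fun u : ℝ => u ^ 2 + b ^ 2) (2 * a) a := by
    simpa using (hasDerivAt_pow 2 a).add_const (b ^ 2)
  have h2 : a / hyp a b = 2 * a / (2 * hyp a b) := by field_simp
  rw [h2]
  exact h1.sqrt h0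

theorem hasDerivAt_hyp_right {a : ℝ} (b : ℝ) (h : hyp a b ≠ 0) :
    HasDerivAt (fun u => hyp a u) (b / hyp a b) b := by
  simp only [hyp_comm a] at h ⊢
  exact hasDerivAt_hyp_left b h

theorem hasDerivAt_hyp_sub_left (a c : ℝ) {b : ℝ} (h : hyp (a - c) b ≠ 0) :
    HasDerivAt (fun u => hyp (u - c) b) ((a - c) / hyp (a - c) b) a := 
  (hasDerivAt_hyp_left (a - c) h).comp_sub_const a c

theorem hasDerivAt_hyp_sub_right {a : ℝ} (b c : ℝ) (h : hyp a (b - c) ≠ 0) :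
    HasDerivAt (fun u => hyp a (u - c)) ((b - c) / hyp a (b - c)) b := 
  (hasDerivAt_hyp_right (b - c) h).comp_sub_const b c

theorem deriv_eq_zero_of_isMinOn_Ioo {f : ℝ → ℝ} {f' x a b : ℝ} (hf : HasDerivAt f f' x)
    (h1 : a < x) (h2 : x < b) (h : ∀ y, a < y → y < b → f x ≤ f y) : f' = 0 := by
  have : IsLocalMin f x := by
    filter_upwards [Ioo_mem_nhds h1 h2] with y hy using h y hy.1 hy.2
  exact this.hasDerivAt_eq_zero hf

/-- This is applied at the end of a side, where a crossing point can be perturbed in one direction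
only. -/
theorem exists_lt_of_deriv_neg {f : ℝ → ℝ} {f' x b : ℝ} (hf : HasDerivAt f f' x)
    (h1 : f' < 0) (hb : x < b) : ∃ y, x < y ∧ y < b ∧ f y < f x := by
  have h2 := (hasDerivAt_iff_tendsto_slope.1 hf).eventually_lt_const h1
  have h3 : ∀ᶠ y in 𝓝[>] x, slope f x y < 0 :=
    h2.filter_mono (nhdsWithin_mono x fun y hy => ne_of_gt hy)
  obtain ⟨y, hy, hy'⟩ := (h3.and (Ioo_mem_nhdsGT hb)).exists
  refine ⟨y, hy'.1, hy'.2, ?_⟩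
  rw [slope_def_field, div_neg_iff] at hy
  rcases hy with hy | hy <;> linarith [hy.1, hy.2, hy'.1]

theorem exists_gt_of_deriv_pos {f : ℝ → ℝ} {f' x a : ℝ} (hf : HasDerivAt f f' x)
    (h1 : 0 < f') (ha : a < x) : ∃ y, a < y ∧ y < x ∧ f y < f x := by
  have hf' : HasDerivAt (fun z => f (-z)) (-f') (-x) := by
    have := HasDerivAt.comp (-x) (by simpa using hf : HasDerivAt f f' (- -x)) (hasDerivAt_neg (-x))
    simpa [Function.comp_def] using this
  obtain ⟨y, h2, h3, h4⟩ := exists_lt_of_deriv_neg hf' (by linarith) (neg_lt_neg ha)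
  exact ⟨-y, by linarith, by linarith, by simpa using h4⟩

/-! ### Lengths of segments and of short chains -/

theorem lt_combo {a b c τ : ℝ} (h0 : 0 < τ) (h1 : τ < 1) (ha : c ≤ a) (hb : c ≤ b)
    (h : c < a ∨ c < b) : c < a + τ * (b - a) := by
  have e : a + τ * (b - a) - c = (1 - τ) * (a - c) + τ * (b - c) := by ring
  have h2 := mul_nonneg (sub_pos.2 h1).le (sub_nonneg.2 ha)
  have h3 := mul_nonneg h0.le (sub_nonneg.2 hb)
  rcases h with h | h
  · have := mul_pos (sub_pos.2 h1) (sub_pos.2 h); linarith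
  · have := mul_pos h0 (sub_pos.2 h); linarith

theorem combo_lt {a b c τ : ℝ} (h0 : 0 < τ) (h1 : τ < 1) (ha : a ≤ c) (hb : b ≤ c)
    (h : a < c ∨ b < c) : a + τ * (b - a) < c := by
  have := lt_combo h0 h1 (neg_le_neg ha) (neg_le_neg hb) (h.imp neg_lt_neg neg_lt_neg)
  linarith

theorem combo_le {a b c τ : ℝ} (h0 : 0 < τ) (h1 : τ < 1) (ha : a ≤ c) (hb : b ≤ c) :
    a + τ * (b - a) ≤ c := by
  have h2 := mul_nonneg (sub_pos.2 h1).le (sub_nonneg.2 ha)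
  have h3 := mul_nonneg h0.le (sub_nonneg.2 hb)
  linarith

theorem le_combo {a b c τ : ℝ} (h0 : 0 < τ) (h1 : τ < 1) (ha : c ≤ a) (hb : c ≤ b) :
    c ≤ a + τ * (b - a) := by
  have h2 := mul_nonneg (sub_pos.2 h1).le (sub_nonneg.2 ha)
  have h3 := mul_nonneg h0.le (sub_nonneg.2 hb)
  linarith

variable {α W sx x y x₁ y₁ x₂ y₂ : ℝ}

/-- Both endpoints lie in the closed rectangle and no side contains both of them, so the open
segment lies in the interior. -/
theorem segLength_inside (h1 : 0 ≤ x₁) (h2 : 0 ≤ x₂) (h3 : 0 < x₁ ∨ 0 < x₂) (h4 : x₁ ≤ W)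
    (h5 : x₂ ≤ W) (h6 : x₁ < W ∨ x₂ < W) (k1 : -1 ≤ y₁) (k2 : -1 ≤ y₂) (k3 : -1 < y₁ ∨ -1 < y₂)
    (k4 : y₁ ≤ 0) (k5 : y₂ ≤ 0) (k6 : y₁ < 0 ∨ y₂ < 0) :
    segLength α W (x₁, y₁) (x₂, y₂) = α * hyp (x₁ - x₂) (y₁ - y₂) :=
  segLength_of_weight_eq fun _ h0 h => weight_of_inside (lt_combo h0 h h1 h2 h3)
    (combo_lt h0 h h4 h5 h6) (lt_combo h0 h k1 k2 k3) (combo_lt h0 h k4 k5 k6)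

theorem segLength_outside (h : (x₁ ≤ 0 ∧ x₂ ≤ 0 ∧ (x₁ < 0 ∨ x₂ < 0)) ∨
    (0 ≤ y₁ ∧ 0 ≤ y₂ ∧ (0 < y₁ ∨ 0 < y₂)) ∨ (y₁ ≤ -1 ∧ y₂ ≤ -1 ∧ (y₁ < -1 ∨ y₂ < -1))) :
    segLength α W (x₁, y₁) (x₂, y₂) = hyp (x₁ - x₂) (y₁ - y₂) := by
  have := segLength_of_weight_eq (α := α) (W := W) (p := (x₁, y₁)) (q := (x₂, y₂)) (c := 1)
    fun τ h0 h1 => weight_of_outside ?_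
  · rw [this, one_mul]; rfl
  · rintro ⟨⟨g1, g2⟩, g3, g4⟩
    rcases h with ⟨a, b, c⟩ | ⟨a, b, c⟩ | ⟨a, b, c⟩
    · exact absurd (combo_lt h0 h1 a b c) g1.not_gt
    · exact absurd (lt_combo h0 h1 a b c) g4.not_gt
    · exact absurd (combo_lt h0 h1 a b c) g3.not_gt

/-- For `1 ≤ α` the left edge weighs as much as the outside, so segments contained in the line x = 0
are allowed. -/
theorem segLength_left_halfplane (hα : 1 ≤ α) (h1 : x₁ ≤ 0) (h2 : x₂ ≤ 0) :
    segLength α W (x₁, y₁) (x₂, y₂) = hyp (x₁ - x₂) (y₁ - y₂) := by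
  have := segLength_of_weight_eq (α := α) (W := W) (p := (x₁, y₁)) (q := (x₂, y₂)) (c := 1)
    fun τ h0 h => weight_of_not_inside hα fun h' => (combo_le h0 h h1 h2).not_gt h'.1.1
  rw [this, one_mul]; rfl

theorem segLength_top (hW : 0 ≤ x₂) (h : x₂ ≤ x₁) (h1 : x₁ ≤ W) :
    segLength α W (x₁, 0) (x₂, 0) = min 1 α * (x₁ - x₂) := by
  rw [segLength_of_weight_eq (c := min 1 α) fun τ h0 h' => weight_of_edge
    ⟨⟨le_combo h0 h' (hW.trans h) hW, combo_le h0 h' h1 (h.trans h1)⟩, by simp⟩ (by simp)]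
  rw [show euclid (x₁, 0) (x₂, 0) = hyp (x₁ - x₂) (0 - 0) from rfl, sub_zero, hyp_zero_right,
    abs_of_nonneg (sub_nonneg.2 h)]

theorem segLength_left (hW : 0 ≤ W) (h2 : -1 ≤ y₂) (h : y₂ ≤ y₁) (h1 : y₁ ≤ 0) :
    segLength α W (0, y₁) (0, y₂) = min 1 α * (y₁ - y₂) := by
  rw [segLength_of_weight_eq (c := min 1 α) fun τ h0 h' => weight_of_edge
    ⟨by simp [hW], le_combo h0 h' (h2.trans h) h2, combo_le h0 h' h1 (h.trans h1)⟩ (by simp)]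
  rw [show euclid (0, y₁) (0, y₂) = hyp (0 - 0) (y₁ - y₂) from rfl, sub_zero, hyp_zero_left,
    abs_of_nonneg (sub_nonneg.2 h)]

theorem pathLength_nil (t : ℝ × ℝ) : pathLength α W sx t [] = segLength α W (sx, 0) t := by
  simp [pathLength, chainLength]

theorem pathLength_one (t a : ℝ × ℝ) : pathLength α W sx t [a] =
    segLength α W (sx, 0) a + segLength α W a t := by
  simp [pathLength, chainLength]

theorem pathLength_two (t a b : ℝ × ℝ) : pathLength α W sx t [a, b] =
    segLength α W (sx, 0) a + segLength α W a b + segLength α W b t := by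
  simp [pathLength, chainLength, add_assoc]

theorem pathLength_three (t a b c : ℝ × ℝ) : pathLength α W sx t [a, b, c] =
    segLength α W (sx, 0) a + segLength α W a b + segLength α W b c + segLength α W c t := by
  simp [pathLength, chainLength, add_assoc]

theorem pathLength_direct_above (hy : 0 < y) : pathLength α W sx (x, y) [] = hyp (x - sx) y := by
  rw [pathLength_nil, segLength_outside (by right; left; exact ⟨le_rfl, hy.le, Or.inr hy⟩), zero_sub,
    hyp_neg_right, hyp_sub_left]

theorem pathLength_top {b : ℝ} (hW : sx ≤ W) (hb : 0 ≤ b) (hb' : b ≤ sx) (hy : 0 < y) :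
    pathLength α W sx (x, y) [(b, 0)] = min 1 α * (sx - b) + hyp (b - x) y := by
  rw [pathLength_one, segLength_top hb hb' hW,
    segLength_outside (by right; left; exact ⟨le_rfl, hy.le, Or.inr hy⟩), zero_sub,
    hyp_neg_right]

theorem pathLength_corner (hsx : 0 < sx) (hW : sx ≤ W) (hx : x < 0) :
    pathLength α W sx (x, y) [(0, 0)] = min 1 α * sx + hyp x y := by
  rw [pathLength_one, segLength_top le_rfl hsx.le hW,
    segLength_outside (by left; exact ⟨le_rfl, hx.le, Or.inr hx⟩), zero_sub, zero_sub,
    hyp_neg_right, hyp_neg_left, sub_zero]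

theorem segLength_source_left {w : ℝ} (hsx : 0 < sx) (hW : sx ≤ W) (hw : -1 ≤ w) (hw' : w < 0) :
    segLength α W (sx, 0) (0, w) = α * hyp sx w := by
  rw [segLength_inside hsx.le le_rfl (Or.inl hsx) hW (hsx.le.trans hW) (Or.inr (hsx.trans_le hW))
    (by norm_num) hw (by norm_num) le_rfl hw'.le (Or.inr hw'), sub_zero, zero_sub, hyp_neg_right]

theorem pathLength_left {w : ℝ} (hsx : 0 < sx) (hW : sx ≤ W) (hw : -1 ≤ w) (hw' : w < 0)
    (hx : x < 0) : pathLength α W sx (x, y) [(0, w)] = α * hyp sx w + hyp x (w - y) := by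
  rw [pathLength_one, segLength_source_left hsx hW hw hw',
    segLength_outside (by left; exact ⟨le_rfl, hx.le, Or.inr hx⟩), zero_sub, hyp_neg_left]

theorem pathLength_lower_corner (hsx : 0 < sx) (hW : sx ≤ W) (h : x < 0 ∨ y < -1) :
    pathLength α W sx (x, y) [(0, -1)] = α * hyp sx 1 + hyp x (y + 1) := by
  rw [pathLength_one, segLength_source_left hsx hW le_rfl (by norm_num), segLength_outside,
    zero_sub, hyp_neg_left, hyp_sub_right, sub_neg_eq_add, hyp_neg_right]
  rcases h with h | h
  · left; exact ⟨le_rfl, h.le, Or.inr h⟩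
  · right; right; exact ⟨le_rfl, h.le, Or.inr h⟩

theorem pathLength_bottom {w : ℝ} (hsx : 0 < sx) (hW : sx ≤ W) (hw : 0 ≤ w) (hw' : w < W)
    (hy : y < -1) :
    pathLength α W sx (x, y) [(w, -1)] = α * hyp (w - sx) 1 + hyp (w - x) (y + 1) := by
  rw [pathLength_one, segLength_inside hsx.le hw (Or.inl hsx) hW hw'.le (Or.inr hw') (by norm_num)
    le_rfl (by norm_num) le_rfl (by norm_num) (by norm_num),
    segLength_outside (by right; right; exact ⟨le_rfl, hy.le, Or.inr hy⟩), hyp_sub_left sx,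
    hyp_sub_right (-1) y, sub_neg_eq_add]
  norm_num

theorem pathLength_top_left {b₁ b₂ : ℝ} (hW : sx ≤ W) (h1 : 0 < b₁) (h2 : b₁ ≤ sx) (h3 : -1 ≤ b₂)
    (h4 : b₂ < 0) (hx : x < 0) : pathLength α W sx (x, y) [(b₁, 0), (0, b₂)] =
      min 1 α * (sx - b₁) + α * hyp b₁ b₂ + hyp x (b₂ - y) := by
  rw [pathLength_two, segLength_top h1.le h2 hW, segLength_source_left h1 (h2.trans hW) h3 h4,
    segLength_outside (by left; exact ⟨le_rfl, hx.le, Or.inr hx⟩), zero_sub, hyp_neg_left]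

/-- This variant admits `x = 0`, for targets straight below the left side. -/
theorem pathLength_top_left_of_one_le {b₁ b₂ : ℝ} (hα : 1 ≤ α) (hW : sx ≤ W) (h1 : 0 < b₁)
    (h2 : b₁ ≤ sx) (h3 : -1 ≤ b₂) (h4 : b₂ < 0) (hx : x ≤ 0) :
    pathLength α W sx (x, y) [(b₁, 0), (0, b₂)] = sx - b₁ + α * hyp b₁ b₂ + hyp x (b₂ - y) := by
  rw [pathLength_two, segLength_top h1.le h2 hW, segLength_source_left h1 (h2.trans hW) h3 h4,
    segLength_left_halfplane hα le_rfl hx, zero_sub, hyp_neg_left, min_eq_left hα, one_mul]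

theorem pathLength_left_corner {b : ℝ} (hsx : 0 < sx) (hW : sx ≤ W) (h1 : -1 ≤ b) (h2 : b < 0)
    (hy : y < -1) : pathLength α W sx (x, y) [(0, b), (0, -1)] =
      α * hyp sx b + min 1 α * (b + 1) + hyp x (y + 1) := by
  rw [pathLength_two, segLength_source_left hsx hW h1 h2,
    segLength_left (hsx.le.trans hW) le_rfl h1 h2.le,
    segLength_outside (by right; right; exact ⟨le_rfl, hy.le, Or.inr hy⟩), zero_sub, hyp_neg_left,
    hyp_sub_right, sub_neg_eq_add, sub_neg_eq_add]

theorem pathLength_left_bottom {b₁ b₂ b₃ : ℝ} (hsx : 0 < sx) (hW : sx ≤ W) (h1 : -1 < b₂)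
    (h2 : b₂ ≤ b₁) (h3 : b₁ < 0) (h4 : 0 < b₃) (h5 : b₃ < W) (hy : y < -1) :
    pathLength α W sx (x, y) [(0, b₁), (0, b₂), (b₃, -1)] =
      α * hyp sx b₁ + min 1 α * (b₁ - b₂) + α * hyp b₃ (b₂ + 1) + hyp (b₃ - x) (y + 1) := by
  rw [pathLength_three, segLength_source_left hsx hW (h1.le.trans h2) h3,
    segLength_left (hsx.le.trans hW) h1.le h2 h3.le,
    segLength_inside le_rfl h4.le (Or.inr h4) (hsx.le.trans hW) h5.le (Or.inr h5) h1.le le_rfl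
      (Or.inl h1) (h2.trans h3.le) (by norm_num) (Or.inr (by norm_num)),
    segLength_outside (by right; right; exact ⟨le_rfl, hy.le, Or.inr hy⟩), zero_sub, hyp_neg_left,
    hyp_sub_right (-1) y, sub_neg_eq_add, sub_neg_eq_add]

theorem pathLength_top_inside {b : ℝ} (hW : sx ≤ W) (hb : 0 ≤ b) (hb' : b ≤ sx)
    (hin : (x, y) ∈ interior (rect W)) :
    pathLength α W sx (x, y) [(b, 0)] = min 1 α * (sx - b) + α * hyp (b - x) y := by
  obtain ⟨⟨h1, h2⟩, h3, h4⟩ := mem_interior_rect.1 hin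
  simp only at h1 h2 h3 h4
  rw [pathLength_one, segLength_top hb hb' hW,
    segLength_inside hb h1.le (Or.inr h1) (hb'.trans hW) h2.le (Or.inr h2) (by norm_num) h3.le
      (Or.inr h3) le_rfl h4.le (Or.inr h4), zero_sub, hyp_neg_right]

theorem pathLength_direct_inside (hsx : 0 < sx) (hW : sx ≤ W) (hin : (x, y) ∈ interior (rect W)) :
    pathLength α W sx (x, y) [] = α * hyp (x - sx) y := by
  obtain ⟨⟨h1, h2⟩, h3, h4⟩ := mem_interior_rect.1 hin
  simp only at h1 h2 h3 h4
  rw [pathLength_nil, segLength_inside hsx.le h1.le (Or.inr h1) hW h2.le (Or.inr h2) (by norm_num)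
    h3.le (Or.inr h3) le_rfl h4.le (Or.inr h4), zero_sub, hyp_neg_right, hyp_sub_left]

theorem pathLength_left_inside {b₁ b₂ : ℝ} (hsx : 0 < sx) (hW : sx ≤ W) (g1 : -1 ≤ b₂)
    (g2 : b₂ ≤ b₁) (g3 : b₁ < 0) (hin : (x, y) ∈ interior (rect W)) :
    pathLength α W sx (x, y) [(0, b₁), (0, b₂)] =
      α * hyp sx b₁ + min 1 α * (b₁ - b₂) + α * hyp x (b₂ - y) := by
  obtain ⟨⟨h1, h2⟩, h3, h4⟩ := mem_interior_rect.1 hin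
  simp only at h1 h2 h3 h4
  rw [pathLength_two, segLength_source_left hsx hW (g1.trans g2) g3,
    segLength_left (hsx.le.trans hW) g1 g2 g3.le,
    segLength_inside le_rfl h1.le (Or.inr h1) (hsx.le.trans hW) h2.le (Or.inr h2) g1 h3.le
      (Or.inr h3) (g2.trans g3.le) h4.le (Or.inr h4), zero_sub, hyp_neg_left]

end

section

/-! ### Facts about the types that hold for all weights -/

variable {α W sx x y : ℝ} {i j : ℕ}

theorem mem_typeGraph_iff {t : ℝ × ℝ} {d : ℝ} : (t, d) ∈ typeGraph α W sx i ↔ t.1 ≤ sx ∧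
    (∃ v ∈ pathsOfType W sx t i, d = pathLength α W sx t v) ∧
      ∀ v ∈ pathsOfType W sx t i, d ≤ pathLength α W sx t v := by
  constructor
  · rintro ⟨h1, ⟨v, hv, hd⟩, h2⟩
    exact ⟨h1, ⟨v, hv, hd.symm⟩, fun w hw => h2 ⟨w, hw, rfl⟩⟩
  · rintro ⟨h1, ⟨v, hv, rfl⟩, h2⟩
    refine ⟨h1, ⟨v, hv, rfl⟩, ?_⟩
    rintro _ ⟨w, hw, rfl⟩
    exact h2 w hw

theorem of_mem_closure_typeDomain {P : ℝ × ℝ → Prop} (hP : IsClosed {q | P q})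
    (h : ∀ t d, (t, d) ∈ typeGraph α W sx i → P t) {q : ℝ × ℝ}
    (hq : q ∈ closure (typeDomain α W sx i)) : P q :=
  closure_minimal (t := {q | P q}) (fun t ht => ht.elim fun d hd => h t d hd) hP hq

theorem mem_cell_of_mem_typeDomain {f : ℝ × ℝ → ℝ}
    (h : ∀ t d, (t, d) ∈ typeGraph α W sx i → d = f t) {t : ℝ × ℝ}
    (ht : t ∈ typeDomain α W sx i) (hle : ∀ v, f t ≤ pathLength α W sx t v) :
    t ∈ cell α W sx i := by
  obtain ⟨d, hd⟩ := ht
  have hf := h t d hd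
  obtain ⟨h1, ⟨v, hv, hvd⟩, -⟩ := hd
  refine ⟨h1, v, hv, fun v' => ?_⟩
  have hvd : pathLength α W sx t v = d := hvd
  rw [hvd, hf]
  exact hle v'

theorem mem_closure_of_eventually {S : Set (ℝ × ℝ)} {f : ℝ → ℝ × ℝ} (hf : Continuous f)
    (h : ∀ᶠ ε in 𝓝[>] (0 : ℝ), f ε ∈ S) : f 0 ∈ closure S :=
  mem_closure_of_tendsto (hf.continuousAt.mono_left nhdsWithin_le_nhds) h

/-- The types use crossing points in open intervals, while the minimal lengths below are taken over
closed ones. -/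
theorem le_on_Icc {f : ℝ → ℝ} (hf : Continuous f) {a b d : ℝ} (hab : a < b)
    (h : ∀ w, a < w → w < b → d ≤ f w) : ∀ w ∈ Icc a b, d ≤ f w := by
  intro w hw
  rw [← closure_Ioo hab.ne] at hw
  exact closure_minimal (t := {w | d ≤ f w}) (fun w hw => h w hw.1 hw.2)
    (isClosed_le continuous_const hf) hw

/-- The sine u / `hyp x u` of a direction increases with u; clearing denominators avoids degenerate
cases. -/
theorem mul_hyp_le_mul_hyp {u v : ℝ} (x : ℝ) (hu : 0 ≤ u) (huv : u ≤ v) :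
    u * hyp x v ≤ v * hyp x u := by
  refine le_of_sq_le_sq ?_ (mul_nonneg (hu.trans huv) (hyp_nonneg _ _))
  rw [mul_pow, mul_pow, hyp_sq, hyp_sq]
  nlinarith [mul_le_mul_of_nonneg_right (pow_le_pow_left₀ hu huv 2) (sq_nonneg x)]

theorem ramp_of_le {c₁ c₂ l m r x : ℝ} (h : c₁ ≤ c₂) (hx : x ≤ c₁) :
    ramp c₁ c₂ l m r x = l * (x - c₁) := by
  rw [ramp, min_eq_left (by linarith), max_eq_right (by linarith)]; ring

theorem ramp_of_mem {c₁ c₂ l m r x : ℝ} (h1 : c₁ ≤ x) (h2 : x ≤ c₂) :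
    ramp c₁ c₂ l m r x = m * (x - c₁) := by
  rw [ramp, min_eq_right (by linarith), max_eq_right (by linarith)]; ring

theorem ramp_of_ge {c₁ c₂ l m r x : ℝ} (h : c₁ ≤ c₂) (hx : c₂ ≤ x) :
    ramp c₁ c₂ l m r x = m * (c₂ - c₁) + r * (x - c₂) := by
  rw [ramp, min_eq_right (by linarith), max_eq_left (by linarith)]; ring

theorem ramp_same {c₁ c₂ l x : ℝ} : ramp c₁ c₂ l l l x = l * (x - c₁) := by
  rw [ramp]; ring

/-- The length of the path of type 1 to `t`. -/
noncomputable def directLength (sx : ℝ) (t : ℝ × ℝ) : ℝ := hyp (t.1 - sx) t.2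

/-- The length of the path to `t` that leaves the rectangle at the point `(0, w)`. -/
noncomputable def leftLength (α sx : ℝ) (t : ℝ × ℝ) (w : ℝ) : ℝ :=
  α * hyp sx w + hyp t.1 (w - t.2)

/-- The length of the shortest path to `t` that leaves the rectangle at the left side. -/
noncomputable def minLeftLength (α sx : ℝ) (t : ℝ × ℝ) : ℝ :=
  sInf (leftLength α sx t '' Icc (-1) 0)

/-- The length of the path to `t` that leaves the rectangle at the lower left corner. -/
noncomputable def cornerLength (α sx : ℝ) (t : ℝ × ℝ) : ℝ := α * hyp sx 1 + hyp t.1 (t.2 + 1)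

@[fun_prop]
theorem continuous_directLength : Continuous (directLength sx) := by
  unfold directLength; fun_prop

@[fun_prop]
theorem continuous_leftLength (t : ℝ × ℝ) : Continuous (leftLength α sx t) := by
  unfold leftLength; fun_prop

theorem continuous_minLeftLength : Continuous (minLeftLength α sx) := by
  refine isCompact_Icc.continuous_sInf ?_
  unfold leftLength Function.HasUncurry.uncurry
  simp only [Function.hasUncurryInduction]
  fun_prop

theorem continuous_cornerLength : Continuous (cornerLength α sx) := by
  unfold cornerLength; fun_prop

theorem minLeftLength_eq_iff {t : ℝ × ℝ} {w : ℝ} (hw : w ∈ Icc (-1 : ℝ) 0) :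
    minLeftLength α sx t = leftLength α sx t w ↔
      ∀ w' ∈ Icc (-1 : ℝ) 0, leftLength α sx t w ≤ leftLength α sx t w' := by
  constructor
  · intro h w' hw'
    rw [← h]
    exact csInf_le (isCompact_Icc.image (continuous_leftLength t)).bddBelow ⟨w', hw', rfl⟩
  · intro h
    refine IsLeast.csInf_eq ⟨⟨w, hw, rfl⟩, ?_⟩
    rintro _ ⟨w', hw', rfl⟩
    exact h w' hw'

theorem exists_minLeftLength_eq (t : ℝ × ℝ) :
    ∃ w ∈ Icc (-1 : ℝ) 0, minLeftLength α sx t = leftLength α sx t w := by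
  obtain ⟨w, hw, h⟩ := (isCompact_Icc (a := (-1 : ℝ)) (b := 0)).exists_isMinOn (by simp)
    (continuous_leftLength (α := α) (sx := sx) t).continuousOn
  exact ⟨w, hw, (minLeftLength_eq_iff hw).2 fun w' hw' => h hw'⟩

theorem cornerLength_eq (t : ℝ × ℝ) : cornerLength α sx t = leftLength α sx t (-1) := by
  rw [cornerLength, leftLength, hyp_neg_right, ← hyp_neg_right t.1 (t.2 + 1)]; ring_nf

theorem hasDerivAt_leftLength (hsx : 0 < sx) {t : ℝ × ℝ} {w : ℝ} (h : hyp t.1 (w - t.2) ≠ 0) :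
    HasDerivAt (leftLength α sx t)
      (α * (w / hyp sx w) + (w - t.2) / hyp t.1 (w - t.2)) w :=
  ((hasDerivAt_hyp_right w (hyp_pos_left w hsx.ne').ne').const_mul α).add
    (hasDerivAt_hyp_sub_right w t.2 h)

/-! ### Lengths and closed domains of types 1, 3, 4, 9 and 6 -/

theorem eq_directLength_of_mem_typeGraph :
    ∀ t d, (t, d) ∈ typeGraph α W sx 1 → d = directLength sx t := by
  rintro ⟨x, y⟩ d h
  obtain ⟨hx, ⟨v, ⟨hy, rfl⟩, rfl⟩, -⟩ := mem_typeGraph_iff.1 h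
  exact pathLength_direct_above hy

theorem mem_closure_typeDomain_one {q : ℝ × ℝ} (hq : q ∈ closure (typeDomain α W sx 1)) :
    0 ≤ q.2 := by
  refine of_mem_closure_typeDomain (P := fun q => 0 ≤ q.2)
    (isClosed_le continuous_const continuous_snd) ?_ hq
  rintro t d h
  obtain ⟨hx, ⟨v, ⟨hy, rfl⟩, rfl⟩, -⟩ := mem_typeGraph_iff.1 h
  exact hy.le

theorem mem_closure_typeDomain_three {q : ℝ × ℝ} (hq : q ∈ closure (typeDomain α W sx 3)) :
    q.1 ≤ 0 ∧ 0 ≤ q.2 := by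
  refine of_mem_closure_typeDomain (P := fun q => q.1 ≤ 0 ∧ 0 ≤ q.2)
    ((isClosed_le continuous_fst continuous_const).inter
      (isClosed_le continuous_const continuous_snd)) ?_ hq
  rintro t d h
  obtain ⟨hx, ⟨v, ⟨hx', hy, rfl⟩, rfl⟩, -⟩ := mem_typeGraph_iff.1 h
  exact ⟨hx'.le, hy.le⟩

theorem mem_closure_typeDomain_four {q : ℝ × ℝ} (hq : q ∈ closure (typeDomain α W sx 4)) :
    q.1 ≤ 0 ∧ q.2 ≤ 0 := by
  refine of_mem_closure_typeDomain (P := fun q => q.1 ≤ 0 ∧ q.2 ≤ 0)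
    ((isClosed_le continuous_fst continuous_const).inter
      (isClosed_le continuous_snd continuous_const)) ?_ hq
  rintro t d h
  obtain ⟨hx, ⟨v, ⟨hx', hy, rfl⟩, rfl⟩, -⟩ := mem_typeGraph_iff.1 h
  exact ⟨hx'.le, hy.le⟩

theorem mem_closure_typeDomain_nine {q : ℝ × ℝ} (hq : q ∈ closure (typeDomain α W sx 9)) :
    q.1 ≤ 0 ∧ q.2 ≤ -1 := by
  refine of_mem_closure_typeDomain (P := fun q => q.1 ≤ 0 ∧ q.2 ≤ -1)
    ((isClosed_le continuous_fst continuous_const).inter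
      (isClosed_le continuous_snd continuous_const)) ?_ hq
  rintro t d h
  obtain ⟨hx, ⟨v, ⟨hx', hy, rfl⟩, rfl⟩, -⟩ := mem_typeGraph_iff.1 h
  exact ⟨hx'.le, hy.le⟩

theorem eq_cornerLength_of_mem_typeGraph (hsx : 0 < sx) (hW : sx ≤ W) :
    ∀ t d, (t, d) ∈ typeGraph α W sx 9 → d = cornerLength α sx t := by
  rintro ⟨x, y⟩ d h
  obtain ⟨hx, ⟨v, ⟨hx', hy, rfl⟩, rfl⟩, -⟩ := mem_typeGraph_iff.1 h
  exact pathLength_lower_corner hsx hW (Or.inl hx')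

theorem eq_of_mem_typeGraph_three (hsx : 0 < sx) (hW : sx ≤ W) :
    ∀ t d, (t, d) ∈ typeGraph α W sx 3 → d = min 1 α * sx + hyp t.1 t.2 := by
  rintro ⟨x, y⟩ d h
  obtain ⟨hx, ⟨v, ⟨hx', hy, rfl⟩, rfl⟩, -⟩ := mem_typeGraph_iff.1 h
  exact pathLength_corner hsx hW hx'

theorem eq_of_mem_typeGraph_four (hsx : 0 < sx) (hW : sx ≤ W) :
    ∀ t d, (t, d) ∈ typeGraph α W sx 4 → d = min 1 α * sx + hyp t.1 t.2 := by
  rintro ⟨x, y⟩ d h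
  obtain ⟨hx, ⟨v, ⟨hx', hy, rfl⟩, rfl⟩, -⟩ := mem_typeGraph_iff.1 h
  exact pathLength_corner hsx hW hx'

theorem exists_of_mem_typeGraph_six (hsx : 0 < sx) (hW : sx ≤ W) {t : ℝ × ℝ} {d : ℝ}
    (h : (t, d) ∈ typeGraph α W sx 6) : t.1 < 0 ∧ ∃ w, -1 < w ∧ w < 0 ∧
      d = leftLength α sx t w ∧ d = minLeftLength α sx t ∧
      α * (w / hyp sx w) + (w - t.2) / hyp t.1 (w - t.2) = 0 := by
  obtain ⟨x, y⟩ := t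
  obtain ⟨hx, ⟨v, ⟨hx', w, hw1, hw2, rfl⟩, rfl⟩, hmin⟩ := mem_typeGraph_iff.1 h
  have hx' : x < 0 := hx'
  have e : ∀ w, -1 < w → w < 0 → pathLength α W sx (x, y) [(0, w)] = leftLength α sx (x, y) w :=
    fun w h1 h2 => pathLength_left hsx hW h1.le h2 hx'
  have hle : ∀ w', -1 < w' → w' < 0 → leftLength α sx (x, y) w ≤ leftLength α sx (x, y) w' := by
    intro w' h1 h2
    rw [← e w hw1 hw2, ← e w' h1 h2]
    exact hmin _ ⟨hx', w', h1, h2, rfl⟩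
  refine ⟨hx', w, hw1, hw2, e w hw1 hw2, ?_, ?_⟩
  · rw [e w hw1 hw2]
    exact ((minLeftLength_eq_iff ⟨hw1.le, hw2.le⟩).2
      (le_on_Icc (continuous_leftLength _) (by norm_num) hle)).symm
  · exact deriv_eq_zero_of_isMinOn_Ioo
      (hasDerivAt_leftLength hsx (hyp_pos_left _ hx'.ne).ne') hw1 hw2 hle

theorem eq_minLeftLength_of_mem_typeGraph (hsx : 0 < sx) (hW : sx ≤ W) :
    ∀ t d, (t, d) ∈ typeGraph α W sx 6 → d = minLeftLength α sx t := fun _ _ h => by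
  obtain ⟨-, w, -, -, -, h', -⟩ := exists_of_mem_typeGraph_six hsx hW h
  exact h'

/-- The stationary crossing points obey the law of refraction. -/
theorem refraction_of_mem_typeGraph_six (hsx : 0 < sx) (hW : sx ≤ W) {t : ℝ × ℝ}
    {d : ℝ} (h : (t, d) ∈ typeGraph α W sx 6) : t.1 < 0 ∧ ∃ w, -1 < w ∧ w < 0 ∧
      d = leftLength α sx t w ∧ (w - t.2) * hyp sx w = -(α * w) * hyp t.1 (w - t.2) := by
  obtain ⟨hx, w, h1, h2, h3, -, h4⟩ := exists_of_mem_typeGraph_six hsx hW h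
  refine ⟨hx, w, h1, h2, h3, ?_⟩
  have e1 := (hyp_pos_left w hsx.ne').ne'
  have e2 := (hyp_pos_left (w - t.2) hx.ne).ne'
  field_simp at h4
  linarith

/-- The third condition compares with refraction at the lower corner. The ray from the corner to the
target is no steeper than the ray from the crossing point, whose sine is α times the incoming sine,
and the incoming sine is largest at the corner. Without denominators the condition is visibly
closed. -/
theorem mem_closure_typeDomain_six (hα : 0 < α) (hsx : 0 < sx) (hW : sx ≤ W) {q : ℝ × ℝ}
    (hq : q ∈ closure (typeDomain α W sx 6)) :
    q.1 ≤ 0 ∧ q.2 ≤ 0 ∧ -(q.2 + 1) * hyp sx 1 ≤ α * hyp q.1 (q.2 + 1) := by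
  refine of_mem_closure_typeDomain (P := fun q => q.1 ≤ 0 ∧ q.2 ≤ 0 ∧
    -(q.2 + 1) * hyp sx 1 ≤ α * hyp q.1 (q.2 + 1))
    ((isClosed_le continuous_fst continuous_const).inter
      ((isClosed_le continuous_snd continuous_const).inter
        (isClosed_le (f := fun q : ℝ × ℝ => -(q.2 + 1) * hyp sx 1)
          (g := fun q : ℝ × ℝ => α * hyp q.1 (q.2 + 1)) (by fun_prop) (by fun_prop)))) ?_ hq
  rintro ⟨x, y⟩ d h
  obtain ⟨hx, w, h1, h2, -, h4⟩ := refraction_of_mem_typeGraph_six hsx hW h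
  simp only at hx h4 ⊢
  have hρ := hyp_pos_left w hsx.ne'
  have hr := hyp_pos_left (w - y) hx.ne
  have hv : 0 < w - y := by
    have : 0 < (w - y) * hyp sx w := by
      rw [h4]; exact mul_pos (by nlinarith) hr
    exact (mul_pos_iff_of_pos_right hρ).1 this
  refine ⟨hx.le, by linarith, ?_⟩
  rcases le_or_gt (-(y + 1)) 0 with hu | hu
  · exact (mul_nonpos_of_nonpos_of_nonneg hu (hyp_nonneg _ _)).trans
      (mul_nonneg hα.le (hyp_nonneg _ _))
  · have k1 := mul_hyp_le_mul_hyp x hu.le (by linarith : -(y + 1) ≤ w - y)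
    have k2 := mul_hyp_le_mul_hyp sx (by linarith : 0 ≤ -w) (by linarith : -w ≤ 1)
    rw [hyp_neg_right] at k1 k2
    have hs := hyp_nonneg x (y + 1)
    have hs1 := hyp_nonneg sx 1
    have k3 : (-(y + 1) * hyp sx w) * hyp x (w - y) ≤
        (α * -w * hyp x (y + 1)) * hyp x (w - y) := by
      calc _ = (-(y + 1) * hyp x (w - y)) * hyp sx w := by ring
        _ ≤ ((w - y) * hyp x (y + 1)) * hyp sx w := by gcongr
        _ = ((w - y) * hyp sx w) * hyp x (y + 1) := by ring
        _ = _ := by rw [h4]; ring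
    have k4 := le_of_mul_le_mul_right k3 hr
    have k5 : (-(y + 1) * hyp sx 1) * hyp sx w ≤ (α * hyp x (y + 1)) * hyp sx w := by
      calc _ = (-(y + 1) * hyp sx w) * hyp sx 1 := by ring
        _ ≤ (α * -w * hyp x (y + 1)) * hyp sx 1 := by gcongr
        _ = (α * hyp x (y + 1)) * (-w * hyp sx 1) := by ring
        _ ≤ (α * hyp x (y + 1)) * (1 * hyp sx w) := by gcongr
        _ = _ := by ring
    exact le_of_mul_le_mul_right k5 hρ

/-- The calibration has the direction of the segment as gradient above the top line and drops the
vertical component below it. The last hypothesis bounds the horizontal component by α, as the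
interior requires. -/
theorem mem_cell_one (hα : 0 < α) (hsx : 0 < sx) (hW : sx ≤ W) (hx : x ≤ sx) (hy : 0 < y)
    (h : sx - x ≤ α * hyp (x - sx) y) : (x, y) ∈ cell α W sx 1 := by
  refine ⟨hx, [], ⟨hy, rfl⟩, fun v => ?_⟩
  have hr := hyp_pos_right (x - sx) hy.ne'
  have hsq := hyp_sq (x - sx) y
  rw [pathLength_direct_above hy]
  generalize hyp (x - sx) y = r at *
  have e : ((x - sx) / r) ^ 2 + (y / r) ^ 2 = 1 := by field_simp; linarith
  have e2 : ((x - sx) / r) ^ 2 ≤ α ^ 2 := by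
    rw [div_pow, div_le_iff₀ (by positivity), ← mul_pow]
    exact sq_le_sq' (by linarith) (by nlinarith)
  have e3 : ((x - sx) / r) ^ 2 ≤ 1 := by nlinarith [sq_nonneg (y / r)]
  have hc : IsCalibration α ((x - sx) / r) ((x - sx) / r) ((x - sx) / r) 0 0 (y / r) := by
    constructor <;> first | exact e.le | simpa using e2 | simpa using e3
  refine le_trans (le_of_eq ?_) (hc.le_pathLength hα hsx.le hW (x, y) v)
  rw [potential, ramp_same, ramp_of_ge (by norm_num) hy.le]
  field_simp
  linarith

/-! ### Cells inside and outside the rectangle -/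

theorem false_of_mem_closure_interior {q : ℝ × ℝ} (hq : q ∉ frontier (rect W))
    (h1 : q ∈ closure (interior (rect W))) (h2 : q ∈ closure (interior (rect W))ᶜ) : False := by
  rw [isOpen_interior.isClosed_compl.closure_eq] at h2
  refine hq ?_
  rw [(isClosed_rect W).frontier_eq]
  exact ⟨closure_minimal interior_subset (isClosed_rect W) h1, h2⟩

theorem cell_subset_interior (hi : i = 11 ∨ i = 12 ∨ i = 13) :
    cell α W sx i ⊆ interior (rect W) := by
  rcases hi with rfl | rfl | rfl
  all_goals
    rintro t ⟨-, v, ⟨h, -⟩, -⟩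
    exact h

theorem cell_subset_compl_interior (hi : i < 11) : cell α W sx i ⊆ (interior (rect W))ᶜ := by
  rintro t ⟨-, v, hv, -⟩ ht
  obtain ⟨⟨h1, h2⟩, h3, h4⟩ := mem_interior_rect.1 ht
  interval_cases i
  · exact hv
  all_goals simp only [pathsOfType, mem_ofPred_eq] at hv
  · linarith [hv.1]
  · linarith [hv.1]
  · linarith [hv.1]
  · linarith [hv.1]
  · linarith [hv.1]
  · linarith [hv.1]
  · linarith [hv.2.1]
  · linarith [hv.1]
  · linarith [hv.1]
  · linarith [hv.1]

theorem cell_eq_empty_of_lt (hi : i = 0 ∨ 13 < i) : cell α W sx i = ∅ := by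
  refine eq_empty_of_forall_notMem ?_
  rintro t ⟨-, v, hv, -⟩
  rcases hi with rfl | hi
  · exact hv
  · obtain ⟨k, rfl⟩ := Nat.exists_eq_add_of_lt hi
    rw [show 13 + k + 1 = k + 14 by ring] at hv
    exact hv

end

/-! ### Equality in Cauchy–Schwarz, and first restrictions on edges -/

section

variable {α W sx x y : ℝ} {i j : ℕ}

/-- For a unit vector and a nonnegative inner product, parallelism is also sufficient. This
identifies the bisectors on which a linear length meets a norm. -/
theorem mul_add_mul_eq_hyp_iff {a b c d : ℝ} (h : a ^ 2 + b ^ 2 = 1) (h' : 0 ≤ a * c + b * d) :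
    a * c + b * d = hyp c d ↔ a * d = b * c := by
  constructor
  · intro e
    exact mul_add_mul_eq_hyp (e := 1) (by rw [h, one_pow]) (by rw [e, one_mul])
  · intro e
    refine (hyp_eq_of_sq h' ?_).symm
    linear_combination -(c ^ 2 + d ^ 2) * h + (a * d - b * c) * e

theorem sq_sqrt_one_sub_sq (hα : 0 < α) (hα1 : α < 1) : √(1 - α ^ 2) ^ 2 = 1 - α ^ 2 :=
  Real.sq_sqrt (by nlinarith)

theorem sqrt_one_sub_sq_pos (hα : 0 < α) (hα1 : α < 1) : 0 < √(1 - α ^ 2) :=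
  Real.sqrt_pos.2 (by nlinarith)

theorem spmEdge_nonempty_cells (h : (spmEdge α W sx i j).Nonempty) :
    (cell α W sx i).Nonempty ∧ (cell α W sx j).Nonempty := by
  obtain ⟨q, -, h1, h2⟩ := h
  exact ⟨closure_nonempty_iff.1 ⟨q, h1⟩, closure_nonempty_iff.1 ⟨q, h2⟩⟩

theorem spmEdge_interior_eq_empty (hi : i < 11) (hj : j = 11 ∨ j = 12 ∨ j = 13) :
    ¬ (spmEdge α W sx i j).Nonempty := by
  rintro ⟨q, h1, h2, h3⟩
  exact false_of_mem_closure_interior h1 (closure_mono (cell_subset_interior hj) h3)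
    (closure_mono (cell_subset_compl_interior hi) h2)

/-! ### Light rectangles -/

/-- The length of the shortest path of type 2 for a light rectangle. -/
noncomputable def lightTopLength (α sx : ℝ) (t : ℝ × ℝ) : ℝ :=
  α * (sx - t.1) + √(1 - α ^ 2) * t.2

/-- Stationarity in `b` is the critical angle: the last segment has direction cosine α and sine √(1
- α²), so its length can be eliminated and the total is linear. The last two inequalities are `0 <
b` and `b < sx`, weakened. -/
theorem of_mem_typeGraph_two (hα : 0 < α) (hα1 : α < 1) (hW : sx ≤ W) {t : ℝ × ℝ} {d : ℝ}
    (h : (t, d) ∈ typeGraph α W sx 2) : d = lightTopLength α sx t ∧ 0 < t.2 ∧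
      -(√(1 - α ^ 2) * t.1) ≤ α * t.2 ∧ α * t.2 ≤ √(1 - α ^ 2) * (sx - t.1) := by
  obtain ⟨x, y⟩ := t
  obtain ⟨hx, ⟨v, ⟨hy, b, hb1, hb2, rfl⟩, rfl⟩, hmin⟩ := mem_typeGraph_iff.1 h
  simp only at hx hy
  have e : ∀ b, 0 < b → b < sx →
      pathLength α W sx (x, y) [(b, 0)] = α * (sx - b) + hyp (b - x) y := fun b h1 h2 => by
    rw [pathLength_top hW h1.le h2.le hy, min_eq_right hα1.le]
  have hr := hyp_pos_right (b - x) hy.ne'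
  have hd : HasDerivAt (fun b => α * (sx - b) + hyp (b - x) y)
      (α * (-1) + (b - x) / hyp (b - x) y) b :=
    (((hasDerivAt_id b).const_sub sx).const_mul α).add (hasDerivAt_hyp_sub_left b x hr.ne')
  have h0 := deriv_eq_zero_of_isMinOn_Ioo hd hb1 hb2 fun b' h1 h2 => by
    rw [← e b hb1 hb2, ← e b' h1 h2]
    exact hmin _ ⟨hy, b', h1, h2, rfl⟩
  have hsq := hyp_sq (b - x) y
  rw [e b hb1 hb2]
  have hβ := sqrt_one_sub_sq_pos hα hα1
  have hβ2 := sq_sqrt_one_sub_sq hα hα1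
  unfold lightTopLength
  simp only
  generalize hyp (b - x) y = r at *
  generalize √(1 - α ^ 2) = β at *
  field_simp at h0
  have e1 : b - x = α * r := by linarith
  have e2 : y = β * r := by
    refine (sq_eq_sq₀ hy.le (by positivity)).1 ?_
    rw [mul_pow, hβ2]
    rw [e1] at hsq
    linarith
  refine ⟨?_, hy, ?_, ?_⟩
  · rw [e2]; linear_combination -r * hβ2 - α * e1
  · rw [e2]; nlinarith
  · rw [e2]; nlinarith

theorem mem_closure_typeDomain_two (hα : 0 < α) (hα1 : α < 1) (hW : sx ≤ W) {q : ℝ × ℝ}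
    (hq : q ∈ closure (typeDomain α W sx 2)) : 0 ≤ q.2 ∧
      -(√(1 - α ^ 2) * q.1) ≤ α * q.2 ∧ α * q.2 ≤ √(1 - α ^ 2) * (sx - q.1) := by
  refine of_mem_closure_typeDomain (P := fun q => 0 ≤ q.2 ∧
      -(√(1 - α ^ 2) * q.1) ≤ α * q.2 ∧ α * q.2 ≤ √(1 - α ^ 2) * (sx - q.1)) ?_ ?_ hq
  · have h1 : IsClosed {q : ℝ × ℝ | 0 ≤ q.2} := isClosed_le (by fun_prop) (by fun_prop)
    have h2 : IsClosed {q : ℝ × ℝ | -(√(1 - α ^ 2) * q.1) ≤ α * q.2} :=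
      isClosed_le (by fun_prop) (by fun_prop)
    have h3 : IsClosed {q : ℝ × ℝ | α * q.2 ≤ √(1 - α ^ 2) * (sx - q.1)} :=
      isClosed_le (by fun_prop) (by fun_prop)
    exact h1.inter (h2.inter h3)
  · intro t d h
    obtain ⟨-, h1, h2⟩ := of_mem_typeGraph_two hα hα1 hW h
    exact ⟨h1.le, h2⟩

theorem continuous_lightTopLength : Continuous (lightTopLength α sx) := by
  unfold lightTopLength; fun_prop

/-- The calibrating gradient is (-α, √(1 - α²)) above the top line and (-α, 0) below it. -/
theorem typeDomain_two_subset_cell (hα : 0 < α) (hα1 : α < 1) (hsx : 0 < sx) (hW : sx ≤ W) :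
    typeDomain α W sx 2 ⊆ cell α W sx 2 := by
  intro t ht
  refine mem_cell_of_mem_typeDomain
    (fun t d h => (of_mem_typeGraph_two hα hα1 hW h).1) ht fun v => ?_
  obtain ⟨d, hd⟩ := ht
  have hy := (of_mem_typeGraph_two hα hα1 hW hd).2.1
  have hβ2 := sq_sqrt_one_sub_sq hα hα1
  have hc : IsCalibration α (-α) (-α) (-α) 0 0 (√(1 - α ^ 2)) := by
    constructor <;> nlinarith
  refine le_trans (le_of_eq ?_) (hc.le_pathLength hα hsx.le hW t v)
  rw [potential, ramp_same, ramp_of_ge (by norm_num) hy.le, lightTopLength]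
  ring

/-- The horizontal slope is that of the outgoing direction for x < 0 and -α for x > 0. The last
hypothesis is what keeps the gradient (-α, y / r) above the rectangle within the unit disc. -/
theorem mem_cell_three (hα : 0 < α) (hα1 : α < 1) (hsx : 0 < sx) (hW : sx ≤ W) (hx : x < 0)
    (hy : 0 < y) (h : α * hyp x y ≤ -x) : (x, y) ∈ cell α W sx 3 := by
  refine ⟨(hx.trans hsx).le, [(0, 0)], ⟨hx, hy, rfl⟩, fun v => ?_⟩
  have hr := hyp_pos_left y hx.ne
  have hsq := hyp_sq x y
  rw [pathLength_corner hsx hW hx, min_eq_right hα1.le]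
  generalize hyp x y = r at *
  have e : (x / r) ^ 2 + (y / r) ^ 2 = 1 := by field_simp; linarith
  have e2 : α ^ 2 ≤ (x / r) ^ 2 := by
    rw [div_pow, le_div_iff₀ (by positivity), ← mul_pow, ← neg_sq x]
    exact pow_le_pow_left₀ (by positivity) h 2
  have hc : IsCalibration α (x / r) (-α) (-α) 0 0 (y / r) := by
    constructor <;> nlinarith [sq_nonneg (y / r)]
  refine le_trans (le_of_eq ?_) (hc.le_pathLength hα hsx.le hW (x, y) v)
  rw [potential, ramp_of_le (hsx.le.trans hW) hx.le, ramp_of_ge (by norm_num) hy.le]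
  field_simp
  linear_combination hsq

/-- By Snell's law one vertical slope serves on both sides of x = 0, and only the horizontal slope
jumps. To the right of that line the gradient has norm α, which is admissible outside the rectangle
too since α < 1. -/
theorem typeDomain_six_subset_cell (hα : 0 < α) (hα1 : α < 1) (hsx : 0 < sx) (hW : sx ≤ W) :
    typeDomain α W sx 6 ⊆ cell α W sx 6 := by
  intro t ht
  refine mem_cell_of_mem_typeDomain (eq_minLeftLength_of_mem_typeGraph hsx hW) ht fun v => ?_
  obtain ⟨d, hd⟩ := ht
  rw [← eq_minLeftLength_of_mem_typeGraph hsx hW t d hd]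
  obtain ⟨x, y⟩ := t
  obtain ⟨hx, w, h1, h2, rfl, h4⟩ := refraction_of_mem_typeGraph_six hsx hW hd
  simp only [leftLength] at hx h4 ⊢
  have hρ := hyp_pos_left w hsx.ne'
  have hr := hyp_pos_left (w - y) hx.ne
  have hρ2 := hyp_sq sx w
  have hr2 := hyp_sq x (w - y)
  generalize hyp sx w = ρ at *
  generalize hyp x (w - y) = r at *
  have eq : (w - y) / r = -(α * w) / ρ := by rw [div_eq_div_iff hr.ne' hρ.ne']; exact h4
  have e1 : (x / r) ^ 2 + (-((w - y) / r)) ^ 2 = 1 := by field_simp; linarith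
  have e2 : (-(α * sx / ρ)) ^ 2 + (-((w - y) / r)) ^ 2 = α ^ 2 := by
    rw [eq]; field_simp; linarith
  have hc : IsCalibration α (x / r) (-(α * sx / ρ)) (-(α * sx / ρ)) (-((w - y) / r))
      (-((w - y) / r)) (-((w - y) / r)) := by
    constructor <;> nlinarith
  refine le_trans (le_of_eq ?_) (hc.le_pathLength hα hsx.le hW (x, y) v)
  rw [potential, ramp_of_le (hsx.le.trans hW) hx.le, ramp_same]
  simp only
  have f1 : α * ρ = α * sx / ρ * sx - (w - y) / r * w := by
    rw [eq]; field_simp; linarith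
  have f2 : r = x / r * x + (w - y) / r * (w - y) := by
    field_simp; linarith
  linarith

/-- At a corner both slopes may jump. The last two hypotheses say that each component of the
outgoing unit vector dominates, in absolute value, that of α times the incoming one; hence the two
mixed boxes also have gradients of norm at most 1. -/
theorem mem_cell_nine (hα : 0 < α) (hsx : 0 < sx) (hW : sx ≤ W) (hx : x < 0)
    (hy : y < -1) (h1 : α * hyp x (y + 1) ≤ -(y + 1) * hyp sx 1)
    (h2 : α * sx * hyp x (y + 1) ≤ -x * hyp sx 1) : (x, y) ∈ cell α W sx 9 := by
  refine ⟨(hx.trans hsx).le, [(0, -1)], ⟨hx, hy, rfl⟩, fun v => ?_⟩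
  rw [pathLength_lower_corner hsx hW (Or.inl hx)]
  have hρ := hyp_pos_left 1 hsx.ne'
  have hr := hyp_pos_left (y + 1) hx.ne
  have hρ2 := hyp_sq sx 1
  have hr2 := hyp_sq x (y + 1)
  generalize hyp sx 1 = ρ at *
  generalize hyp x (y + 1) = r at *
  have e1 : (x / r) ^ 2 + ((y + 1) / r) ^ 2 = 1 := by field_simp; linarith
  have e2 : (-(α * sx / ρ)) ^ 2 + (-(α / ρ)) ^ 2 = α ^ 2 := by field_simp; linarith
  have e3 : (-(α / ρ)) ^ 2 ≤ ((y + 1) / r) ^ 2 := by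
    rw [neg_sq, ← neg_sq ((y + 1) / r), ← neg_div]
    refine pow_le_pow_left₀ (by positivity) ?_ 2
    rwa [div_le_div_iff₀ hρ hr]
  have e4 : (-(α * sx / ρ)) ^ 2 ≤ (x / r) ^ 2 := by
    rw [neg_sq, ← neg_sq (x / r), ← neg_div]
    refine pow_le_pow_left₀ (by positivity) ?_ 2
    rwa [div_le_div_iff₀ hρ hr]
  have hc : IsCalibration α (x / r) (-(α * sx / ρ)) (-(α * sx / ρ)) ((y + 1) / r)
      (-(α / ρ)) (-(α / ρ)) := by
    constructor <;> nlinarith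
  refine le_trans (le_of_eq ?_) (hc.le_pathLength hα hsx.le hW (x, y) v)
  rw [potential, ramp_of_le (hsx.le.trans hW) hx.le, ramp_of_le (by norm_num) hy.le]
  have f1 : α * ρ = α * sx / ρ * sx + α / ρ := by field_simp; linarith
  have f2 : r = x / r * x + (y + 1) / r * (y + 1) := by field_simp; linarith
  linarith

/-- The length of the path to `t` that leaves the rectangle at the point `(w, -1)`. -/
noncomputable def bottomLength (α sx : ℝ) (t : ℝ × ℝ) (w : ℝ) : ℝ :=
  α * hyp (w - sx) 1 + hyp (w - t.1) (t.2 + 1)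

/-- The length of the shortest path to `t` that leaves the rectangle at the bottom side. -/
noncomputable def minBottomLength (α W sx : ℝ) (t : ℝ × ℝ) : ℝ :=
  sInf (bottomLength α sx t '' Icc 0 W)

@[fun_prop]
theorem continuous_bottomLength (t : ℝ × ℝ) : Continuous (bottomLength α sx t) := by
  unfold bottomLength; fun_prop

theorem continuous_minBottomLength : Continuous (minBottomLength α W sx) := by
  refine isCompact_Icc.continuous_sInf ?_
  unfold bottomLength Function.HasUncurry.uncurry
  simp only [Function.hasUncurryInduction]
  fun_prop

theorem minBottomLength_eq_iff {t : ℝ × ℝ} {w : ℝ} (hw : w ∈ Icc 0 W) :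
    minBottomLength α W sx t = bottomLength α sx t w ↔
      ∀ w' ∈ Icc 0 W, bottomLength α sx t w ≤ bottomLength α sx t w' := by
  constructor
  · intro h w' hw'
    rw [← h]
    exact csInf_le (isCompact_Icc.image (continuous_bottomLength t)).bddBelow ⟨w', hw', rfl⟩
  · intro h
    refine IsLeast.csInf_eq ⟨⟨w, hw, rfl⟩, ?_⟩
    rintro _ ⟨w', hw', rfl⟩
    exact h w' hw'

theorem cornerLength_eq_bottomLength (t : ℝ × ℝ) :
    cornerLength α sx t = bottomLength α sx t 0 := by
  simp only [cornerLength, bottomLength, zero_sub, hyp_neg_left]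

theorem hasDerivAt_bottomLength {t : ℝ × ℝ} {w : ℝ} (h : hyp (w - t.1) (t.2 + 1) ≠ 0) :
    HasDerivAt (bottomLength α sx t)
      (α * ((w - sx) / hyp (w - sx) 1) + (w - t.1) / hyp (w - t.1) (t.2 + 1)) w :=
  ((hasDerivAt_hyp_sub_left w sx (hyp_pos_right _ one_ne_zero).ne').const_mul α).add
    (hasDerivAt_hyp_sub_left w t.1 h)

theorem refraction_of_mem_typeGraph_ten (hsx : 0 < sx) (hW : sx ≤ W) {t : ℝ × ℝ} {d : ℝ}
    (h : (t, d) ∈ typeGraph α W sx 10) : t.1 ≤ sx ∧ t.2 < -1 ∧ ∃ w, 0 < w ∧ w < W ∧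
      d = bottomLength α sx t w ∧ d = minBottomLength α W sx t ∧
      (w - t.1) * hyp (w - sx) 1 = α * (sx - w) * hyp (w - t.1) (t.2 + 1) := by
  obtain ⟨x, y⟩ := t
  obtain ⟨hx, ⟨v, ⟨hy, w, hw1, hw2, rfl⟩, rfl⟩, hmin⟩ := mem_typeGraph_iff.1 h
  have hy : y < -1 := hy
  have e : ∀ w, 0 < w → w < W → pathLength α W sx (x, y) [(w, -1)] = bottomLength α sx (x, y) w :=
    fun w h1 h2 => pathLength_bottom hsx hW h1.le h2 hy
  have hle : ∀ w', 0 < w' → w' < W →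
      bottomLength α sx (x, y) w ≤ bottomLength α sx (x, y) w' := by
    intro w' h1 h2
    rw [← e w hw1 hw2, ← e w' h1 h2]
    exact hmin _ ⟨hy, w', h1, h2, rfl⟩
  refine ⟨hx, hy, w, hw1, hw2, e w hw1 hw2, ?_, ?_⟩
  · rw [e w hw1 hw2]
    exact ((minBottomLength_eq_iff ⟨hw1.le, hw2.le⟩).2
      (le_on_Icc (continuous_bottomLength _) (hsx.trans_le hW) hle)).symm
  · have hr : hyp (w - x) (y + 1) ≠ 0 := (hyp_pos_right _ (by linarith)).ne'
    have h4 := deriv_eq_zero_of_isMinOn_Ioo (hasDerivAt_bottomLength hr) hw1 hw2 hle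
    have e1 := (hyp_pos_right (w - sx) (one_ne_zero (α := ℝ))).ne'
    simp only at h4 ⊢
    field_simp at h4
    linarith

theorem eq_minBottomLength_of_mem_typeGraph (hsx : 0 < sx) (hW : sx ≤ W) :
    ∀ t d, (t, d) ∈ typeGraph α W sx 10 → d = minBottomLength α W sx t := fun _ _ h => by
  obtain ⟨-, -, w, -, -, -, h', -⟩ := refraction_of_mem_typeGraph_ten hsx hW h
  exact h'

/-- The argument for type 6 with the coordinates exchanged: no refraction at the bottom side
deflects a ray further to the left than the one at the corner. -/
theorem mem_closure_typeDomain_ten (hα : 0 < α) (hsx : 0 < sx) (hW : sx ≤ W) {q : ℝ × ℝ}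
    (hq : q ∈ closure (typeDomain α W sx 10)) :
    -q.1 * hyp sx 1 ≤ α * sx * hyp q.1 (q.2 + 1) := by
  refine of_mem_closure_typeDomain (P := fun q => -q.1 * hyp sx 1 ≤ α * sx * hyp q.1 (q.2 + 1))
    (isClosed_le (f := fun q : ℝ × ℝ => -q.1 * hyp sx 1)
          (g := fun q : ℝ × ℝ => α * sx * hyp q.1 (q.2 + 1)) (by fun_prop) (by fun_prop)) ?_ hq
  rintro ⟨x, y⟩ d h
  obtain ⟨-, hy, w, h1, h2, -, -, h4⟩ := refraction_of_mem_typeGraph_ten hsx hW h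
  simp only at hy h4 ⊢
  have hρ := hyp_pos_right (w - sx) (one_ne_zero (α := ℝ))
  have hr := hyp_pos_right (w - x) (by linarith : y + 1 ≠ 0)
  have hs := hyp_nonneg x (y + 1)
  have hs1 := hyp_nonneg sx 1
  rcases le_or_gt (-x) 0 with hu | hu
  · exact (mul_nonpos_of_nonpos_of_nonneg hu (hyp_nonneg _ _)).trans
      (by positivity)
  -- The ray leaves to the left, hence by refraction it also arrived from the right.
  · have hw : 0 < sx - w := by
      have : 0 < (α * (sx - w)) * hyp (w - x) (y + 1) := by
        rw [← h4]; exact mul_pos (by linarith) hρ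
      have := (mul_pos_iff_of_pos_right hr).1 this
      exact (mul_pos_iff_of_pos_left hα).1 this
    have k1 := mul_hyp_le_mul_hyp (y + 1) hu.le (by linarith : -x ≤ w - x)
    have k2 := mul_hyp_le_mul_hyp 1 hw.le (by linarith : sx - w ≤ sx)
    rw [hyp_comm _ (w - x), hyp_comm _ (-x), hyp_neg_left] at k1
    rw [hyp_comm _ sx, hyp_comm _ (sx - w), hyp_sub_left] at k2
    have k3 : (-x * hyp (w - sx) 1) * hyp (w - x) (y + 1) ≤
        (α * (sx - w) * hyp x (y + 1)) * hyp (w - x) (y + 1) := by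
      calc _ = (-x * hyp (w - x) (y + 1)) * hyp (w - sx) 1 := by ring
        _ ≤ ((w - x) * hyp x (y + 1)) * hyp (w - sx) 1 := by gcongr
        _ = ((w - x) * hyp (w - sx) 1) * hyp x (y + 1) := by ring
        _ = _ := by rw [h4]; ring
    have k4 := le_of_mul_le_mul_right k3 hr
    have k5 : (-x * hyp sx 1) * hyp (w - sx) 1 ≤ (α * sx * hyp x (y + 1)) * hyp (w - sx) 1 := by
      calc _ = (-x * hyp (w - sx) 1) * hyp sx 1 := by ring
        _ ≤ (α * (sx - w) * hyp x (y + 1)) * hyp sx 1 := by gcongr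
        _ = (α * hyp x (y + 1)) * ((sx - w) * hyp sx 1) := by ring
        _ ≤ (α * hyp x (y + 1)) * (sx * hyp (w - sx) 1) := by gcongr
        _ = _ := by ring
    exact le_of_mul_le_mul_right k5 hρ

/-- At the bottom side Snell's law matches the horizontal slopes, and the vertical slope jumps. -/
theorem typeDomain_ten_subset_cell (hα : 0 < α) (hα1 : α < 1) (hsx : 0 < sx) (hW : sx ≤ W) :
    typeDomain α W sx 10 ⊆ cell α W sx 10 := by
  intro t ht
  refine mem_cell_of_mem_typeDomain (eq_minBottomLength_of_mem_typeGraph hsx hW) ht fun v => ?_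
  obtain ⟨d, hd⟩ := ht
  rw [← eq_minBottomLength_of_mem_typeGraph hsx hW t d hd]
  obtain ⟨x, y⟩ := t
  obtain ⟨hx, hy, w, h1, h2, rfl, -, h4⟩ := refraction_of_mem_typeGraph_ten hsx hW hd
  simp only [bottomLength] at hx hy h4 ⊢
  have hρ := hyp_pos_right (w - sx) (one_ne_zero (α := ℝ))
  have hr := hyp_pos_right (w - x) (by linarith : y + 1 ≠ 0)
  have hρ2 := hyp_sq (w - sx) 1
  have hr2 := hyp_sq (w - x) (y + 1)
  generalize hyp (w - sx) 1 = ρ at *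
  generalize hyp (w - x) (y + 1) = r at *
  have eq : (w - x) / r = α * (sx - w) / ρ := by rw [div_eq_div_iff hr.ne' hρ.ne']; exact h4
  have e1 : (-((w - x) / r)) ^ 2 + ((y + 1) / r) ^ 2 = 1 := by field_simp; linarith
  have e2 : (-((w - x) / r)) ^ 2 + (-(α / ρ)) ^ 2 = α ^ 2 := by
    rw [eq]; field_simp; linarith
  have hc : IsCalibration α (-((w - x) / r)) (-((w - x) / r)) (-((w - x) / r)) ((y + 1) / r)
      (-(α / ρ)) (-(α / ρ)) := by
    constructor <;> nlinarith
  refine le_trans (le_of_eq ?_) (hc.le_pathLength hα hsx.le hW (x, y) v)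
  rw [potential, ramp_same, ramp_of_le (by norm_num) hy.le]
  simp only
  have f1 : α * ρ = (w - x) / r * (sx - w) + α / ρ := by
    rw [eq]; field_simp; linarith
  have f2 : r = (w - x) / r * (w - x) + (y + 1) / r * (y + 1) := by
    field_simp; linarith
  linarith

end

section

variable {α W sx x y : ℝ} {i j : ℕ}

/-! ### The bisectors of a light rectangle -/

/-- Both sides of the refraction equation are nonnegative in this quadrant, so it may be squared; it
becomes (y + 1)² (sx² + 1 - α²) = α² x². -/
theorem critical_left_iff (hα : 0 < α) (hα1 : α < 1) (hx : x ≤ 0) (hy : y ≤ -1) :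
    -(y + 1) * hyp sx 1 = α * hyp x (y + 1) ↔ y = -1 + α / √(sx ^ 2 + 1 - α ^ 2) * x := by
  have hD0 : 0 < sx ^ 2 + 1 - α ^ 2 := by nlinarith [sq_nonneg sx]
  have hD : 0 < √(sx ^ 2 + 1 - α ^ 2) := Real.sqrt_pos.2 hD0
  have hD2 : √(sx ^ 2 + 1 - α ^ 2) ^ 2 = sx ^ 2 + 1 - α ^ 2 := Real.sq_sqrt hD0.le
  generalize √(sx ^ 2 + 1 - α ^ 2) = D at *
  have h1 : -(y + 1) * hyp sx 1 = α * hyp x (y + 1) ↔ -(y + 1) * D = α * -x := by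
    rw [← sq_eq_sq₀ (mul_nonneg (by linarith) (hyp_nonneg _ _))
      (mul_nonneg hα.le (hyp_nonneg _ _)),
      ← sq_eq_sq₀ (mul_nonneg (by linarith) hD.le) (mul_nonneg hα.le (by linarith)), mul_pow,
      mul_pow, hyp_sq, hyp_sq, mul_pow, mul_pow, hD2]
    constructor <;> intro h <;> linarith
  rw [h1]
  constructor
  · intro h; field_simp; linarith
  · intro h
    have : y + 1 = α / D * x := by linarith
    rw [this]; field_simp

theorem critical_bottom_iff (hα : 0 < α) (hα1 : α < 1) (hsx : 0 < sx) (hx : x ≤ 0) (hy : y ≤ -1) :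
    -x * hyp sx 1 = α * sx * hyp x (y + 1) ↔
      y = -1 + √(1 - (α ^ 2 - 1) * sx ^ 2) / (α * sx) * x := by
  have hD0 : 0 < 1 - (α ^ 2 - 1) * sx ^ 2 := by
    nlinarith [mul_nonneg (by nlinarith : 0 ≤ 1 - α ^ 2) (sq_nonneg sx)]
  have hD : 0 < √(1 - (α ^ 2 - 1) * sx ^ 2) := Real.sqrt_pos.2 hD0
  have hD2 : √(1 - (α ^ 2 - 1) * sx ^ 2) ^ 2 = 1 - (α ^ 2 - 1) * sx ^ 2 := Real.sq_sqrt hD0.le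
  generalize √(1 - (α ^ 2 - 1) * sx ^ 2) = D at *
  have h1 : -x * hyp sx 1 = α * sx * hyp x (y + 1) ↔ α * sx * -(y + 1) = -x * D := by
    rw [← sq_eq_sq₀ (mul_nonneg (by linarith) (hyp_nonneg _ _))
      (mul_nonneg (mul_nonneg hα.le hsx.le) (hyp_nonneg _ _)),
      ← sq_eq_sq₀ (mul_nonneg (mul_nonneg hα.le hsx.le) (by linarith))
        (mul_nonneg (by linarith) hD.le), mul_pow,
      mul_pow, hyp_sq, hyp_sq, mul_pow, mul_pow, mul_pow _ D, hD2]
    constructor <;> intro h <;> linarith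
  rw [h1]
  constructor
  · intro h; field_simp; linarith
  · intro h
    have : y + 1 = D / (α * sx) * x := by linarith
    rw [this]; field_simp

theorem mul_add_mul_le_hyp_mul_hyp (a b c d : ℝ) : a * c + b * d ≤ hyp a b * hyp c d :=
  mul_add_mul_le_hyp (hyp_nonneg a b) (hyp_sq a b).ge

/-- If the direction of the last segment satisfies the law of refraction at the corner, then the
corner is the best point of the left side. -/
theorem cornerLength_le_leftLength (hsx : 0 < sx) (hr : 0 < hyp x (y + 1))
    (h : -(y + 1) * hyp sx 1 = α * hyp x (y + 1)) (hα : 0 < α) (w : ℝ) :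
    cornerLength α sx (x, y) ≤ leftLength α sx (x, y) w := by
  have hρ := hyp_pos_left 1 hsx.ne'
  have h1 := mul_add_mul_le_hyp_mul_hyp sx (-1) sx w
  have h2 := mul_add_mul_le_hyp_mul_hyp x (-(y + 1)) x (w - y)
  have hρ2 := hyp_sq sx 1
  have hr2 := hyp_sq x (y + 1)
  rw [hyp_neg_right] at h1 h2
  simp only [cornerLength, leftLength]
  generalize hyp sx 1 = ρ at *
  generalize hyp x (y + 1) = r at *
  generalize hyp sx w = ρ' at *
  generalize hyp x (w - y) = r' at *
  -- Tangent bounds at w = -1. After weighting by α their slopes in w are -α / ρ and -(y + 1) / r,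
  -- which cancel by the refraction equation.
  have k1 : (sx * sx - w) / ρ ≤ ρ' := by rw [div_le_iff₀ hρ]; linarith
  have k2 : (x * x - (y + 1) * (w - y)) / r ≤ r' := by rw [div_le_iff₀ hr]; linarith
  have k3 : -(y + 1) / r = α / ρ := by rw [div_eq_div_iff hr.ne' hρ.ne']; exact h
  have k4 : α * ((sx * sx - w) / ρ) = α * ρ - α / ρ * (w + 1) := by
    field_simp; linear_combination -hρ2
  have k5 : (x * x - (y + 1) * (w - y)) / r = r + -(y + 1) / r * (w + 1) := by
    field_simp; linear_combination -hr2
  have k6 := mul_le_mul_of_nonneg_left k1 hα.le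
  rw [k4] at k6
  rw [k5, k3] at k2
  linarith

/-- The weighted tangent bounds at w = 0 have slopes -α sx / ρ and -x / r, which cancel by the
refraction equation. -/
theorem cornerLength_le_bottomLength (hsx : 0 < sx) (hr : 0 < hyp x (y + 1))
    (h : -x * hyp sx 1 = α * sx * hyp x (y + 1)) (hα : 0 < α) (w : ℝ) :
    cornerLength α sx (x, y) ≤ bottomLength α sx (x, y) w := by
  have hρ := hyp_pos_left 1 hsx.ne'
  have h1 := mul_add_mul_le_hyp_mul_hyp (-sx) 1 (w - sx) 1
  have h2 := mul_add_mul_le_hyp_mul_hyp (-x) (y + 1) (w - x) (y + 1)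
  have hρ2 := hyp_sq sx 1
  have hr2 := hyp_sq x (y + 1)
  rw [hyp_neg_left] at h1 h2
  simp only [cornerLength, bottomLength]
  generalize hyp sx 1 = ρ at *
  generalize hyp x (y + 1) = r at *
  generalize hyp (w - sx) 1 = ρ' at *
  generalize hyp (w - x) (y + 1) = r' at *
  have k1 : (-sx * (w - sx) + 1) / ρ ≤ ρ' := by rw [div_le_iff₀ hρ]; linarith
  have k2 : (-x * (w - x) + (y + 1) * (y + 1)) / r ≤ r' := by rw [div_le_iff₀ hr]; linarith
  have k3 : -x / r = α * sx / ρ := by rw [div_eq_div_iff hr.ne' hρ.ne']; exact h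
  have k4 : α * ((-sx * (w - sx) + 1) / ρ) = α * ρ - α * sx / ρ * w := by
    field_simp; linear_combination -hρ2
  have k5 : (-x * (w - x) + (y + 1) * (y + 1)) / r = r + -x / r * w := by
    field_simp; linear_combination -hr2
  have k6 := mul_le_mul_of_nonneg_left k1 hα.le
  rw [k4] at k6
  rw [k5, k3] at k2
  linarith

theorem corner_mem_frontier (hsx : 0 < sx) (hW : sx ≤ W) : ((0, -1) : ℝ × ℝ) ∈ frontier (rect W) :=
  mem_frontier_rect.2 ⟨⟨⟨le_rfl, by simp only; linarith⟩, by norm_num⟩, by norm_num⟩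

theorem origin_mem_frontier (hsx : 0 < sx) (hW : sx ≤ W) : ((0, 0) : ℝ × ℝ) ∈ frontier (rect W) :=
  mem_frontier_rect.2 ⟨⟨⟨le_rfl, by simp only; linarith⟩, by norm_num⟩, by norm_num⟩

theorem hyp_corner_pos (hsx : 0 < sx) (hW : sx ≤ W) (hq : (x, y) ∉ frontier (rect W)) :
    0 < hyp x (y + 1) := by
  by_cases hx : x = 0
  · refine hyp_pos_right _ fun hy => hq ?_
    rw [hx, show y = -1 by linarith]
    exact corner_mem_frontier hsx hW
  · exact hyp_pos_left _ hx

/-- The length of type 2 is the inner product of the unit vector (α, √(1 - α²)) with (sx - x, y),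
whose norm is the length of type 1. They are equal exactly when the vectors are parallel. -/
theorem bisector_one_two (hα : 0 < α) (hα1 : α < 1) (hW : sx ≤ W) :
    bisector α W sx 1 2 = curvePart α W sx 1 2 (lightCurve α sx (1, 2)) := by
  refine bisector_eq_curvePart continuous_directLength continuous_lightTopLength
    eq_directLength_of_mem_typeGraph (fun t d h => (of_mem_typeGraph_two hα hα1 hW h).1) ?_
  rintro ⟨x, y⟩ hq h1 h2
  obtain ⟨hy, h3, h4⟩ := mem_closure_typeDomain_two hα hα1 hW h2
  have hβ := sqrt_one_sub_sq_pos hα hα1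
  have hβ2 := sq_sqrt_one_sub_sq hα hα1
  have hx : 0 ≤ sx - x := (mul_nonneg_iff_of_pos_left hβ).1 ((mul_nonneg hα.le hy).trans h4)
  simp only [directLength, lightTopLength, lightCurve] at *
  rw [hyp_sub_left, eq_comm, mul_add_mul_eq_hyp_iff (by linarith) (by positivity)]
  change _ ↔ y = _
  rw [div_mul_eq_mul_div, eq_div_iff hα.ne', mul_comm y]

theorem bisector_two_three (hα : 0 < α) (hα1 : α < 1) (hsx : 0 < sx) (hW : sx ≤ W) :
    bisector α W sx 2 3 = curvePart α W sx 2 3 (lightCurve α sx (2, 3)) := by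
  refine bisector_eq_curvePart (g := fun t => min 1 α * sx + hyp t.1 t.2)
    continuous_lightTopLength (by fun_prop)
    (fun t d h => (of_mem_typeGraph_two hα hα1 hW h).1) (eq_of_mem_typeGraph_three hsx hW) ?_
  rintro ⟨x, y⟩ hq h1 h2
  obtain ⟨hy, h3, h4⟩ := mem_closure_typeDomain_two hα hα1 hW h1
  obtain ⟨hx, -⟩ := mem_closure_typeDomain_three h2
  have hβ := sqrt_one_sub_sq_pos hα hα1
  have hβ2 := sq_sqrt_one_sub_sq hα hα1
  simp only [lightTopLength, lightCurve, min_eq_right hα1.le] at *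
  have h5 := mul_add_mul_eq_hyp_iff (a := α) (b := √(1 - α ^ 2)) (c := -x) (d := y) (by linarith)
    (add_nonneg (mul_nonneg hα.le (by linarith)) (by positivity))
  rw [hyp_neg_left] at h5
  change _ ↔ y = _
  rw [neg_mul, div_mul_eq_mul_div, ← neg_div, eq_div_iff hα.ne', mul_comm y, ← mul_neg, ← h5]
  constructor <;> intro h <;> linarith

/-- The closed domains meet only on y = 0. There both terms of the length grow with |w|, so crossing
at w = 0 is best and the two lengths agree. -/
theorem bisector_three_six (hα : 0 < α) (hα1 : α < 1) (hsx : 0 < sx) (hW : sx ≤ W) :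
    bisector α W sx 3 6 = curvePart α W sx 3 6 (lightCurve α sx (3, 6)) := by
  refine bisector_eq_curvePart (f := fun t => min 1 α * sx + hyp t.1 t.2)
    (by fun_prop) continuous_minLeftLength
    (eq_of_mem_typeGraph_three hsx hW) (eq_minLeftLength_of_mem_typeGraph hsx hW) ?_
  rintro ⟨x, y⟩ hq h1 h2
  obtain ⟨hx, hy⟩ := mem_closure_typeDomain_three h1
  obtain ⟨-, hy', -⟩ := mem_closure_typeDomain_six hα hsx hW h2
  obtain rfl : y = 0 := le_antisymm hy' hy
  refine iff_of_true ?_ rfl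
  have h3 : min 1 α * sx + hyp x 0 = leftLength α sx (x, 0) 0 := by
    simp only [leftLength, min_eq_right hα1.le, hyp_zero_right, abs_of_pos hsx, sub_zero]
  simp only [h3]
  refine ((minLeftLength_eq_iff ⟨by norm_num, le_rfl⟩).2 fun w _ => ?_).symm
  have h4 : hyp sx 0 ≤ hyp sx w := Real.sqrt_le_sqrt (by nlinarith)
  have h5 : hyp x 0 ≤ hyp x w := Real.sqrt_le_sqrt (by nlinarith)
  simp only [leftLength, sub_zero]
  gcongr

theorem bisector_three_nine (hsx : 0 < sx) (hW : sx ≤ W) :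
    bisector α W sx 3 9 = curvePart α W sx 3 9 (lightCurve α sx (3, 9)) := by
  refine bisector_eq_curvePart (f := fun t => min 1 α * sx + hyp t.1 t.2)
    (by fun_prop) continuous_cornerLength
    (eq_of_mem_typeGraph_three hsx hW) (eq_cornerLength_of_mem_typeGraph hsx hW) ?_
  intro q hq h1 h2
  linarith [(mem_closure_typeDomain_three h1).2, (mem_closure_typeDomain_nine h2).2]

/-- If the corner is the best point of the left side, the derivative at w = -1 is nonnegative. The
domain of type 6 gives the opposite sign, so refraction holds exactly at the corner. -/
theorem bisector_six_nine (hα : 0 < α) (hα1 : α < 1) (hsx : 0 < sx) (hW : sx ≤ W) :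
    bisector α W sx 6 9 = curvePart α W sx 6 9 (lightCurve α sx (6, 9)) := by
  refine bisector_eq_curvePart continuous_minLeftLength continuous_cornerLength
    (eq_minLeftLength_of_mem_typeGraph hsx hW) (eq_cornerLength_of_mem_typeGraph hsx hW) ?_
  rintro ⟨x, y⟩ hq h1 h2
  obtain ⟨hx, hy⟩ := mem_closure_typeDomain_nine h2
  obtain ⟨-, -, h3⟩ := mem_closure_typeDomain_six hα hsx hW h1
  simp only at hx hy h3
  have hr := hyp_corner_pos hsx hW hq
  change _ ↔ y = _
  rw [← critical_left_iff hα hα1 hx hy, cornerLength_eq, minLeftLength_eq_iff (by norm_num)]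
  constructor
  · intro h
    refine le_antisymm h3 (le_of_not_gt fun hlt => ?_)
    have hr' : hyp x (-1 - y) = hyp x (y + 1) := by rw [← hyp_neg_right]; congr 1; ring
    have hd := hasDerivAt_leftLength (α := α) hsx (t := (x, y)) (w := -1)
      (by simp only; rw [hr']; exact hr.ne')
    obtain ⟨w, g1, g2, g3⟩ := exists_lt_of_deriv_neg hd (b := 0) (by
      simp only
      rw [hr', hyp_neg_right, ← mul_div_assoc,
        div_add_div _ _ (hyp_pos_left 1 hsx.ne').ne' hr.ne', div_neg_iff]
      right
      exact ⟨by linarith, mul_pos (hyp_pos_left 1 hsx.ne') hr⟩) (by norm_num)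
    exact (h w ⟨g1.le, g2.le⟩).not_gt g3
  · intro h w _
    rw [← cornerLength_eq]
    exact cornerLength_le_leftLength hsx hr h hα w

theorem bisector_nine_ten (hα : 0 < α) (hα1 : α < 1) (hsx : 0 < sx) (hW : sx ≤ W) :
    bisector α W sx 9 10 = curvePart α W sx 9 10 (lightCurve α sx (9, 10)) := by
  refine bisector_eq_curvePart continuous_cornerLength continuous_minBottomLength
    (eq_cornerLength_of_mem_typeGraph hsx hW) (eq_minBottomLength_of_mem_typeGraph hsx hW) ?_
  rintro ⟨x, y⟩ hq h1 h2
  obtain ⟨hx, hy⟩ := mem_closure_typeDomain_nine h1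
  have h3 := mem_closure_typeDomain_ten hα hsx hW h2
  simp only at hx hy h3
  have hr := hyp_corner_pos hsx hW hq
  have hW0 := hsx.trans_le hW
  change _ ↔ y = _
  rw [← critical_bottom_iff hα hα1 hsx hx hy, cornerLength_eq_bottomLength, eq_comm,
    minBottomLength_eq_iff ⟨le_rfl, hW0.le⟩]
  constructor
  · intro h
    refine le_antisymm h3 (le_of_not_gt fun hlt => ?_)
    have hr' : hyp (0 - x) (y + 1) = hyp x (y + 1) := by rw [zero_sub, hyp_neg_left]
    have hd := hasDerivAt_bottomLength (α := α) (sx := sx) (t := (x, y)) (w := 0)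
      (by simp only; rw [hr']; exact hr.ne')
    obtain ⟨w, g1, g2, g3⟩ := exists_lt_of_deriv_neg hd (b := W) (by
      simp only
      rw [hr', zero_sub, zero_sub, hyp_neg_left, ← mul_div_assoc,
        div_add_div _ _ (hyp_pos_left 1 hsx.ne').ne' hr.ne', div_neg_iff]
      right
      exact ⟨by linarith, mul_pos (hyp_pos_left 1 hsx.ne') hr⟩) hW0
    exact (h w ⟨g1.le, g2.le⟩).not_gt g3
  · intro h w _
    rw [← cornerLength_eq_bottomLength]
    exact cornerLength_le_bottomLength hsx hr h hα w

end

section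

variable {α W sx x y : ℝ} {i j : ℕ}

/-! ### The edges of the map of a light rectangle -/

theorem spmEdge_eq_bisector_one_two (hα : 0 < α) (hα1 : α < 1) (hsx : 0 < sx) (hW : sx ≤ W) :
    spmEdge α W sx 1 2 = bisector α W sx 1 2 := by
  refine Subset.antisymm (spmEdge_subset_bisector hα continuous_directLength
    continuous_lightTopLength eq_directLength_of_mem_typeGraph
    fun t d h => (of_mem_typeGraph_two hα hα1 hW h).1) ?_
  rw [bisector_one_two hα hα1 hW]
  rintro ⟨x, y⟩ ⟨hq, h1, h2, h3⟩
  refine ⟨hq, subset_closure ?_, closure_mono (typeDomain_two_subset_cell hα hα1 hsx hW) h2⟩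
  have h3 : y = √(1 - α ^ 2) / α * (sx - x) := h3
  have hβ := sqrt_one_sub_sq_pos hα hα1
  have hβ2 := sq_sqrt_one_sub_sq hα hα1
  generalize √(1 - α ^ 2) = β at *
  have e : α * y = β * (sx - x) := by rw [h3]; field_simp
  have hy := mem_closure_typeDomain_one h1
  simp only at hy
  have hx : 0 ≤ sx - x := (mul_nonneg_iff_of_pos_left hβ).1 (by rw [← e]; positivity)
  have hr : hyp (x - sx) y = (sx - x) / α := by
    refine hyp_eq_of_sq (by positivity) ?_
    field_simp
    linear_combination (α * y + β * (sx - x)) * e + (sx - x) ^ 2 * hβ2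
  -- On the curve y = 0 occurs only at the source, which is on the frontier.
  have hy' : y ≠ 0 := by
    rintro rfl
    have : sx - x = 0 := by
      rw [mul_zero] at e
      exact (mul_eq_zero.1 e.symm).resolve_left hβ.ne'
    refine hq (mem_frontier_rect.2 ?_)
    simp only
    exact ⟨⟨⟨by linarith, by linarith⟩, by norm_num⟩, by norm_num⟩
  refine mem_cell_one hα hsx hW (by linarith) (lt_of_le_of_ne hy hy'.symm) ?_
  rw [hr]
  field_simp
  exact le_rfl

theorem spmEdge_eq_bisector_two_three (hα : 0 < α) (hα1 : α < 1) (hsx : 0 < sx) (hW : sx ≤ W) :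
    spmEdge α W sx 2 3 = bisector α W sx 2 3 := by
  refine Subset.antisymm (spmEdge_subset_bisector (g := fun t => min 1 α * sx + hyp t.1 t.2) hα
    continuous_lightTopLength (by fun_prop)
    (fun t d h => (of_mem_typeGraph_two hα hα1 hW h).1) (eq_of_mem_typeGraph_three hsx hW)) ?_
  rw [bisector_two_three hα hα1 hsx hW]
  rintro ⟨x, y⟩ ⟨hq, h1, h2, h3⟩
  refine ⟨hq, closure_mono (typeDomain_two_subset_cell hα hα1 hsx hW) h1, subset_closure ?_⟩
  have h3 : y = -(√(1 - α ^ 2) / α) * x := h3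
  have hβ := sqrt_one_sub_sq_pos hα hα1
  have hβ2 := sq_sqrt_one_sub_sq hα hα1
  generalize √(1 - α ^ 2) = β at *
  have e : α * y = -(β * x) := by rw [h3]; field_simp
  obtain ⟨hx, hy⟩ := mem_closure_typeDomain_three h2
  simp only at hy hx
  have hx0 : x ≠ 0 := by
    rintro rfl
    rw [mul_zero] at h3
    subst h3
    exact hq (origin_mem_frontier hsx hW)
  have hx1 := lt_of_le_of_ne hx hx0
  have hr : hyp x y = -x / α := by
    refine hyp_eq_of_sq (div_nonneg (by linarith) hα.le) ?_
    field_simp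
    linear_combination (α * y - β * x) * e + x ^ 2 * hβ2
  refine mem_cell_three hα hα1 hsx hW hx1 ?_ ?_
  · exact (mul_pos_iff_of_pos_left hα).1 (by rw [e]; nlinarith)
  · rw [hr]
    field_simp
    exact le_rfl

/-- The point (x, 0) is the limit of points (x, ε), which for small ε are flat enough for
`mem_cell_three`. -/
theorem spmEdge_eq_bisector_three_six (hα : 0 < α) (hα1 : α < 1) (hsx : 0 < sx) (hW : sx ≤ W) :
    spmEdge α W sx 3 6 = bisector α W sx 3 6 := by
  refine Subset.antisymm (spmEdge_subset_bisector (f := fun t => min 1 α * sx + hyp t.1 t.2) hα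
    (by fun_prop) continuous_minLeftLength
    (eq_of_mem_typeGraph_three hsx hW) (eq_minLeftLength_of_mem_typeGraph hsx hW)) ?_
  rw [bisector_three_six hα hα1 hsx hW]
  rintro ⟨x, y⟩ ⟨hq, h1, h2, h3⟩
  refine ⟨hq, ?_, closure_mono (typeDomain_six_subset_cell hα hα1 hsx hW) h2⟩
  obtain rfl : y = 0 := h3
  have hx := (mem_closure_typeDomain_three h1).1
  simp only at hx
  have hx0 : x ≠ 0 := by
    rintro rfl
    exact hq (origin_mem_frontier hsx hW)
  have hx1 := lt_of_le_of_ne hx hx0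
  refine mem_closure_of_eventually (f := fun ε => (x, ε)) (by fun_prop) ?_
  have hc : Tendsto (fun ε => α * hyp x ε) (𝓝[>] 0) (𝓝 (α * hyp x 0)) :=
    ((by fun_prop : Continuous fun ε => α * hyp x ε).tendsto 0).mono_left nhdsWithin_le_nhds
  have hlt : α * hyp x 0 < -x := by
    rw [hyp_zero_right, abs_of_neg hx1]; nlinarith
  filter_upwards [hc.eventually_lt_const hlt, self_mem_nhdsWithin] with ε h1 h2
  exact mem_cell_three hα hα1 hsx hW hx1 h2 h1.le

theorem spmEdge_eq_bisector_three_nine (hα : 0 < α) (hsx : 0 < sx) (hW : sx ≤ W) :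
    spmEdge α W sx 3 9 = bisector α W sx 3 9 := by
  refine Subset.antisymm (spmEdge_subset_bisector (f := fun t => min 1 α * sx + hyp t.1 t.2) hα
    (by fun_prop) continuous_cornerLength
    (eq_of_mem_typeGraph_three hsx hW) (eq_cornerLength_of_mem_typeGraph hsx hW)) ?_
  rw [bisector_three_nine hsx hW]
  rintro q ⟨hq, h1, h2, h3⟩
  linarith [(mem_closure_typeDomain_three h1).2, (mem_closure_typeDomain_nine h2).2]

/-- On the bisectors that end in the lower left corner the path through this corner is optimal. -/
theorem mem_cell_nine_of_critical (hα : 0 < α) (hα1 : α < 1) (hsx : 0 < sx) (hW : sx ≤ W)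
    (hx : x < 0) (hy : y < -1) (h : -(y + 1) * hyp sx 1 = α * hyp x (y + 1) ∨
      -x * hyp sx 1 = α * sx * hyp x (y + 1)) : (x, y) ∈ cell α W sx 9 := by
  have hρ := hyp_pos_left 1 hsx.ne'
  have hr := hyp_pos_left (y + 1) hx.ne
  have hρ2 := hyp_sq sx 1
  have hr2 := hyp_sq x (y + 1)
  have hα2 : α ^ 2 ≤ 1 := by nlinarith
  -- In either case the squares of the two sides of the missing inequality differ by exactly this
  -- product.
  have key := mul_nonneg (mul_nonneg (sub_nonneg.2 hα2) (sq_nonneg (hyp sx 1)))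
    (sq_nonneg (hyp x (y + 1)))
  rcases h with h | h
  · refine mem_cell_nine hα hsx hW hx hy h.ge ?_
    refine le_of_sq_le_sq ?_ (mul_nonneg (by linarith) hρ.le)
    have h2 := congrArg (fun z : ℝ => z ^ 2) h
    beta_reduce at h2
    generalize hyp sx 1 = ρ at *
    generalize hyp x (y + 1) = r at *
    have : (-x * ρ) ^ 2 = r ^ 2 * ρ ^ 2 - (α * r) ^ 2 := by rw [← h2, hr2]; ring
    rw [this]
    have e : (α * sx * r) ^ 2 = α ^ 2 * (ρ ^ 2 - 1) * r ^ 2 := by rw [hρ2]; ring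
    rw [e]
    linarith
  · refine mem_cell_nine hα hsx hW hx hy ?_ h.ge
    refine le_of_sq_le_sq ?_ (mul_nonneg (by linarith) hρ.le)
    have h2 := congrArg (fun z : ℝ => z ^ 2) h
    beta_reduce at h2
    generalize hyp sx 1 = ρ at *
    generalize hyp x (y + 1) = r at *
    have : (-(y + 1) * ρ) ^ 2 = r ^ 2 * ρ ^ 2 - (α * sx * r) ^ 2 := by rw [← h2, hr2]; ring
    rw [this]
    have e : (α * sx * r) ^ 2 = α ^ 2 * (ρ ^ 2 - 1) * r ^ 2 := by rw [hρ2]; ring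
    rw [e]
    linarith

theorem neg_of_mem_line (hsx : 0 < sx) (hW : sx ≤ W) {c : ℝ} (hc : 0 < c)
    (hq : (x, y) ∉ frontier (rect W)) (hx : x ≤ 0) (h : y = -1 + c * x) : x < 0 ∧ y < -1 := by
  have hx0 : x ≠ 0 := by
    rintro rfl
    rw [mul_zero, add_zero] at h
    subst h
    exact hq (corner_mem_frontier hsx hW)
  have := lt_of_le_of_ne hx hx0
  exact ⟨this, by nlinarith⟩

theorem spmEdge_eq_bisector_six_nine (hα : 0 < α) (hα1 : α < 1) (hsx : 0 < sx) (hW : sx ≤ W) :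
    spmEdge α W sx 6 9 = bisector α W sx 6 9 := by
  refine Subset.antisymm (spmEdge_subset_bisector hα continuous_minLeftLength
    continuous_cornerLength (eq_minLeftLength_of_mem_typeGraph hsx hW)
    (eq_cornerLength_of_mem_typeGraph hsx hW)) ?_
  rw [bisector_six_nine hα hα1 hsx hW]
  rintro ⟨x, y⟩ ⟨hq, h1, h2, h3⟩
  refine ⟨hq, closure_mono (typeDomain_six_subset_cell hα hα1 hsx hW) h1, subset_closure ?_⟩
  obtain ⟨hx, hy⟩ := mem_closure_typeDomain_nine h2
  have h3 : y = -1 + α / √(sx ^ 2 + 1 - α ^ 2) * x := h3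
  have hD : 0 < √(sx ^ 2 + 1 - α ^ 2) := Real.sqrt_pos.2 (by nlinarith [sq_nonneg sx])
  obtain ⟨hx', hy'⟩ := neg_of_mem_line hsx hW (div_pos hα hD) hq hx h3
  exact mem_cell_nine_of_critical hα hα1 hsx hW hx' hy'
    (Or.inl ((critical_left_iff hα hα1 hx hy).2 h3))

theorem spmEdge_eq_bisector_nine_ten (hα : 0 < α) (hα1 : α < 1) (hsx : 0 < sx) (hW : sx ≤ W) :
    spmEdge α W sx 9 10 = bisector α W sx 9 10 := by
  refine Subset.antisymm (spmEdge_subset_bisector hα continuous_cornerLength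
    continuous_minBottomLength (eq_cornerLength_of_mem_typeGraph hsx hW)
    (eq_minBottomLength_of_mem_typeGraph hsx hW)) ?_
  rw [bisector_nine_ten hα hα1 hsx hW]
  rintro ⟨x, y⟩ ⟨hq, h1, h2, h3⟩
  refine ⟨hq, subset_closure ?_, closure_mono (typeDomain_ten_subset_cell hα hα1 hsx hW) h2⟩
  obtain ⟨hx, hy⟩ := mem_closure_typeDomain_nine h1
  have h3 : y = -1 + √(1 - (α ^ 2 - 1) * sx ^ 2) / (α * sx) * x := h3
  have hD : 0 < √(1 - (α ^ 2 - 1) * sx ^ 2) := Real.sqrt_pos.2 (by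
    nlinarith [mul_nonneg (by nlinarith : 0 ≤ 1 - α ^ 2) (sq_nonneg sx)])
  obtain ⟨hx', hy'⟩ := neg_of_mem_line hsx hW (div_pos hD (mul_pos hα hsx)) hq hx h3
  exact mem_cell_nine_of_critical hα hα1 hsx hW hx' hy'
    (Or.inr ((critical_bottom_iff hα hα1 hsx hx hy).2 h3))

/-! ### Empty cells and edges of a light rectangle -/

/-- Types 5, 7, 8, 11 and 13 bend at an edge that is no cheaper than the interior, so cutting
through the interior is strictly shorter. In type 4 the corner can slide down the left side: to
first order only the outer segment changes, and it shrinks. -/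
theorem light_cell_eq_empty (hα : 0 < α) (hα1 : α < 1) (hsx : 0 < sx) (hW : sx ≤ W)
    (hi : i = 4 ∨ i = 5 ∨ i = 7 ∨ i = 8 ∨ i = 11 ∨ i = 13) : cell α W sx i = ∅ := by
  refine eq_empty_of_forall_notMem ?_
  rintro ⟨x, y⟩ ⟨hx, v, hv, hmin⟩
  have hmul : ∀ a b : ℝ, a < b → α * a < α * b := fun a b h => mul_lt_mul_of_pos_left h hα
  rcases hi with rfl | rfl | rfl | rfl | rfl | rfl
  · obtain ⟨hx', hy, rfl⟩ := hv
    simp only at hx' hy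
    have hr := hyp_pos_left (0 - y) hx'.ne
    obtain ⟨w, h1, h2, h3⟩ := exists_gt_of_deriv_pos (a := -1)
      (hasDerivAt_leftLength (α := α) hsx (t := (x, y)) (w := 0) hr.ne')
      (by simp only [zero_div, mul_zero, zero_add]; exact div_pos (by linarith) hr) (by norm_num)
    have h4 := hmin [(0, w)]
    rw [pathLength_corner hsx hW hx', pathLength_left hsx hW h1.le h2 hx', min_eq_right hα1.le] at h4
    simp only [leftLength, hyp_zero_right, zero_sub, hyp_neg_right, abs_of_pos hsx] at h3
    linarith
  · obtain ⟨hx', b₁, b₂, h1, h2, h3, h4, rfl⟩ := hv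
    have h5 := hmin [(0, b₂)]
    rw [pathLength_top_left hW h1 h2.le h3.le h4 hx', pathLength_left hsx hW h3.le h4 hx',
      min_eq_right hα1.le] at h5
    have h6 := hyp_add_lt (a := sx - b₁) (b := 0) (c := b₁) (d := b₂)
      (by rw [zero_mul]; exact mul_ne_zero (by linarith) h4.ne)
    rw [hyp_zero_right, abs_of_pos (by linarith), sub_add_cancel, zero_add] at h6
    linarith [hmul _ _ h6]
  · obtain ⟨hx', hy, b, h1, h2, rfl⟩ := hv
    have h5 := hmin [(0, -1)]
    rw [pathLength_left_corner hsx hW h1.le h2 hy, pathLength_lower_corner hsx hW (Or.inr hy),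
      min_eq_right hα1.le] at h5
    have h6 := hyp_add_lt (a := sx) (b := -b) (c := 0) (d := b + 1)
      (by rw [mul_zero]; exact mul_ne_zero hsx.ne' (by linarith))
    rw [hyp_zero_left, abs_of_pos (by linarith), add_zero, hyp_neg_right, neg_add_cancel_left] at h6
    linarith [hmul _ _ h6]
  · obtain ⟨hy, b₁, b₂, b₃, h1, h2, h3, h4, h5, rfl⟩ := hv
    have h6 := hmin [(b₃, -1)]
    rw [pathLength_left_bottom hsx hW h1 h2.le h3 h4 h5 hy, pathLength_bottom hsx hW h4.le h5 hy,
      min_eq_right hα1.le] at h6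
    have h7 := hyp_add_lt (a := -sx) (b := -b₁) (c := 0) (d := b₁ - b₂)
      (by rw [mul_zero]; exact mul_ne_zero (by linarith) (by linarith))
    have h8 := hyp_add_le (-sx) (-b₂) b₃ (b₂ + 1)
    rw [hyp_zero_left, abs_of_pos (by linarith), hyp_neg_left, hyp_neg_right, add_zero,
      show -b₁ + (b₁ - b₂) = -b₂ by ring] at h7
    rw [show -sx + b₃ = b₃ - sx by ring, neg_add_cancel_left] at h8
    have h9 : hyp (b₃ - sx) 1 < hyp sx b₁ + (b₁ - b₂) + hyp b₃ (b₂ + 1) := by linarith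
    linarith [hmul _ _ h9]
  · obtain ⟨hin, b, h1, h2, rfl⟩ := hv
    have h3 := hmin []
    have hy := (mem_interior_rect.1 hin).2.2
    simp only at hy
    rw [pathLength_top_inside hW h1.le h2.le hin, pathLength_direct_inside hsx hW hin,
      min_eq_right hα1.le] at h3
    have h4 := hyp_add_lt (a := sx - b) (b := 0) (c := b - x) (d := y)
      (by rw [zero_mul]; exact mul_ne_zero (by linarith) hy.ne)
    rw [hyp_zero_right, abs_of_pos (by linarith), zero_add, sub_add_sub_cancel, hyp_sub_left] at h4
    linarith [hmul _ _ h4]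
  · obtain ⟨hin, b₁, b₂, h1, h2, h3, rfl⟩ := hv
    have h4 := hmin []
    rw [pathLength_left_inside hsx hW h1.le h2.le h3 hin, pathLength_direct_inside hsx hW hin,
      min_eq_right hα1.le] at h4
    have h7 := hyp_add_lt (a := -sx) (b := -b₁) (c := 0) (d := b₁ - b₂)
      (by rw [mul_zero]; exact mul_ne_zero (by linarith) (by linarith))
    have h8 := hyp_add_le (-sx) (-b₂) x (b₂ - y)
    rw [hyp_zero_left, abs_of_pos (by linarith), hyp_neg_left, hyp_neg_right, add_zero,
      show -b₁ + (b₁ - b₂) = -b₂ by ring] at h7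
    rw [show -sx + x = x - sx by ring, show -b₂ + (b₂ - y) = -y by ring, hyp_neg_right] at h8
    have h9 : hyp (x - sx) y < hyp sx b₁ + (b₁ - b₂) + hyp x (b₂ - y) := by linarith
    linarith [hmul _ _ h9]

theorem light_cell_cases (hα : 0 < α) (hα1 : α < 1) (hsx : 0 < sx) (hW : sx ≤ W) (hi : i ≠ 10)
    (h : (cell α W sx i).Nonempty) :
    i = 1 ∨ i = 2 ∨ i = 3 ∨ i = 6 ∨ i = 9 ∨ i = 12 := by
  by_contra hc
  rcases le_or_gt i 13 with h' | h'
  · rcases Nat.eq_zero_or_pos i with h0 | h0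
    · rw [cell_eq_empty_of_lt (Or.inl h0)] at h
      exact not_nonempty_empty h
    · rw [light_cell_eq_empty hα hα1 hsx hW (by omega)] at h
      exact not_nonempty_empty h
  · rw [cell_eq_empty_of_lt (Or.inr h')] at h
    exact not_nonempty_empty h

theorem light_spmEdge_one_three (hα : 0 < α) (hα1 : α < 1) (hsx : 0 < sx) (hW : sx ≤ W) :
    ¬ (spmEdge α W sx 1 3).Nonempty := by
  rintro ⟨⟨x, y⟩, hq, h1, h2⟩
  have e1 := eq_spDist_of_mem_closure_cell hα continuous_directLength
    eq_directLength_of_mem_typeGraph h1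
  have e2 := eq_spDist_of_mem_closure_cell (f := fun t => min 1 α * sx + hyp t.1 t.2) hα
    (by fun_prop) (eq_of_mem_typeGraph_three hsx hW) h2
  obtain ⟨hx, hy⟩ := mem_closure_typeDomain_three (closure_mono (cell_subset_typeDomain hα) h2)
  simp only [directLength, min_eq_right hα1.le] at *
  rcases hy.eq_or_lt with rfl | hy
  · rw [hyp_zero_right, abs_of_neg (by linarith)] at e1
    rw [hyp_zero_right, abs_of_nonpos hx] at e2
    nlinarith
  · have h3 := spDist_le (W := W) (sx := sx) hα (x, y) [(sx / 2, 0)]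
    rw [pathLength_top hW (by positivity) (by linarith) hy, min_eq_right hα1.le] at h3
    have h4 := hyp_add_lt (a := sx - x) (b := y) (c := -x) (d := y) (by nlinarith)
    rw [hyp_neg_left, hyp_sub_left, show sx - x + -x = 2 * (sx / 2 - x) by ring, ← two_mul y,
      hyp_mul two_pos.le] at h4
    linarith

/-- Both domains force y = 0, where following the top edge costs α sx instead of the sx of the
direct path. -/
theorem light_spmEdge_one_six (hα : 0 < α) (hα1 : α < 1) (hsx : 0 < sx) (hW : sx ≤ W) :
    ¬ (spmEdge α W sx 1 6).Nonempty := by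
  rintro ⟨⟨x, y⟩, hq, h1, h2⟩
  have e1 := eq_spDist_of_mem_closure_cell hα continuous_directLength
    eq_directLength_of_mem_typeGraph h1
  have hy := mem_closure_typeDomain_one (closure_mono (cell_subset_typeDomain hα) h1)
  obtain ⟨hx, hy', -⟩ := mem_closure_typeDomain_six hα hsx hW
    (closure_mono (cell_subset_typeDomain hα) h2)
  simp only at hx hy hy'
  obtain rfl : y = 0 := le_antisymm hy' hy
  have hx0 : x ≠ 0 := by
    rintro rfl
    exact hq (origin_mem_frontier hsx hW)
  have hx1 := lt_of_le_of_ne hx hx0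
  have h3 := spDist_le (W := W) (sx := sx) hα (x, 0) [(0, 0)]
  rw [pathLength_corner hsx hW hx1, e1, directLength, min_eq_right hα1.le, hyp_zero_right,
    hyp_zero_right, abs_of_neg (by simp only; linarith), abs_of_neg hx1] at h3
  simp only at h3
  nlinarith

theorem light_spmEdge_two_six (hα : 0 < α) (hα1 : α < 1) (hsx : 0 < sx) (hW : sx ≤ W) :
    ¬ (spmEdge α W sx 2 6).Nonempty := by
  rintro ⟨⟨x, y⟩, hq, h1, h2⟩
  obtain ⟨hy, hxy, -⟩ := mem_closure_typeDomain_two hα hα1 hW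
    (closure_mono (cell_subset_typeDomain hα) h1)
  obtain ⟨hx, hy', -⟩ := mem_closure_typeDomain_six hα hsx hW
    (closure_mono (cell_subset_typeDomain hα) h2)
  simp only at hx hy hy' hxy
  obtain rfl : y = 0 := le_antisymm hy' hy
  have hβ := sqrt_one_sub_sq_pos hα hα1
  obtain rfl : x = 0 := by
    refine le_antisymm hx ((mul_nonneg_iff_of_pos_left hβ).1 ?_)
    linarith
  exact hq (origin_mem_frontier hsx hW)

theorem spmEdge_nine_eq_empty (hα : 0 < α) (hi : ∀ q ∈ closure (cell α W sx i), 0 ≤ q.2) :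
    ¬ (spmEdge α W sx i 9).Nonempty := by
  rintro ⟨q, -, h1, h2⟩
  linarith [hi q h1, (mem_closure_typeDomain_nine (closure_mono (cell_subset_typeDomain hα) h2)).2]

theorem light_edges (hα : 0 < α) (hα1 : α < 1) (hsx : 0 < sx) (hW : sx ≤ W) (hij : i < j)
    (hi : i ≠ 10) (hj : j ≠ 10) (h : (spmEdge α W sx i j).Nonempty) : (i, j) ∈ lightPairs := by
  obtain ⟨hci, hcj⟩ := spmEdge_nonempty_cells h
  have hci := light_cell_cases hα hα1 hsx hW hi hci
  have hcj := light_cell_cases hα hα1 hsx hW hj hcj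
  by_cases hj' : j = 12
  · exact absurd h (spmEdge_interior_eq_empty (by omega) (by omega))
  have hcase : (i, j) ∈ lightPairs ∨ (i = 1 ∧ (j = 3 ∨ j = 6 ∨ j = 9)) ∨
      (i = 2 ∧ (j = 6 ∨ j = 9)) := by
    clear h
    rcases hci with rfl | rfl | rfl | rfl | rfl | rfl <;>
      rcases hcj with rfl | rfl | rfl | rfl | rfl | rfl <;> simp [lightPairs] at hij hj' ⊢
  rcases hcase with hc | ⟨rfl, rfl | rfl | rfl⟩ | ⟨rfl, rfl | rfl⟩
  · exact hc
  · exact absurd h (light_spmEdge_one_three hα hα1 hsx hW)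
  · exact absurd h (light_spmEdge_one_six hα hα1 hsx hW)
  · exact absurd h (spmEdge_nine_eq_empty hα fun q hq =>
      mem_closure_typeDomain_one (closure_mono (cell_subset_typeDomain hα) hq))
  · exact absurd h (light_spmEdge_two_six hα hα1 hsx hW)
  · exact absurd h (spmEdge_nine_eq_empty hα fun q hq =>
      (mem_closure_typeDomain_two hα hα1 hW (closure_mono (cell_subset_typeDomain hα) hq)).1)

theorem light_case (hα : 0 < α) (hα1 : α < 1) (hsx : 0 < sx) (hW : sx ≤ W) :
    ∀ p ∈ lightPairs,
      bisector α W sx p.1 p.2 = curvePart α W sx p.1 p.2 (lightCurve α sx p) ∧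
      spmEdge α W sx p.1 p.2 = bisector α W sx p.1 p.2 := by
  intro p hp
  simp only [lightPairs, mem_insert_iff, mem_singleton_iff] at hp
  rcases hp with rfl | rfl | rfl | rfl | rfl | rfl
  · exact ⟨bisector_one_two hα hα1 hW, spmEdge_eq_bisector_one_two hα hα1 hsx hW⟩
  · exact ⟨bisector_two_three hα hα1 hsx hW, spmEdge_eq_bisector_two_three hα hα1 hsx hW⟩
  · exact ⟨bisector_three_six hα hα1 hsx hW, spmEdge_eq_bisector_three_six hα hα1 hsx hW⟩
  · exact ⟨bisector_three_nine hsx hW, spmEdge_eq_bisector_three_nine hα hsx hW⟩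
  · exact ⟨bisector_six_nine hα hα1 hsx hW, spmEdge_eq_bisector_six_nine hα hα1 hsx hW⟩
  · exact ⟨bisector_nine_ten hα hα1 hsx hW, spmEdge_eq_bisector_nine_ten hα hα1 hsx hW⟩

end

section

variable {α κ μ W sx x y : ℝ} {i j : ℕ}

/-! ### Heavy rectangles -/

/-- The constants of a heavy rectangle: `κ = √(α ^ 2 - 1)` and `μ = √(2 - α ^ 2)`. -/
structure IsHeavy (α κ μ : ℝ) : Prop where
  one_lt : 1 < α
  pos_left : 0 < κ
  pos_right : 0 < μ
  sq : α ^ 2 = 1 + κ ^ 2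
  sq_add_sq : κ ^ 2 + μ ^ 2 = 1

theorem isHeavy_sqrt (h1 : 1 < α) (h2 : α < √2) : IsHeavy α √(α ^ 2 - 1) √(2 - α ^ 2) := by
  have h3 : α ^ 2 < 2 := (Real.lt_sqrt (by linarith)).1 h2
  have h4 : 0 < α ^ 2 - 1 := by nlinarith
  refine ⟨h1, Real.sqrt_pos.2 h4, Real.sqrt_pos.2 (by linarith), ?_, ?_⟩
  · rw [Real.sq_sqrt h4.le]; ring
  · rw [Real.sq_sqrt h4.le, Real.sq_sqrt (by linarith)]; ring

namespace IsHeavy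

variable (H : IsHeavy α κ μ)
include H

theorem pos : 0 < α := zero_lt_one.trans H.one_lt

theorem lt_one : κ < 1 := by nlinarith [H.sq_add_sq, H.pos_right, H.pos_left]

theorem min_eq : min 1 α = 1 := min_eq_left H.one_lt.le

/-- Snell's law for a ray along a side of the rectangle. -/
theorem eq_of_critical {a b : ℝ} (ha : 0 ≤ a) (h : α * b = hyp a b) : a = κ * b := by
  have hb : 0 ≤ b := (mul_nonneg_iff_of_pos_left H.pos).1 (by rw [h]; exact hyp_nonneg _ _)
  have h1 := hyp_sq a b
  rw [← h, mul_pow, H.sq] at h1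
  refine (sq_eq_sq₀ ha (mul_nonneg H.pos_left.le hb)).1 ?_
  linarith [mul_pow κ b 2]

/-- Cauchy–Schwarz with the vector (1, -κ) of norm α. The left side is the linear cost of following
an edge and then entering at the critical angle. -/
theorem add_le_mul_hyp (a b : ℝ) : a - κ * b ≤ α * hyp a b := by
  have := mul_add_mul_le_hyp (a := 1) (b := -κ) (c := a) (d := b) H.pos.le
    (by rw [H.sq, neg_sq, one_pow])
  linarith

theorem eq_of_add_eq_mul_hyp {a b : ℝ} (h : a - κ * b = α * hyp a b) : b = -κ * a := by
  have := mul_add_mul_eq_hyp (a := 1) (b := -κ) (c := a) (d := b) (e := α)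
    (by rw [H.sq, neg_sq, one_pow]) (by linarith)
  linarith

theorem mul_hyp_eq {a : ℝ} (ha : 0 ≤ a) : α * hyp a (-κ * a) = a - κ * (-κ * a) := by
  have : hyp a (-κ * a) = α * a := hyp_eq_of_sq (mul_nonneg H.pos.le ha) (by
    rw [mul_pow, mul_pow, neg_sq, H.sq]; ring)
  rw [this]
  linear_combination a * H.sq

/-- Cauchy–Schwarz with the unit vector (-μ, κ), which up to the sign of the vertical coordinate is
the direction in which a critical ray leaves the left side. -/
theorem outside_le_hyp (a b : ℝ) : κ * b - μ * a ≤ hyp a b := by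
  have := mul_add_mul_le_hyp (a := -μ) (b := κ) (c := a) (d := b) zero_le_one
    (by linarith [H.sq_add_sq])
  linarith

theorem outside_eq_hyp_iff {a b : ℝ} (h : 0 ≤ κ * b - μ * a) :
    κ * b - μ * a = hyp a b ↔ μ * b = -κ * a := by
  have := mul_add_mul_eq_hyp_iff (a := -μ) (b := κ) (c := a) (d := b)
    (by linarith [H.sq_add_sq]) (by linarith)
  rw [show κ * b - μ * a = -μ * a + κ * b by ring, this]
  constructor <;> intro h <;> linarith

/-! ### Lengths and domains -/

/-- Stationarity in `b₁` gives -b₂ = κ b₁, and stationarity in `b₂` then fixes the outgoing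
direction, with components μ and κ in absolute value. Eliminating the vertices makes the length
linear; the final inequalities come from `b₂ < 0`, `b₁ < sx` and `-1 < b₂`. -/
theorem of_mem_typeGraph_five (hW : sx ≤ W) {t : ℝ × ℝ} {d : ℝ}
    (h : (t, d) ∈ typeGraph α W sx 5) : d = sx - κ * t.2 - μ * t.1 ∧ t.1 < 0 ∧
      μ * t.2 ≤ κ * t.1 ∧ κ * t.1 - κ * μ * sx ≤ μ * t.2 ∧ κ * t.1 - μ ≤ μ * t.2 := by
  obtain ⟨x, y⟩ := t
  obtain ⟨hx, ⟨v, ⟨hx', b₁, b₂, h1, h2, h3, h4, rfl⟩, rfl⟩, hmin⟩ := mem_typeGraph_iff.1 h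
  simp only at hx'
  have e : ∀ b₁ b₂, 0 < b₁ → b₁ < sx → -1 < b₂ → b₂ < 0 →
      pathLength α W sx (x, y) [(b₁, 0), (0, b₂)] =
        sx - b₁ + α * hyp b₁ b₂ + hyp x (b₂ - y) := fun b₁ b₂ h1 h2 h3 h4 => by
    rw [pathLength_top_left hW h1 h2.le h3.le h4 hx', H.min_eq, one_mul]
  have hρ := hyp_pos_left b₂ h1.ne'
  have hr := hyp_pos_left (b₂ - y) hx'.ne
  have hd1 : HasDerivAt (fun b => sx - b + α * hyp b b₂ + hyp x (b₂ - y))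
      (-1 + α * (b₁ / hyp b₁ b₂)) b₁ :=
    (((hasDerivAt_id b₁).const_sub sx).add
      ((hasDerivAt_hyp_left b₁ hρ.ne').const_mul α)).add_const _
  have k1 := deriv_eq_zero_of_isMinOn_Ioo hd1 h1 h2 fun b h1' h2' => by
    rw [← e b₁ b₂ h1 h2 h3 h4, ← e b b₂ h1' h2' h3 h4]
    exact hmin _ ⟨hx', b, b₂, h1', h2', h3, h4, rfl⟩
  have hd2 : HasDerivAt (fun b => sx - b₁ + α * hyp b₁ b + hyp x (b - y))
      (α * (b₂ / hyp b₁ b₂) + (b₂ - y) / hyp x (b₂ - y)) b₂ :=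
    (((hasDerivAt_hyp_right b₂ hρ.ne').const_mul α).const_add _).add
      (hasDerivAt_hyp_sub_right b₂ y hr.ne')
  have k2 := deriv_eq_zero_of_isMinOn_Ioo hd2 h3 h4 fun b h1' h2' => by
    rw [← e b₁ b₂ h1 h2 h3 h4, ← e b₁ b h1 h2 h1' h2']
    exact hmin _ ⟨hx', b₁, b, h1, h2, h1', h2', rfl⟩
  have l1 : α * b₁ = hyp b₁ b₂ := by field_simp at k1; linarith
  have l2 : -b₂ = κ * b₁ := H.eq_of_critical (by linarith) (by
    rw [l1, hyp_comm, hyp_neg_left])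
  have hα := H.pos
  have l3 : b₂ - y = κ * hyp x (b₂ - y) := by
    rw [← l1, show b₂ = -(κ * b₁) by linarith] at k2
    rw [show b₂ = -(κ * b₁) by linarith] at hr ⊢
    field_simp at k2
    linarith
  have hr2 := hyp_sq x (b₂ - y)
  rw [e b₁ b₂ h1 h2 h3 h4, ← l1]
  generalize hyp x (b₂ - y) = r at *
  have l4 : -x = μ * r := by
    refine (sq_eq_sq₀ (by linarith) (mul_nonneg H.pos_right.le hr.le)).1 ?_
    rw [l3] at hr2
    linear_combination -hr2 - r ^ 2 * H.sq_add_sq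
  have l5 : μ * y = μ * b₂ + κ * x := by linear_combination -μ * l3 + κ * l4
  have hμ := H.pos_right
  have hκ := H.pos_left
  simp only
  refine ⟨?_, hx', ?_, ?_, ?_⟩
  · linear_combination b₁ * H.sq - r * H.sq_add_sq - κ * l3 - μ * l4 - κ * l2
  · rw [l5]; nlinarith
  · rw [l5]; nlinarith [mul_pos (mul_pos hμ hκ) (sub_pos.2 h2)]
  · rw [l5]; nlinarith

theorem mem_closure_typeDomain_five (hW : sx ≤ W) {q : ℝ × ℝ}
    (hq : q ∈ closure (typeDomain α W sx 5)) : q.1 ≤ 0 ∧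
      μ * q.2 ≤ κ * q.1 ∧ κ * q.1 - κ * μ * sx ≤ μ * q.2 ∧ κ * q.1 - μ ≤ μ * q.2 := by
  refine of_mem_closure_typeDomain (P := fun q => q.1 ≤ 0 ∧
      μ * q.2 ≤ κ * q.1 ∧ κ * q.1 - κ * μ * sx ≤ μ * q.2 ∧ κ * q.1 - μ ≤ μ * q.2) ?_ ?_ hq
  · have h1 : IsClosed {q : ℝ × ℝ | q.1 ≤ 0} := isClosed_le (by fun_prop) (by fun_prop)
    have h2 : IsClosed {q : ℝ × ℝ | μ * q.2 ≤ κ * q.1} :=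
      isClosed_le (by fun_prop) (by fun_prop)
    have h3 : IsClosed {q : ℝ × ℝ | κ * q.1 - κ * μ * sx ≤ μ * q.2} :=
      isClosed_le (by fun_prop) (by fun_prop)
    have h4 : IsClosed {q : ℝ × ℝ | κ * q.1 - μ ≤ μ * q.2} :=
      isClosed_le (by fun_prop) (by fun_prop)
    exact h1.inter (h2.inter (h3.inter h4))
  · intro t d h
    obtain ⟨-, h1, h2⟩ := H.of_mem_typeGraph_five hW h
    exact ⟨h1.le, h2⟩

omit H in
theorem hasDerivAt_left_run (hsx : 0 < sx) (α b c : ℝ) :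
    HasDerivAt (fun b => α * hyp sx b + (b - c)) (α * (b / hyp sx b) + 1) b :=
  ((hasDerivAt_hyp_right b (hyp_pos_left b hsx.ne').ne').const_mul α).add
    ((hasDerivAt_id b).sub_const c)

/-- The point at which a path that starts along the left side reaches this side. -/
theorem left_run_critical (hsx : 0 < sx) {b : ℝ} (h : α * (b / hyp sx b) + 1 = 0) :
    sx = κ * -b ∧ α * hyp sx b = κ * sx - b := by
  have hρ := hyp_pos_left b hsx.ne'
  have l1 : α * -b = hyp sx (-b) := by
    rw [hyp_neg_right]; field_simp at h; linarith
  have l2 := H.eq_of_critical hsx.le l1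
  refine ⟨l2, ?_⟩
  rw [← hyp_neg_right, ← l1]
  linear_combination -b * H.sq - κ * l2

/-- Stationarity forces the left side to be reached at height -sx / κ, so the type exists only if
`sx < κ`. -/
theorem of_mem_typeGraph_seven (hsx : 0 < sx) (hW : sx ≤ W) {t : ℝ × ℝ} {d : ℝ}
    (h : (t, d) ∈ typeGraph α W sx 7) : d = κ * sx + 1 + hyp t.1 (t.2 + 1) ∧
      0 < t.1 ∧ t.2 < -1 ∧ sx < κ := by
  obtain ⟨x, y⟩ := t
  obtain ⟨hx, ⟨v, ⟨hx', hy, b, h1, h2, rfl⟩, rfl⟩, hmin⟩ := mem_typeGraph_iff.1 h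
  simp only at hx' hy
  have e : ∀ b, -1 < b → b < 0 → pathLength α W sx (x, y) [(0, b), (0, -1)] =
      α * hyp sx b + (b - (-1 - hyp x (y + 1))) := fun b h1 h2 => by
    rw [pathLength_left_corner hsx hW h1.le h2 hy, H.min_eq]; ring
  have k1 := deriv_eq_zero_of_isMinOn_Ioo (hasDerivAt_left_run hsx α b _) h1 h2 fun b' h1' h2' => by
    rw [← e b h1 h2, ← e b' h1' h2']
    exact hmin _ ⟨hx', hy, b', h1', h2', rfl⟩
  obtain ⟨l1, l2⟩ := H.left_run_critical hsx k1
  refine ⟨?_, hx', hy, ?_⟩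
  · rw [e b h1 h2, l2]; ring
  · nlinarith [H.pos_left]

theorem mem_closure_typeDomain_seven (hsx : 0 < sx) (hW : sx ≤ W) {q : ℝ × ℝ}
    (hq : q ∈ closure (typeDomain α W sx 7)) : 0 ≤ q.1 ∧ q.2 ≤ -1 ∧ sx ≤ κ := by
  refine of_mem_closure_typeDomain (P := fun q => 0 ≤ q.1 ∧ q.2 ≤ -1 ∧ sx ≤ κ) ?_ ?_ hq
  · have h1 : IsClosed {q : ℝ × ℝ | 0 ≤ q.1} := isClosed_le (by fun_prop) (by fun_prop)
    have h2 : IsClosed {q : ℝ × ℝ | q.2 ≤ -1} := isClosed_le (by fun_prop) (by fun_prop)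
    exact h1.inter (h2.inter isClosed_const)
  · intro t d h
    obtain ⟨-, h1, h2, h3⟩ := H.of_mem_typeGraph_seven hsx hW h
    exact ⟨h1.le, h2.le, h3.le⟩

/-- Both inner segments meet the left side at the critical angle, and the segment below the bottom
side then has components κ and μ in absolute value. The last inequality is the trace of `0 < b₃`. -/
theorem of_mem_typeGraph_eight (hsx : 0 < sx) (hW : sx ≤ W) {t : ℝ × ℝ} {d : ℝ}
    (h : (t, d) ∈ typeGraph α W sx 8) : d = κ * sx + 1 + κ * t.1 - μ * (t.2 + 1) ∧
      t.2 < -1 ∧ 0 ≤ μ * t.1 + κ * (t.2 + 1) := by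
  obtain ⟨x, y⟩ := t
  obtain ⟨hx, ⟨v, ⟨hy, b₁, b₂, b₃, h1, h2, h3, h4, h5, rfl⟩, rfl⟩, hmin⟩ := mem_typeGraph_iff.1 h
  simp only at hy
  have e : ∀ b₁ b₂ b₃, -1 < b₂ → b₂ < b₁ → b₁ < 0 → 0 < b₃ → b₃ < W →
      pathLength α W sx (x, y) [(0, b₁), (0, b₂), (b₃, -1)] =
        α * hyp sx b₁ + (b₁ - b₂) + α * hyp b₃ (b₂ + 1) + hyp (b₃ - x) (y + 1) :=
    fun b₁ b₂ b₃ h1 h2 h3 h4 h5 => by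
      rw [pathLength_left_bottom hsx hW h1 h2.le h3 h4 h5 hy, H.min_eq, one_mul]
  have hρ := hyp_pos_left (b₂ + 1) h4.ne'
  have hr := hyp_pos_right (b₃ - x) (by linarith : y + 1 ≠ 0)
  have k1 := deriv_eq_zero_of_isMinOn_Ioo
    (((hasDerivAt_left_run hsx α b₁ b₂).add_const (α * hyp b₃ (b₂ + 1))).add_const
      (hyp (b₃ - x) (y + 1))) h2 h3 fun b h1' h2' => by
    rw [← e b₁ b₂ b₃ h1 h2 h3 h4 h5, ← e b b₂ b₃ h1 h1' h2' h4 h5]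
    exact hmin _ ⟨hy, b, b₂, b₃, h1, h1', h2', h4, h5, rfl⟩
  have hd2 : HasDerivAt (fun b => α * hyp sx b₁ + (b₁ - b) + α * hyp b₃ (b + 1) +
      hyp (b₃ - x) (y + 1)) (-1 + α * ((b₂ + 1) / hyp b₃ (b₂ + 1))) b₂ := by
    have := (hasDerivAt_hyp_right (b₂ + 1) hρ.ne').comp_add_const b₂ 1
    exact ((((hasDerivAt_id b₂).const_sub b₁).const_add _).add (this.const_mul α)).add_const _
  have k2 := deriv_eq_zero_of_isMinOn_Ioo hd2 h1 h2 fun b h1' h2' => by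
    rw [← e b₁ b₂ b₃ h1 h2 h3 h4 h5, ← e b₁ b b₃ h1' h2' h3 h4 h5]
    exact hmin _ ⟨hy, b₁, b, b₃, h1', h2', h3, h4, h5, rfl⟩
  have hd3 : HasDerivAt (fun b => α * hyp sx b₁ + (b₁ - b₂) + α * hyp b (b₂ + 1) +
      hyp (b - x) (y + 1)) (α * (b₃ / hyp b₃ (b₂ + 1)) + (b₃ - x) / hyp (b₃ - x) (y + 1)) b₃ :=
    (((hasDerivAt_hyp_left b₃ hρ.ne').const_mul α).const_add _).add
      (hasDerivAt_hyp_sub_left b₃ x hr.ne')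
  have k3 := deriv_eq_zero_of_isMinOn_Ioo hd3 h4 h5 fun b h1' h2' => by
    rw [← e b₁ b₂ b₃ h1 h2 h3 h4 h5, ← e b₁ b₂ b h1 h2 h3 h1' h2']
    exact hmin _ ⟨hy, b₁, b₂, b, h1, h2, h3, h1', h2', rfl⟩
  obtain ⟨-, l1⟩ := H.left_run_critical hsx k1
  have l2 : α * (b₂ + 1) = hyp b₃ (b₂ + 1) := by field_simp at k2; linarith
  have l3 := H.eq_of_critical h4.le l2
  have hα := H.pos
  have hκ := H.pos_left
  have hμ := H.pos_right
  have l4 : x - b₃ = κ * hyp (b₃ - x) (y + 1) := by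
    have hb : 0 < b₂ + 1 := by linarith
    rw [← l2] at k3
    have : α * (b₃ / (α * (b₂ + 1))) = κ := by rw [l3]; field_simp
    rw [this] at k3
    field_simp at k3
    linarith
  have hr2 := hyp_sq (b₃ - x) (y + 1)
  rw [e b₁ b₂ b₃ h1 h2 h3 h4 h5, ← l2, l1]
  generalize hyp (b₃ - x) (y + 1) = r at *
  have l5 : -(y + 1) = μ * r := by
    refine (sq_eq_sq₀ (by linarith) (mul_nonneg hμ.le hr.le)).1 ?_
    rw [show b₃ - x = -(κ * r) by linarith] at hr2
    linear_combination -hr2 - r ^ 2 * H.sq_add_sq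
  simp only
  refine ⟨?_, hy, ?_⟩
  · linear_combination (b₂ + 1) * H.sq - r * H.sq_add_sq - κ * l3 - κ * l4 - μ * l5
  · have : μ * x + κ * (y + 1) = μ * b₃ := by linear_combination μ * l4 - κ * l5
    rw [this]; positivity

theorem mem_closure_typeDomain_eight (hsx : 0 < sx) (hW : sx ≤ W) {q : ℝ × ℝ}
    (hq : q ∈ closure (typeDomain α W sx 8)) : q.2 ≤ -1 ∧ 0 ≤ μ * q.1 + κ * (q.2 + 1) := by
  refine of_mem_closure_typeDomain
    (P := fun q => q.2 ≤ -1 ∧ 0 ≤ μ * q.1 + κ * (q.2 + 1)) ?_ ?_ hq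
  · have h1 : IsClosed {q : ℝ × ℝ | q.2 ≤ -1} := isClosed_le (by fun_prop) (by fun_prop)
    have h2 : IsClosed {q : ℝ × ℝ | 0 ≤ μ * q.1 + κ * (q.2 + 1)} :=
      isClosed_le (by fun_prop) (by fun_prop)
    exact h1.inter h2
  · intro t d h
    obtain ⟨-, h1, h2⟩ := H.of_mem_typeGraph_eight hsx hW h
    exact ⟨h1.le, h2⟩

theorem of_mem_typeGraph_eleven (hW : sx ≤ W) {t : ℝ × ℝ} {d : ℝ}
    (h : (t, d) ∈ typeGraph α W sx 11) : d = sx - t.1 - κ * t.2 ∧ t ∈ interior (rect W) ∧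
      -κ * (sx - t.1) ≤ t.2 := by
  obtain ⟨x, y⟩ := t
  obtain ⟨hx, ⟨v, ⟨hin, b, h1, h2, rfl⟩, rfl⟩, hmin⟩ := mem_typeGraph_iff.1 h
  have hin : (x, y) ∈ interior (rect W) := hin
  have hy := (mem_interior_rect.1 hin).2.2
  simp only at hy
  have e : ∀ b, 0 < b → b < sx → pathLength α W sx (x, y) [(b, 0)] =
      sx - b + α * hyp (b - x) y := fun b h1 h2 => by
    rw [pathLength_top_inside hW h1.le h2.le hin, H.min_eq, one_mul]
  have hρ := hyp_pos_right (b - x) hy.ne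
  have hd : HasDerivAt (fun b => sx - b + α * hyp (b - x) y)
      (-1 + α * ((b - x) / hyp (b - x) y)) b :=
    ((hasDerivAt_id b).const_sub sx).add ((hasDerivAt_hyp_sub_left b x hρ.ne').const_mul α)
  have k := deriv_eq_zero_of_isMinOn_Ioo hd h1 h2 fun b' h1' h2' => by
    rw [← e b h1 h2, ← e b' h1' h2']
    exact hmin _ ⟨hin, b', h1', h2', rfl⟩
  have l1 : α * (b - x) = hyp (b - x) y := by field_simp at k; linarith
  have l2 : -y = κ * (b - x) := H.eq_of_critical (by linarith) (by
    rw [l1, hyp_comm, hyp_neg_left])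
  rw [e b h1 h2, ← l1]
  refine ⟨?_, hin, ?_⟩
  · linear_combination (b - x) * H.sq - κ * l2
  · simp only
    nlinarith [H.pos_left]

/-- The left side is reached at height -sx / κ and left at height y + x / κ; the order of these two
heights is the last inequality. -/
theorem of_mem_typeGraph_thirteen (hsx : 0 < sx) (hW : sx ≤ W) {t : ℝ × ℝ} {d : ℝ}
    (h : (t, d) ∈ typeGraph α W sx 13) : d = κ * (sx + t.1) - t.2 ∧ t ∈ interior (rect W) ∧
      κ * t.2 ≤ -(sx + t.1) := by
  obtain ⟨x, y⟩ := t
  obtain ⟨hx, ⟨v, ⟨hin, b₁, b₂, h1, h2, h3, rfl⟩, rfl⟩, hmin⟩ := mem_typeGraph_iff.1 h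
  have hin : (x, y) ∈ interior (rect W) := hin
  have hx0 := (mem_interior_rect.1 hin).1.1
  have hy1 := (mem_interior_rect.1 hin).2.1
  simp only at hx0 hy1
  have e : ∀ b₁ b₂, -1 < b₂ → b₂ < b₁ → b₁ < 0 → pathLength α W sx (x, y) [(0, b₁), (0, b₂)] =
      α * hyp sx b₁ + (b₁ - b₂) + α * hyp x (b₂ - y) := fun b₁ b₂ h1 h2 h3 => by
    rw [pathLength_left_inside hsx hW h1.le h2.le h3 hin, H.min_eq, one_mul]
  have hρ := hyp_pos_left (b₂ - y) hx0.ne'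
  have k1 := deriv_eq_zero_of_isMinOn_Ioo
    ((hasDerivAt_left_run hsx α b₁ b₂).add_const (α * hyp x (b₂ - y))) h2 h3 fun b h1' h2' => by
    rw [← e b₁ b₂ h1 h2 h3, ← e b b₂ h1 h1' h2']
    exact hmin _ ⟨hin, b, b₂, h1, h1', h2', rfl⟩
  have hd2 : HasDerivAt (fun b => α * hyp sx b₁ + (b₁ - b) + α * hyp x (b - y))
      (-1 + α * ((b₂ - y) / hyp x (b₂ - y))) b₂ :=
    (((hasDerivAt_id b₂).const_sub b₁).const_add _).add
      ((hasDerivAt_hyp_sub_right b₂ y hρ.ne').const_mul α)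
  have k2 := deriv_eq_zero_of_isMinOn_Ioo hd2 h1 h2 fun b h1' h2' => by
    rw [← e b₁ b₂ h1 h2 h3, ← e b₁ b h1' h2' h3]
    exact hmin _ ⟨hin, b₁, b, h1', h2', h3, rfl⟩
  obtain ⟨l0, l1⟩ := H.left_run_critical hsx k1
  have l2 : α * (b₂ - y) = hyp x (b₂ - y) := by field_simp at k2; linarith
  have l3 := H.eq_of_critical hx0.le l2
  rw [e b₁ b₂ h1 h2 h3, ← l2, l1]
  refine ⟨?_, hin, ?_⟩
  · linear_combination (b₂ - y) * H.sq - κ * l3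
  · simp only
    nlinarith [H.pos_left]

end IsHeavy

theorem of_mem_typeGraph_twelve (hsx : 0 < sx) (hW : sx ≤ W) {t : ℝ × ℝ} {d : ℝ}
    (h : (t, d) ∈ typeGraph α W sx 12) : d = α * directLength sx t ∧ t ∈ interior (rect W) := by
  obtain ⟨x, y⟩ := t
  obtain ⟨hx, ⟨v, ⟨hin, rfl⟩, rfl⟩, hmin⟩ := mem_typeGraph_iff.1 h
  exact ⟨pathLength_direct_inside hsx hW hin, hin⟩

theorem mem_closure_typeDomain_le {q : ℝ × ℝ} (hq : q ∈ closure (typeDomain α W sx i)) :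
    q.1 ≤ sx :=
  of_mem_closure_typeDomain (P := fun q => q.1 ≤ sx) (isClosed_le continuous_fst continuous_const)
    (fun _ _ h => (mem_typeGraph_iff.1 h).1) hq

end

section

variable {α κ μ W sx x y : ℝ} {i j : ℕ}

/-! ### The bisectors of a heavy rectangle -/

theorem bisector_eq_and_spmEdge_subset (hα : 0 < α) {f g : ℝ × ℝ → ℝ} (hf : Continuous f)
    (hg : Continuous g) (h : ∀ t d, (t, d) ∈ typeGraph α W sx i → d = f t)
    (h' : ∀ t d, (t, d) ∈ typeGraph α W sx j → d = g t) {C : Set (ℝ × ℝ)}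
    (hC : ∀ q, q ∉ frontier (rect W) → q ∈ closure (typeDomain α W sx i) →
      q ∈ closure (typeDomain α W sx j) → (f q = g q ↔ q ∈ C)) :
    bisector α W sx i j = curvePart α W sx i j C ∧ spmEdge α W sx i j ⊆ bisector α W sx i j :=
  ⟨bisector_eq_curvePart hf hg h h' hC, spmEdge_subset_bisector hα hf hg h h'⟩

theorem mem_rect_of_mem_closure {i : ℕ} (h : typeDomain α W sx i ⊆ interior (rect W)) {q : ℝ × ℝ}
    (hq : q ∈ closure (typeDomain α W sx i)) : (0 ≤ q.1 ∧ q.1 ≤ W) ∧ -1 ≤ q.2 ∧ q.2 ≤ 0 :=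
  closure_minimal (h.trans interior_subset) (isClosed_rect W) hq

namespace IsHeavy

variable (H : IsHeavy α κ μ)
include H

theorem bisector_one_four (hsx : 0 < sx) (hW : sx ≤ W) :
    bisector α W sx 1 4 = curvePart α W sx 1 4 {q | q.2 = 0} ∧
      spmEdge α W sx 1 4 ⊆ bisector α W sx 1 4 := by
  refine bisector_eq_and_spmEdge_subset (g := fun t => min 1 α * sx + hyp t.1 t.2) H.pos
    continuous_directLength (by fun_prop)
    eq_directLength_of_mem_typeGraph (eq_of_mem_typeGraph_four hsx hW) ?_
  rintro ⟨x, y⟩ hq h1 h2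
  obtain ⟨hx, hy⟩ := mem_closure_typeDomain_four h2
  have hy' := mem_closure_typeDomain_one h1
  simp only at hx hy hy'
  obtain rfl : y = 0 := le_antisymm hy hy'
  refine iff_of_true ?_ rfl
  simp only [directLength, H.min_eq, hyp_zero_right]
  rw [abs_of_neg (by linarith), abs_of_nonpos hx]
  ring

theorem bisector_four_five (hsx : 0 < sx) (hW : sx ≤ W) :
    bisector α W sx 4 5 = curvePart α W sx 4 5 {q | q.2 = κ / μ * q.1} ∧
      spmEdge α W sx 4 5 ⊆ bisector α W sx 4 5 := by
  refine bisector_eq_and_spmEdge_subset (f := fun t => min 1 α * sx + hyp t.1 t.2)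
    (g := fun t => sx - κ * t.2 - μ * t.1) H.pos (by fun_prop) (by fun_prop)
    (eq_of_mem_typeGraph_four hsx hW) (fun t d h => (H.of_mem_typeGraph_five hW h).1) ?_
  rintro ⟨x, y⟩ hq h1 h2
  obtain ⟨hx, hy⟩ := mem_closure_typeDomain_four h1
  have hκ := H.pos_left
  have hμ := H.pos_right
  simp only [H.min_eq] at *
  change _ ↔ y = _
  have h3 := H.outside_eq_hyp_iff (a := x) (b := -y) (by nlinarith)
  rw [hyp_neg_right] at h3
  have h4 : y = κ / μ * x ↔ μ * -y = -κ * x := by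
    rw [div_mul_eq_mul_div, eq_div_iff hμ.ne']
    constructor <;> intro h <;> linarith
  rw [h4, ← h3]
  constructor <;> intro h <;> linarith

/-- The exit point cancels from the sum of the two bounds, leaving the length of type 5. -/
theorem leftLength_ge (w : ℝ) :
    (sx - κ * w) + (κ * (w - y) - μ * x) ≤ leftLength α sx (x, y) w :=
  add_le_add (H.add_le_mul_hyp _ _) (H.outside_le_hyp _ _)

/-- The path that leaves the rectangle at `(0, -κ * sx)` on the line that separates the targets
of types 5 and 6. -/
theorem leftLength_eq (hsx : 0 < sx) (hx : x ≤ 0) (h : μ * y = κ * x - κ * μ * sx) :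
    leftLength α sx (x, y) (-κ * sx) = sx - κ * y - μ * x := by
  have h1 := H.mul_hyp_eq hsx.le
  have hκ := H.pos_left
  have hμ := H.pos_right
  have h2 : hyp x (-κ * sx - y) = κ * (-κ * sx - y) - μ * x := by
    refine ((H.outside_eq_hyp_iff ?_).2 (by linarith)).symm
    have : 0 ≤ -κ * sx - y := by
      refine (mul_nonneg_iff_of_pos_left hμ).1 ?_
      nlinarith
    nlinarith
  simp only [leftLength]
  rw [h1, h2]; ring

/-- The minimum over exit points reaches the bound of `leftLength_ge` only if both Cauchy–Schwarz
inequalities are tight for the same w. The first forces w = -κ sx, and the second then puts the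
target on the line. -/
theorem bisector_five_six (hsx : 0 < sx) (hW : sx ≤ W) :
    bisector α W sx 5 6 = curvePart α W sx 5 6 {q | q.2 = κ / μ * q.1 - κ * sx} ∧
      spmEdge α W sx 5 6 ⊆ bisector α W sx 5 6 := by
  refine bisector_eq_and_spmEdge_subset (f := fun t => sx - κ * t.2 - μ * t.1) H.pos (by fun_prop)
    continuous_minLeftLength
    (fun t d h => (H.of_mem_typeGraph_five hW h).1) (eq_minLeftLength_of_mem_typeGraph hsx hW) ?_
  rintro ⟨x, y⟩ hq h1 h2
  obtain ⟨hx, -, -, h3⟩ := H.mem_closure_typeDomain_five hW h1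
  have hκ := H.pos_left
  have hμ := H.pos_right
  simp only at hx h3 ⊢
  change _ ↔ y = _
  have h4 : y = κ / μ * x - κ * sx ↔ μ * y = κ * x - κ * μ * sx := by
    rw [show κ / μ * x - κ * sx = (κ * x - κ * μ * sx) / μ by field_simp, eq_div_iff hμ.ne', mul_comm]
  rw [h4]
  constructor
  · intro h
    obtain ⟨w, -, hw⟩ := exists_minLeftLength_eq (α := α) (sx := sx) (x, y)
    rw [hw] at h
    have k1 := H.add_le_mul_hyp sx w
    have k2 := H.outside_le_hyp x (w - y)
    simp only [leftLength] at h
    have k3 : sx - κ * w = α * hyp sx w := by linarith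
    have k4 : κ * (w - y) - μ * x = hyp x (w - y) := by linarith
    have k5 := H.eq_of_add_eq_mul_hyp k3
    have k6 := (H.outside_eq_hyp_iff (by rw [k4]; exact hyp_nonneg _ _)).1 k4
    rw [k5] at k6
    linarith
  · intro h
    rw [← H.leftLength_eq hsx hx h, eq_comm, minLeftLength_eq_iff]
    · intro w _
      rw [H.leftLength_eq hsx hx h]
      have := H.leftLength_ge (sx := sx) (x := x) (y := y) w
      linarith
    -- That -κ sx is at least -1 follows from the domain inequality that `-1 < b₂` left behind in
    -- type 5.
    · constructor
      · nlinarith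
      · nlinarith

/-- The closed domains meet only on x = 0. There the outer part of a type 6 path degenerates to a
run down the left side and beyond, and the best exit height -sx / κ is the one used by type 7. -/
theorem bisector_six_seven (hsx : 0 < sx) (hW : sx ≤ W) :
    bisector α W sx 6 7 = curvePart α W sx 6 7 {q | q.1 = 0} ∧
      spmEdge α W sx 6 7 ⊆ bisector α W sx 6 7 := by
  refine bisector_eq_and_spmEdge_subset (g := fun t => κ * sx + 1 + hyp t.1 (t.2 + 1)) H.pos
    continuous_minLeftLength (by fun_prop) (eq_minLeftLength_of_mem_typeGraph hsx hW)
    (fun t d h => (H.of_mem_typeGraph_seven hsx hW h).1) ?_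
  rintro ⟨x, y⟩ hq h1 h2
  obtain ⟨hx, hy, hs⟩ := H.mem_closure_typeDomain_seven hsx hW h2
  have hx' := (mem_closure_typeDomain_six H.pos hsx hW h1).1
  have hκ := H.pos_left
  simp only at hx hy hx' ⊢
  obtain rfl : x = 0 := le_antisymm hx' hx
  refine iff_of_true ?_ rfl
  have hw : -(sx / κ) ∈ Icc (-1 : ℝ) 0 := by
    constructor
    · rw [neg_le_neg_iff, div_le_one hκ]; exact hs
    · rw [neg_nonpos]; positivity
  have h3 : hyp sx (-(sx / κ)) = α * (sx / κ) := by
    refine hyp_eq_of_sq (mul_nonneg H.pos.le (by positivity)) ?_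
    rw [mul_pow, H.sq]; field_simp; ring
  have h4 : leftLength α sx (0, y) (-(sx / κ)) = κ * sx - y := by
    simp only [leftLength]
    rw [h3, hyp_zero_left, abs_of_nonneg (by linarith [hw.1]), ← mul_assoc, ← pow_two, H.sq]
    field_simp; ring
  rw [hyp_zero_left, abs_of_nonpos (by linarith),
    show κ * sx + 1 + -(y + 1) = leftLength α sx (0, y) (-(sx / κ)) by rw [h4]; ring,
    minLeftLength_eq_iff hw]
  intro w hw'
  rw [h4]
  have h5 := H.add_le_mul_hyp (-w) (-sx)
  rw [hyp_comm, hyp_neg_left, hyp_neg_right] at h5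
  simp only [leftLength]
  rw [hyp_zero_left, abs_of_nonneg (by linarith [hw'.1])]
  linarith

theorem bisector_seven_eight (hsx : 0 < sx) (hW : sx ≤ W) :
    bisector α W sx 7 8 = curvePart α W sx 7 8 {q | q.2 = -1 - μ / κ * q.1} ∧
      spmEdge α W sx 7 8 ⊆ bisector α W sx 7 8 := by
  refine bisector_eq_and_spmEdge_subset (f := fun t => κ * sx + 1 + hyp t.1 (t.2 + 1))
    (g := fun t => κ * sx + 1 + κ * t.1 - μ * (t.2 + 1)) H.pos
    (by fun_prop) (by fun_prop) (fun t d h => (H.of_mem_typeGraph_seven hsx hW h).1)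
    (fun t d h => (H.of_mem_typeGraph_eight hsx hW h).1) ?_
  rintro ⟨x, y⟩ hq h1 h2
  obtain ⟨hx, hy, -⟩ := H.mem_closure_typeDomain_seven hsx hW h1
  have hκ := H.pos_left
  have hμ := H.pos_right
  simp only at hx hy ⊢
  change _ ↔ y = _
  have h3 := H.outside_eq_hyp_iff (a := y + 1) (b := x) (by nlinarith)
  rw [hyp_comm] at h3
  have h4 : y = -1 - μ / κ * x ↔ μ * x = -κ * (y + 1) := by
    field_simp
    constructor <;> intro h <;> linarith
  rw [h4, ← h3]
  constructor <;> intro h <;> linarith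

theorem bisector_eleven_twelve (hsx : 0 < sx) (hW : sx ≤ W) :
    bisector α W sx 11 12 = curvePart α W sx 11 12 {q | q.2 = -κ * (sx - q.1)} ∧
      spmEdge α W sx 11 12 ⊆ bisector α W sx 11 12 := by
  refine bisector_eq_and_spmEdge_subset (f := fun t => sx - t.1 - κ * t.2)
    (g := fun t => α * directLength sx t) H.pos
    (by fun_prop) (by fun_prop) (fun t d h => (H.of_mem_typeGraph_eleven hW h).1)
    (fun t d h => (of_mem_typeGraph_twelve hsx hW h).1) ?_
  rintro ⟨x, y⟩ hq h1 h2
  have hx := mem_closure_typeDomain_le h1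
  simp only [directLength] at hx ⊢
  rw [hyp_sub_left]
  change _ ↔ y = -κ * (sx - x)
  constructor
  · exact H.eq_of_add_eq_mul_hyp
  · rintro rfl
    exact (H.mul_hyp_eq (sub_nonneg.2 hx)).symm

/-- Squared, the equation reads (κ y + sx + x)² = 4 α² sx x. The domain of type 13 gives the sign of
κ y + sx + x and so selects the branch. -/
theorem bisector_twelve_thirteen (hsx : 0 < sx) (hW : sx ≤ W) :
    bisector α W sx 12 13 = curvePart α W sx 12 13
      {q | q.2 = -((sx + q.1 + 2 * α * √(sx * q.1)) / κ)} ∧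
      spmEdge α W sx 12 13 ⊆ bisector α W sx 12 13 := by
  refine bisector_eq_and_spmEdge_subset (f := fun t => α * directLength sx t)
    (g := fun t => κ * (sx + t.1) - t.2) H.pos
    (by fun_prop) (by fun_prop) (fun t d h => (of_mem_typeGraph_twelve hsx hW h).1)
    (fun t d h => (H.of_mem_typeGraph_thirteen hsx hW h).1) ?_
  rintro ⟨x, y⟩ hq h1 h2
  obtain ⟨⟨hx, -⟩, -, hy⟩ := mem_rect_of_mem_closure
    (fun t ⟨d, h⟩ => (of_mem_typeGraph_twelve hsx hW h).2) h1
  have hk := of_mem_closure_typeDomain (P := fun q => κ * q.2 ≤ -(sx + q.1))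
    (isClosed_le (f := fun q : ℝ × ℝ => κ * q.2) (g := fun q : ℝ × ℝ => -(sx + q.1))
      (by fun_prop) (by fun_prop))
    (fun t d h => (H.of_mem_typeGraph_thirteen hsx hW h).2.2) h2
  have hκ := H.pos_left
  have hα := H.pos
  simp only [directLength] at hx hy hk ⊢
  change _ ↔ y = _
  have hs := Real.sq_sqrt (mul_nonneg hsx.le hx)
  have hs0 := Real.sqrt_nonneg (sx * x)
  generalize √(sx * x) = s at *
  have e1 : α * hyp (x - sx) y = κ * (sx + x) - y ↔ -(κ * y + (sx + x)) = 2 * α * s := by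
    have n1 : 0 ≤ κ * (sx + x) - y := by nlinarith
    have n2 : 0 ≤ -(κ * y + (sx + x)) := by linarith
    have n3 : 0 ≤ 2 * α * s := by positivity
    rw [← sq_eq_sq₀ (mul_nonneg hα.le (hyp_nonneg _ _)) n1, ← sq_eq_sq₀ n2 n3, mul_pow, hyp_sq,
      mul_pow _ s, hs, mul_pow, H.sq]
    constructor <;> intro h
    · linear_combination h
    · linear_combination h
  rw [e1]
  field_simp
  constructor <;> intro h <;> linarith

/-! ### Cells of a heavy rectangle -/

/-- The lower bound from a potential that falls with slopes `p` and `q` inside the rectangle. -/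
theorem le_pathLength_left (hsx : 0 < sx) (hW : sx ≤ W) {l p q : ℝ} (h1 : l ^ 2 + q ^ 2 = 1)
    (h2 : p ^ 2 ≤ 1) (h3 : p ^ 2 + q ^ 2 ≤ α ^ 2) (hx : x ≤ 0) (hy : -1 ≤ y) (hy' : y ≤ 0)
    (v : List (ℝ × ℝ)) : p * sx - l * x - q * y ≤ pathLength α W sx (x, y) v := by
  have hc : IsCalibration α (-l) (-p) 0 0 (-q) 0 := by
    constructor <;> nlinarith
  refine le_trans (le_of_eq ?_) (hc.le_pathLength H.pos hsx.le hW (x, y) v)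
  rw [potential, ramp_of_le (hsx.le.trans hW) hx, ramp_of_mem hy hy']
  ring

/-- The gradient (-1, -κ) has the norm α allowed inside. Its extension uses the unit vector (-μ, -κ)
on the left and sets the horizontal slope to zero on the right and the vertical slope to zero above
and below. -/
theorem le_pathLength_inside (hsx : 0 < sx) (hW : sx ≤ W) (hin : (x, y) ∈ interior (rect W))
    (v : List (ℝ × ℝ)) : sx - x - κ * y ≤ pathLength α W sx (x, y) v := by
  obtain ⟨⟨h1, h2⟩, h3, h4⟩ := mem_interior_rect.1 hin
  simp only at h1 h2 h3 h4
  have hκ := H.lt_one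
  have hκ0 := H.pos_left
  have hsq := H.sq
  have hc : IsCalibration α (-μ) (-1) 0 0 (-κ) 0 := by
    constructor <;> nlinarith [H.sq_add_sq]
  refine le_trans (le_of_eq ?_) (hc.le_pathLength H.pos hsx.le hW (x, y) v)
  rw [potential, ramp_of_mem h1.le h2.le, ramp_of_mem h3.le h4.le]
  ring

theorem mem_cell_one (hsx : 0 < sx) (hW : sx ≤ W) (hx : x ≤ sx) (hy : 0 < y) :
    (x, y) ∈ cell α W sx 1 := by
  refine WeightedRectangle.mem_cell_one H.pos hsx hW hx hy ?_
  have h1 : sx - x ≤ hyp (x - sx) y := by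
    have := mul_add_mul_le_hyp (a := -1) (b := 0) (c := x - sx) (d := y) zero_le_one (by norm_num)
    linarith
  nlinarith [H.one_lt, hyp_nonneg (x - sx) y]

/-- Inside the rectangle the calibrating gradient is (-1, y / r), and the last hypothesis keeps its
norm at most α. -/
theorem mem_cell_four (hsx : 0 < sx) (hW : sx ≤ W) (hx : x < 0) (hy : y < 0) (hy' : -1 ≤ y)
    (h : -y ≤ κ * hyp x y) : (x, y) ∈ cell α W sx 4 := by
  refine ⟨(hx.trans hsx).le, [(0, 0)], ⟨hx, hy, rfl⟩, fun v => ?_⟩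
  rw [pathLength_corner hsx hW hx, H.min_eq]
  have hr := hyp_pos_left y hx.ne
  have hsq := hyp_sq x y
  generalize hyp x y = r at *
  have e : (-x / r) ^ 2 + (-y / r) ^ 2 = 1 := by field_simp; linarith
  have e2 : (-y / r) ^ 2 ≤ κ ^ 2 := by
    rw [div_pow, div_le_iff₀ (by positivity), ← mul_pow]
    exact pow_le_pow_left₀ (by linarith) h 2
  refine le_trans (le_of_eq ?_) (H.le_pathLength_left hsx hW e (p := 1) (by norm_num)
    (by rw [H.sq]; linarith) hx.le hy' hy.le v)
  field_simp
  linear_combination hsq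

theorem mem_cell_five (hsx : 0 < sx) (hW : sx ≤ W) :
    typeDomain α W sx 5 ∩ {q | -1 < q.2} ⊆ cell α W sx 5 := by
  rintro ⟨x, y⟩ ⟨ht, hy : -1 < y⟩
  refine mem_cell_of_mem_typeDomain (f := fun t => sx - κ * t.2 - μ * t.1)
    (fun t d h => (H.of_mem_typeGraph_five hW h).1) ht fun v => ?_
  obtain ⟨hx, h1, -⟩ := H.mem_closure_typeDomain_five hW (subset_closure ht)
  simp only at hx h1 ⊢
  have hy' : y ≤ 0 := by nlinarith [H.pos_left, H.pos_right]
  have := H.le_pathLength_left hsx hW (l := μ) (p := 1) (q := κ) (by linarith [H.sq_add_sq])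
    (by norm_num) (by rw [H.sq]; norm_num) hx hy.le hy' v
  linarith

/-- On the line shared with type 5, the calibration that certifies type 5 certifies type 6 as well.
-/
theorem mem_cell_six (hsx : 0 < sx) (hW : sx ≤ W) (hx : x < 0) (hy : -1 < y)
    (h : μ * y = κ * x - κ * μ * sx) : (x, y) ∈ cell α W sx 6 := by
  have hκ := H.pos_left
  have hμ := H.pos_right
  have hw : -κ * sx < 0 := by nlinarith
  have hy' : y < -κ * sx := by
    have : μ * y < μ * (-κ * sx) := by nlinarith
    exact lt_of_mul_lt_mul_left this hμ.le
  refine ⟨(hx.trans hsx).le, [(0, -κ * sx)], ⟨hx, _, hy.trans hy', hw, rfl⟩, fun v => ?_⟩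
  rw [pathLength_left hsx hW (hy.trans hy').le hw hx]
  have h1 := H.leftLength_eq hsx hx.le h
  have h2 := H.le_pathLength_left hsx hW (l := μ) (p := 1) (q := κ) (by linarith [H.sq_add_sq])
    (by norm_num) (by rw [H.sq]; norm_num) hx.le hy.le (hy'.trans hw).le v
  simp only [leftLength] at h1
  linarith

theorem typeDomain_eleven_subset_cell (hsx : 0 < sx) (hW : sx ≤ W) :
    typeDomain α W sx 11 ⊆ cell α W sx 11 := by
  rintro ⟨x, y⟩ ht
  refine mem_cell_of_mem_typeDomain (f := fun t => sx - t.1 - κ * t.2)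
    (fun t d h => (H.of_mem_typeGraph_eleven hW h).1) ht fun v => ?_
  obtain ⟨d, hd⟩ := ht
  exact H.le_pathLength_inside hsx hW (H.of_mem_typeGraph_eleven hW hd).2.1 v

theorem mem_cell_twelve (hsx : 0 < sx) (hW : sx ≤ W) (hx : x ≤ sx)
    (hin : (x, y) ∈ interior (rect W)) (h : y = -κ * (sx - x)) : (x, y) ∈ cell α W sx 12 := by
  refine ⟨hx, [], ⟨hin, rfl⟩, fun v => ?_⟩
  refine le_trans (le_of_eq ?_) (H.le_pathLength_inside hsx hW hin v)
  rw [pathLength_direct_inside hsx hW hin, hyp_sub_left, h]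
  exact H.mul_hyp_eq (sub_nonneg.2 hx)

/-! ### Edges of the map of a heavy rectangle -/

theorem mem_spmEdge_one_four (hsx : 0 < sx) (hW : sx ≤ W) {q : ℝ × ℝ}
    (h : q ∈ bisector α W sx 1 4) : q ∈ spmEdge α W sx 1 4 := by
  rw [(H.bisector_one_four hsx hW).1] at h
  obtain ⟨x, y⟩ := q
  obtain ⟨hq, h1, h2, h3⟩ := h
  obtain rfl : y = 0 := h3
  have hx := (mem_closure_typeDomain_four h2).1
  simp only at hx
  have hx0 : x ≠ 0 := by
    rintro rfl
    exact hq (origin_mem_frontier hsx hW)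
  have hx1 := lt_of_le_of_ne hx hx0
  refine ⟨hq, ?_, ?_⟩
  · refine mem_closure_of_eventually (f := fun ε => (x, ε)) (by fun_prop) ?_
    filter_upwards [self_mem_nhdsWithin] with ε hε
    exact H.mem_cell_one hsx hW (hx.trans hsx.le) hε
  · have := mem_closure_of_eventually (S := cell α W sx 4) (f := fun ε => (x, -ε))
      (by fun_prop) ?_
    · simpa using this
    have hc : Tendsto (fun ε => κ * hyp x (-ε) - ε) (𝓝[>] 0) (𝓝 (κ * hyp x (-0) - 0)) :=
      ((by fun_prop : Continuous fun ε => κ * hyp x (-ε) - ε).tendsto 0).mono_left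
        nhdsWithin_le_nhds
    have hlt : 0 < κ * hyp x (-0) - 0 := by
      rw [neg_zero, sub_zero, hyp_zero_right]
      exact mul_pos H.pos_left (abs_pos.2 hx0)
    filter_upwards [hc.eventually_const_lt hlt, Ioo_mem_nhdsGT one_pos] with ε h1 h2
    exact H.mem_cell_four hsx hW hx1 (by linarith [h2.1]) (by linarith [h2.2]) (by linarith)

/-- The half-plane y > -1 is open, so a limit of targets that lies in it is a limit of targets
inside it, where the calibration applies. -/
theorem mem_closure_cell_five (hsx : 0 < sx) (hW : sx ≤ W) {q : ℝ × ℝ}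
    (h : q ∈ closure (typeDomain α W sx 5)) (hy : -1 < q.2) : q ∈ closure (cell α W sx 5) := by
  have ho : IsOpen {q : ℝ × ℝ | -1 < q.2} := isOpen_lt continuous_const continuous_snd
  have := ho.inter_closure ⟨hy, h⟩
  rw [inter_comm] at this
  exact closure_mono (H.mem_cell_five hsx hW) this

theorem mem_spmEdge_four_five (hsx : 0 < sx) (hW : sx ≤ W) {q : ℝ × ℝ}
    (h : q ∈ bisector α W sx 4 5) (hy : -1 < q.2) : q ∈ spmEdge α W sx 4 5 := by
  rw [(H.bisector_four_five hsx hW).1] at h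
  obtain ⟨hq, h1, h2, h3⟩ := h
  refine ⟨hq, subset_closure ?_, H.mem_closure_cell_five hsx hW h2 hy⟩
  obtain ⟨x, y⟩ := q
  have h3 : y = κ / μ * x := h3
  have hy : -1 < y := hy
  have hκ := H.pos_left
  have hμ := H.pos_right
  obtain ⟨hx, -⟩ := mem_closure_typeDomain_four h1
  simp only at hx
  have hx0 : x ≠ 0 := by
    rintro rfl
    rw [mul_zero] at h3
    subst h3
    exact hq (origin_mem_frontier hsx hW)
  have hx1 := lt_of_le_of_ne hx hx0
  have hr : hyp x y = -x / μ := by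
    refine hyp_eq_of_sq (div_nonneg (by linarith) hμ.le) ?_
    rw [h3]
    field_simp
    linarith [H.sq_add_sq]
  refine H.mem_cell_four hsx hW hx1 ?_ hy.le ?_
  · rw [h3]
    exact mul_neg_of_pos_of_neg (div_pos hκ hμ) hx1
  · rw [hr, h3]
    field_simp
    exact le_rfl

theorem mem_spmEdge_five_six (hsx : 0 < sx) (hW : sx ≤ W) {q : ℝ × ℝ}
    (h : q ∈ bisector α W sx 5 6) (hy : -1 < q.2) : q ∈ spmEdge α W sx 5 6 := by
  rw [(H.bisector_five_six hsx hW).1] at h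
  obtain ⟨hq, h1, h2, h3⟩ := h
  refine ⟨hq, H.mem_closure_cell_five hsx hW h1 hy, subset_closure ?_⟩
  obtain ⟨x, y⟩ := q
  have h3 : y = κ / μ * x - κ * sx := h3
  have hy : -1 < y := hy
  have hκ := H.pos_left
  have hμ := H.pos_right
  have hx := (H.mem_closure_typeDomain_five hW h1).1
  simp only at hx
  -- On x = 0 the line passes through (0, -κ sx), a point of the left side.
  have hx0 : x ≠ 0 := by
    rintro rfl
    refine hq (mem_frontier_rect.2 ?_)
    simp only
    rw [mul_zero] at h3
    exact ⟨⟨⟨le_rfl, by linarith⟩, hy.le, by nlinarith⟩, by simp⟩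
  refine H.mem_cell_six hsx hW (lt_of_le_of_ne hx hx0) hy ?_
  rw [h3]
  field_simp

theorem mem_spmEdge_eleven_twelve (hsx : 0 < sx) (hW : sx ≤ W) {q : ℝ × ℝ}
    (h : q ∈ bisector α W sx 11 12) : q ∈ spmEdge α W sx 11 12 := by
  rw [(H.bisector_eleven_twelve hsx hW).1] at h
  obtain ⟨hq, h1, h2, h3⟩ := h
  refine ⟨hq, closure_mono (H.typeDomain_eleven_subset_cell hsx hW) h1, subset_closure ?_⟩
  have hin : q ∈ interior (rect W) := by
    by_contra hc
    exact hq (mem_frontier_rect.2 ⟨mem_rect_of_mem_closure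
      (fun t ⟨d, h⟩ => (H.of_mem_typeGraph_eleven hW h).2.1) h1,
      fun h' => hc (mem_interior_rect.2 h')⟩)
  exact H.mem_cell_twelve hsx hW (mem_closure_typeDomain_le h1) hin h3

theorem case_pairs (hsx : 0 < sx) (hW : sx ≤ W) (hκ : κ = √(α ^ 2 - 1))
    (hμ : μ = √(2 - α ^ 2)) : ∀ p ∈ heavyPairs,
      bisector α W sx p.1 p.2 = curvePart α W sx p.1 p.2 (heavyCurve α sx p) ∧
      spmEdge α W sx p.1 p.2 ⊆ bisector α W sx p.1 p.2 ∧
      (p ≠ (12, 13) →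
        ∀ q ∈ bisector α W sx p.1 p.2, -1 < q.2 → q ∈ spmEdge α W sx p.1 p.2) := by
  intro p hp
  simp only [heavyPairs, mem_insert_iff, mem_singleton_iff] at hp
  -- Type 7 only has targets below the rectangle, so the claim about y > -1 is vacuous for its
  -- pairs.
  have below : ∀ i, ∀ q ∈ bisector α W sx i 7 ∪ bisector α W sx 7 i, ¬ -1 < q.2 := by
    intro i q hq hy
    have key : ∀ d, (q, d) ∈ closure (typeGraph α W sx 7) → False := fun d hd => by
      have := ((mem_closure_typeGraph_iff
        (f := fun t => κ * sx + 1 + hyp t.1 (t.2 + 1)) (by fun_prop)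
        (fun t d h => (H.of_mem_typeGraph_seven hsx hW h).1)).1 hd).1
      linarith [(H.mem_closure_typeDomain_seven hsx hW this).2.1]
    rcases hq with ⟨-, d, -, hd⟩ | ⟨-, d, hd, -⟩ <;> exact key d hd
  subst hκ hμ
  rcases hp with rfl | rfl | rfl | rfl | rfl | rfl | rfl
  · obtain ⟨h1, h2⟩ := H.bisector_one_four hsx hW
    exact ⟨h1, h2, fun _ q hq _ => H.mem_spmEdge_one_four hsx hW hq⟩
  · obtain ⟨h1, h2⟩ := H.bisector_four_five hsx hW
    exact ⟨h1, h2, fun _ q hq hy => H.mem_spmEdge_four_five hsx hW hq hy⟩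
  · obtain ⟨h1, h2⟩ := H.bisector_five_six hsx hW
    exact ⟨h1, h2, fun _ q hq hy => H.mem_spmEdge_five_six hsx hW hq hy⟩
  · obtain ⟨h1, h2⟩ := H.bisector_six_seven hsx hW
    exact ⟨h1, h2, fun _ q hq hy => absurd hy (below 6 q (Or.inl hq))⟩
  · obtain ⟨h1, h2⟩ := H.bisector_seven_eight hsx hW
    exact ⟨h1, h2, fun _ q hq hy => absurd hy (below 8 q (Or.inr hq))⟩
  · obtain ⟨h1, h2⟩ := H.bisector_eleven_twelve hsx hW
    exact ⟨h1, h2, fun _ q hq _ => H.mem_spmEdge_eleven_twelve hsx hW hq⟩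
  · obtain ⟨h1, h2⟩ := H.bisector_twelve_thirteen hsx hW
    exact ⟨h1, h2, fun h => absurd rfl h⟩

end IsHeavy

end

section

variable {α κ μ W sx x y : ℝ} {i j : ℕ}

namespace IsHeavy

variable (H : IsHeavy α κ μ)
include H

/-! ### Empty cells and edges of a heavy rectangle -/

/-- At an optimal corner neither a shift up the left side nor one along the bottom side can help.
These two one-sided conditions, squared and added, give α² ≤ 1. -/
theorem cell_nine_eq_empty (hsx : 0 < sx) (hW : sx ≤ W) : cell α W sx 9 = ∅ := by
  refine eq_empty_of_forall_notMem ?_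
  rintro ⟨x, y⟩ ⟨hx, v, ⟨hx', hy, rfl⟩, hmin⟩
  have hx' : x < 0 := hx'
  have hy : y < -1 := hy
  have hρ := hyp_pos_left 1 hsx.ne'
  have hr := hyp_pos_left (y + 1) hx'.ne
  have e : pathLength α W sx (x, y) [(0, -1)] = cornerLength α sx (x, y) :=
    pathLength_lower_corner hsx hW (Or.inl hx')
  have h1 : α * hyp x (y + 1) ≤ -(y + 1) * hyp sx 1 := by
    refine le_of_not_gt fun hlt => ?_
    have hr' : hyp x (-1 - y) = hyp x (y + 1) := by rw [← hyp_neg_right]; congr 1; ring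
    have hd := hasDerivAt_leftLength (α := α) hsx (t := (x, y)) (w := -1)
      (by simp only; rw [hr']; exact hr.ne')
    obtain ⟨w, g1, g2, g3⟩ := exists_lt_of_deriv_neg hd (b := 0) (by
      simp only
      rw [hr', hyp_neg_right, ← mul_div_assoc, div_add_div _ _ hρ.ne' hr.ne', div_neg_iff]
      right
      exact ⟨by linarith, mul_pos hρ hr⟩) (by norm_num)
    have h2 := hmin [(0, w)]
    rw [e, cornerLength_eq, pathLength_left hsx hW g1.le g2 hx'] at h2
    exact h2.not_gt g3
  have h2 : α * sx * hyp x (y + 1) ≤ -x * hyp sx 1 := by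
    refine le_of_not_gt fun hlt => ?_
    have hr' : hyp (0 - x) (y + 1) = hyp x (y + 1) := by rw [zero_sub, hyp_neg_left]
    have hd := hasDerivAt_bottomLength (α := α) (sx := sx) (t := (x, y)) (w := 0)
      (by simp only; rw [hr']; exact hr.ne')
    obtain ⟨w, g1, g2, g3⟩ := exists_lt_of_deriv_neg hd (b := W) (by
      simp only
      rw [hr', zero_sub, zero_sub, hyp_neg_left, ← mul_div_assoc,
        div_add_div _ _ hρ.ne' hr.ne', div_neg_iff]
      right
      exact ⟨by linarith, mul_pos hρ hr⟩) (hsx.trans_le hW)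
    have h2 := hmin [(w, -1)]
    rw [e, cornerLength_eq_bottomLength, pathLength_bottom hsx hW g1.le g2 hy] at h2
    exact h2.not_gt g3
  have hα := H.pos
  have k1 := pow_le_pow_left₀ (by positivity) h1 2
  have k2 := pow_le_pow_left₀ (by positivity) h2 2
  have hρ2 := hyp_sq sx 1
  have hr2 := hyp_sq x (y + 1)
  generalize hyp sx 1 = ρ at *
  generalize hyp x (y + 1) = r at *
  have k3 : α ^ 2 * (ρ ^ 2 * r ^ 2) ≤ ρ ^ 2 * r ^ 2 := by
    calc _ = (α * r) ^ 2 + (α * sx * r) ^ 2 := by rw [hρ2]; ring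
      _ ≤ (-(y + 1) * ρ) ^ 2 + (-x * ρ) ^ 2 := add_le_add k1 k2
      _ = _ := by rw [hr2]; ring
  have k4 : 0 < ρ ^ 2 * r ^ 2 := by positivity
  rw [H.sq] at k3
  nlinarith [mul_pos (pow_pos H.pos_left 2) k4]

theorem cell_two_three_eq_empty (hsx : 0 < sx) (hW : sx ≤ W) (hi : i = 2 ∨ i = 3) :
    cell α W sx i = ∅ := by
  refine eq_empty_of_forall_notMem ?_
  rintro ⟨x, y⟩ ⟨hx, v, hv, hmin⟩
  rcases hi with rfl | rfl
  · obtain ⟨hy, b, h1, h2, rfl⟩ := hv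
    simp only at hy
    have h3 := hmin []
    rw [pathLength_top hW h1.le h2.le hy, pathLength_direct_above hy, H.min_eq] at h3
    have h4 := hyp_add_lt (a := sx - b) (b := 0) (c := b - x) (d := y)
      (by rw [zero_mul]; exact mul_ne_zero (by linarith) hy.ne')
    rw [hyp_zero_right, abs_of_pos (by linarith), zero_add, sub_add_sub_cancel, hyp_sub_left] at h4
    linarith
  · obtain ⟨hx', hy, rfl⟩ := hv
    simp only at hy hx'
    have h3 := hmin []
    rw [pathLength_corner hsx hW hx', pathLength_direct_above hy, H.min_eq] at h3
    have h4 := hyp_add_lt (a := -sx) (b := 0) (c := x) (d := y)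
      (by rw [zero_mul]; exact mul_ne_zero (by linarith) hy.ne')
    rw [hyp_zero_right, abs_of_neg (by linarith), zero_add, neg_add_eq_sub] at h4
    linarith

theorem cell_cases (hsx : 0 < sx) (hW : sx ≤ W) (hi : i ≠ 10) (h : (cell α W sx i).Nonempty) :
    i = 1 ∨ i = 4 ∨ i = 5 ∨ i = 6 ∨ i = 7 ∨ i = 8 ∨ i = 11 ∨ i = 12 ∨ i = 13 := by
  by_contra hc
  have key : cell α W sx i = ∅ := by
    rcases le_or_gt i 13 with h' | h'
    · by_cases h0 : i = 0
      · exact cell_eq_empty_of_lt (Or.inl h0)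
      · by_cases h9 : i = 9
        · rw [h9, H.cell_nine_eq_empty hsx hW]
        · exact H.cell_two_three_eq_empty hsx hW (by omega)
    · exact cell_eq_empty_of_lt (Or.inr h')
  rw [key] at h
  exact not_nonempty_empty h

omit H in
theorem false_of_corner (hsx : 0 < sx) (hW : sx ≤ W) (hq : (x, y) ∉ frontier (rect W))
    (hx : x = 0) (hy : y = -1) : False := by
  subst hx hy
  exact hq (corner_mem_frontier hsx hW)

theorem spmEdge_one_five (hsx : 0 < sx) (hW : sx ≤ W) : ¬ (spmEdge α W sx 1 5).Nonempty := by
  rintro ⟨⟨x, y⟩, hq, h1, h2⟩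
  have hy := mem_closure_typeDomain_one (closure_mono (cell_subset_typeDomain H.pos) h1)
  obtain ⟨hx, hxy, -⟩ := H.mem_closure_typeDomain_five hW
    (closure_mono (cell_subset_typeDomain H.pos) h2)
  have hκ := H.pos_left
  have hμ := H.pos_right
  simp only at hx hy hxy
  have hx0 : x = 0 := le_antisymm hx ((mul_nonneg_iff_of_pos_left hκ).1
    ((mul_nonneg hμ.le hy).trans hxy))
  have hy0 : y = 0 := le_antisymm (by
    rw [hx0, mul_zero] at hxy
    exact le_of_mul_le_mul_left (by rwa [mul_zero]) hμ) hy
  subst hx0 hy0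
  exact hq (origin_mem_frontier hsx hW)

/-- Both domains force y = 0, where a crossing of the interior costs at least α sx before the left
side is reached, against sx for the direct path. -/
theorem spmEdge_one_six (hsx : 0 < sx) (hW : sx ≤ W) : ¬ (spmEdge α W sx 1 6).Nonempty := by
  rintro ⟨⟨x, y⟩, hq, h1, h2⟩
  have e1 := eq_spDist_of_mem_closure_cell H.pos continuous_directLength
    eq_directLength_of_mem_typeGraph h1
  have e2 := eq_spDist_of_mem_closure_cell H.pos continuous_minLeftLength
    (eq_minLeftLength_of_mem_typeGraph hsx hW) h2
  have hy := mem_closure_typeDomain_one (closure_mono (cell_subset_typeDomain H.pos) h1)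
  obtain ⟨hx, hy', -⟩ := mem_closure_typeDomain_six H.pos hsx hW
    (closure_mono (cell_subset_typeDomain H.pos) h2)
  simp only at hx hy hy'
  obtain rfl : y = 0 := le_antisymm hy' hy
  obtain ⟨w, -, hw⟩ := exists_minLeftLength_eq (α := α) (sx := sx) (x, 0)
  rw [e1, hw] at e2
  simp only [directLength, leftLength, hyp_zero_right, sub_zero] at e2
  rw [abs_of_neg (by linarith)] at e2
  have h3 : sx ≤ hyp sx w := Real.le_sqrt_of_sq_le (by nlinarith)
  have h4 : -x ≤ hyp x w := Real.le_sqrt_of_sq_le (by nlinarith)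
  nlinarith [H.one_lt]

/-- Below the left side it is a detour to follow this side from its upper end. -/
theorem spDist_lt (hsx : 0 < sx) (hW : sx ≤ W) (hy : y ≤ -1) :
    spDist α W sx (0, y) < sx - y := by
  have hκ := H.pos_left
  -- The competitor leaves the top edge at (b, 0) at the critical angle. The cap 1 keeps its exit
  -- point -κ b on the left side; the saving is κ (1 - κ) b.
  set b := min sx 1 with hb
  have hb0 : 0 < b := lt_min hsx one_pos
  have hb1 : b ≤ sx := min_le_left _ _
  have hb2 : b ≤ 1 := min_le_right _ _
  have h1 : -1 ≤ -κ * b := by nlinarith [H.lt_one]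
  have h2 : -κ * b < 0 := by nlinarith
  have h3 := spDist_le (W := W) (sx := sx) H.pos (0, y) [(b, 0), (0, -κ * b)]
  rw [pathLength_top_left_of_one_le H.one_lt.le hW hb0 hb1 h1 h2 le_rfl, H.mul_hyp_eq hb0.le,
    hyp_zero_left, abs_of_nonneg (by linarith)] at h3
  nlinarith [H.lt_one, mul_pos hκ hb0]

theorem false_of_mem_closure_cell_four (hsx : 0 < sx) (hW : sx ≤ W) (hy : y ≤ -1)
    (h : (0, y) ∈ closure (cell α W sx 4)) : False := by
  have e := eq_spDist_of_mem_closure_cell (f := fun t => min 1 α * sx + hyp t.1 t.2) H.pos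
    (by fun_prop) (eq_of_mem_typeGraph_four hsx hW) h
  simp only [H.min_eq, hyp_zero_left] at e
  rw [abs_of_neg (by linarith)] at e
  linarith [H.spDist_lt hsx hW hy]

theorem spmEdge_four_six (hsx : 0 < sx) (hW : sx ≤ W) : ¬ (spmEdge α W sx 4 6).Nonempty := by
  rintro ⟨⟨x, y⟩, hq, h1, h2⟩
  obtain ⟨hx, hy⟩ := mem_closure_typeDomain_four (closure_mono (cell_subset_typeDomain H.pos) h1)
  simp only at hx hy
  rcases hx.eq_or_lt with rfl | hx
  · refine H.false_of_mem_closure_cell_four hsx hW (le_of_not_gt fun hy' => hq ?_) h1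
    exact mem_frontier_rect.2 ⟨⟨⟨le_rfl, by simp only; linarith⟩, hy'.le, hy⟩, by simp⟩
  have e1 := eq_spDist_of_mem_closure_cell (f := fun t => min 1 α * sx + hyp t.1 t.2) H.pos
    (by fun_prop) (eq_of_mem_typeGraph_four hsx hW) h1
  have e2 := eq_spDist_of_mem_closure_cell H.pos continuous_minLeftLength
    (eq_minLeftLength_of_mem_typeGraph hsx hW) h2
  obtain ⟨w, hw, hw'⟩ := exists_minLeftLength_eq (α := α) (sx := sx) (x, y)
  rw [hw'] at e2
  simp only [H.min_eq, one_mul, leftLength] at e1 e2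
  rcases hw.2.eq_or_lt with rfl | hw0
  · rw [hyp_zero_right, abs_of_pos hsx, zero_sub, hyp_neg_right] at e2
    nlinarith [H.one_lt]
  -- Average of the path around the corner and the path through (0, w). The inner segment scales by
  -- one half, and the outer ones are not parallel, so strict convexity applies.
  · have h3 := spDist_le (W := W) (sx := sx) H.pos (x, y) [(sx / 2, 0), (0, w / 2)]
    rw [pathLength_top_left hW (by positivity) (by linarith) (by linarith [hw.1]) (by linarith) hx,
      H.min_eq, one_mul] at h3
    have h4 := hyp_add_lt (a := x) (b := -y) (c := x) (d := w - y)
      (fun h => (mul_ne_zero hx.ne hw0.ne) (by linarith))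
    rw [show -y + (w - y) = 2 * (w / 2 - y) by ring, ← two_mul x, hyp_mul two_pos.le,
      hyp_neg_right] at h4
    have h5 : hyp sx w = 2 * hyp (sx / 2) (w / 2) := by
      rw [← hyp_mul two_pos.le]; congr 1 <;> ring
    rw [h5] at e2
    linarith

/-- The closed domain of type 8 lies to the right of a critical ray from the lower left corner, so
it meets x ≤ 0 only at that corner, which is on the frontier. -/
theorem spmEdge_eight_eq_empty (hsx : 0 < sx) (hW : sx ≤ W)
    (hi : ∀ q ∈ closure (cell α W sx i), q.1 ≤ 0) : ¬ (spmEdge α W sx i 8).Nonempty := by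
  rintro ⟨⟨x, y⟩, hq, h1, h2⟩
  obtain ⟨hy, hxy⟩ := H.mem_closure_typeDomain_eight hsx hW
    (closure_mono (cell_subset_typeDomain H.pos) h2)
  have hx := hi _ h1
  have hκ := H.pos_left
  have hμ := H.pos_right
  simp only at hx hy hxy
  refine false_of_corner hsx hW hq (le_antisymm hx ?_) (le_antisymm hy ?_)
  · refine (mul_nonneg_iff_of_pos_left hμ).1 ?_
    nlinarith
  · have : 0 ≤ κ * (y + 1) := by nlinarith
    linarith [(mul_nonneg_iff_of_pos_left hκ).1 this]

theorem spmEdge_four_seven (hsx : 0 < sx) (hW : sx ≤ W) : ¬ (spmEdge α W sx 4 7).Nonempty := by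
  rintro ⟨⟨x, y⟩, hq, h1, h2⟩
  obtain ⟨hx, hy⟩ := mem_closure_typeDomain_four (closure_mono (cell_subset_typeDomain H.pos) h1)
  obtain ⟨hx', hy', -⟩ := H.mem_closure_typeDomain_seven hsx hW
    (closure_mono (cell_subset_typeDomain H.pos) h2)
  simp only at hx hx' hy'
  obtain rfl : x = 0 := le_antisymm hx hx'
  exact H.false_of_mem_closure_cell_four hsx hW hy' h1

theorem spmEdge_five_seven (hsx : 0 < sx) (hW : sx ≤ W) : ¬ (spmEdge α W sx 5 7).Nonempty := by
  rintro ⟨⟨x, y⟩, hq, h1, h2⟩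
  obtain ⟨hx, -, -, hxy⟩ := H.mem_closure_typeDomain_five hW
    (closure_mono (cell_subset_typeDomain H.pos) h1)
  obtain ⟨hx', hy', -⟩ := H.mem_closure_typeDomain_seven hsx hW
    (closure_mono (cell_subset_typeDomain H.pos) h2)
  have hμ := H.pos_right
  simp only at hx hx' hy' hxy
  have hx0 : x = 0 := le_antisymm hx hx'
  refine false_of_corner hsx hW hq hx0 (le_antisymm hy' ?_)
  rw [hx0] at hxy
  nlinarith

/-- The domain inequalities combine to sx + x ≤ κ² (sx - x), which is impossible for 0 ≤ x ≤ sx, 0 <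
sx and κ < 1. -/
theorem spmEdge_eleven_thirteen (hsx : 0 < sx) (hW : sx ≤ W) :
    ¬ (spmEdge α W sx 11 13).Nonempty := by
  rintro ⟨⟨x, y⟩, hq, h1, h2⟩
  replace h1 := closure_mono (cell_subset_typeDomain H.pos) h1
  replace h2 := closure_mono (cell_subset_typeDomain H.pos) h2
  have k1 := of_mem_closure_typeDomain (P := fun q => -κ * (sx - q.1) ≤ q.2)
    (isClosed_le (f := fun q : ℝ × ℝ => -κ * (sx - q.1)) (g := fun q : ℝ × ℝ => q.2)
      (by fun_prop) (by fun_prop))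
    (fun t d h => (H.of_mem_typeGraph_eleven hW h).2.2) h1
  have k2 := of_mem_closure_typeDomain (P := fun q => κ * q.2 ≤ -(sx + q.1))
    (isClosed_le (f := fun q : ℝ × ℝ => κ * q.2) (g := fun q : ℝ × ℝ => -(sx + q.1))
      (by fun_prop) (by fun_prop))
    (fun t d h => (H.of_mem_typeGraph_thirteen hsx hW h).2.2) h2
  have hx := (mem_rect_of_mem_closure
    (fun t ⟨d, h⟩ => (H.of_mem_typeGraph_eleven hW h).2.1) h1).1.1
  have hκ := H.pos_left
  have hκ1 := H.lt_one
  have hxs := mem_closure_typeDomain_le h1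
  simp only at k1 k2 hx hxs
  have k3 : κ * (-κ * (sx - x)) ≤ κ * y := mul_le_mul_of_nonneg_left k1 hκ.le
  have k4 : κ * κ * (sx - x) ≤ 1 * (sx - x) := by
    refine mul_le_mul_of_nonneg_right ?_ (by linarith)
    nlinarith
  have k5 : x = 0 := by linarith
  subst k5
  nlinarith [mul_pos (sub_pos.2 hκ1) hsx]

theorem spmEdge_one_eq_empty (hj : ∀ q ∈ closure (cell α W sx j), q.2 ≤ -1) :
    ¬ (spmEdge α W sx 1 j).Nonempty := by
  rintro ⟨q, -, h1, h2⟩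
  linarith [hj q h2, mem_closure_typeDomain_one (closure_mono (cell_subset_typeDomain H.pos) h1)]

theorem edges (hsx : 0 < sx) (hW : sx ≤ W) (hij : i < j) (hi : i ≠ 10) (hj : j ≠ 10)
    (h : (spmEdge α W sx i j).Nonempty) : (i, j) ∈ heavyPairs := by
  obtain ⟨hci, hcj⟩ := spmEdge_nonempty_cells h
  have hci := H.cell_cases hsx hW hi hci
  have hcj := H.cell_cases hsx hW hj hcj
  by_cases hint : i < 11 ∧ 11 ≤ j
  · exact absurd h (spmEdge_interior_eq_empty hint.1 (by omega))
  have hcase : (i, j) ∈ heavyPairs ∨ (i = 1 ∧ (j = 5 ∨ j = 6 ∨ j = 7 ∨ j = 8)) ∨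
      (i = 4 ∧ (j = 6 ∨ j = 7 ∨ j = 8)) ∨ (i = 5 ∧ (j = 7 ∨ j = 8)) ∨ (i = 6 ∧ j = 8) ∨
      (i = 11 ∧ j = 13) := by
    clear h
    rcases hci with rfl | rfl | rfl | rfl | rfl | rfl | rfl | rfl | rfl <;>
      rcases hcj with rfl | rfl | rfl | rfl | rfl | rfl | rfl | rfl | rfl <;>
      simp [heavyPairs] at hij hint ⊢
  have sub : ∀ i, ∀ q ∈ closure (cell α W sx i), q ∈ closure (typeDomain α W sx i) :=
    fun i q hq => closure_mono (cell_subset_typeDomain H.pos) hq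
  rcases hcase with hc | ⟨rfl, rfl | rfl | rfl | rfl⟩ | ⟨rfl, rfl | rfl | rfl⟩ |
    ⟨rfl, rfl | rfl⟩ | ⟨rfl, rfl⟩ | ⟨rfl, rfl⟩
  · exact hc
  · exact absurd h (H.spmEdge_one_five hsx hW)
  · exact absurd h (H.spmEdge_one_six hsx hW)
  · exact absurd h (H.spmEdge_one_eq_empty fun q hq =>
      (H.mem_closure_typeDomain_seven hsx hW (sub 7 q hq)).2.1)
  · exact absurd h (H.spmEdge_one_eq_empty fun q hq =>
      (H.mem_closure_typeDomain_eight hsx hW (sub 8 q hq)).1)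
  · exact absurd h (H.spmEdge_four_six hsx hW)
  · exact absurd h (H.spmEdge_four_seven hsx hW)
  · exact absurd h (H.spmEdge_eight_eq_empty hsx hW fun q hq =>
      (mem_closure_typeDomain_four (sub 4 q hq)).1)
  · exact absurd h (H.spmEdge_five_seven hsx hW)
  · exact absurd h (H.spmEdge_eight_eq_empty hsx hW fun q hq =>
      (H.mem_closure_typeDomain_five hW (sub 5 q hq)).1)
  · exact absurd h (H.spmEdge_eight_eq_empty hsx hW fun q hq =>
      (mem_closure_typeDomain_six H.pos hsx hW (sub 6 q hq)).1)
  · exact absurd h (H.spmEdge_eleven_thirteen hsx hW)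

end IsHeavy

end

end WeightedRectangle


open WeightedRectangle in
theorem mainTheorem3 (α W sx : ℝ) (hα : 0 < α) (hsx : 0 < sx) (hW : sx ≤ W) :
    (α < 1 →
      (∀ p ∈ lightPairs,
        bisector α W sx p.1 p.2 = curvePart α W sx p.1 p.2 (lightCurve α sx p) ∧
        spmEdge α W sx p.1 p.2 = bisector α W sx p.1 p.2) ∧
      (∀ i j : ℕ, i < j → i ≠ 10 → j ≠ 10 →
        (spmEdge α W sx i j).Nonempty → (i, j) ∈ lightPairs)) ∧
    (1 < α → α < √2 →
      (∀ p ∈ heavyPairs,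
        bisector α W sx p.1 p.2 = curvePart α W sx p.1 p.2 (heavyCurve α sx p) ∧
        spmEdge α W sx p.1 p.2 ⊆ bisector α W sx p.1 p.2 ∧
        (p ≠ (12, 13) →
          ∀ q ∈ bisector α W sx p.1 p.2, -1 < q.2 → q ∈ spmEdge α W sx p.1 p.2)) ∧
      (∀ i j : ℕ, i < j → i ≠ 10 → j ≠ 10 →
        (spmEdge α W sx i j).Nonempty → (i, j) ∈ heavyPairs)) :=
  ⟨fun hα1 => ⟨light_case hα hα1 hsx hW,
      fun _ _ hij hi hj h => light_edges hα hα1 hsx hW hij hi hj h⟩,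
    fun h1 h2 => ⟨(isHeavy_sqrt h1 h2).case_pairs hsx hW rfl rfl,
      fun _ _ hij hi hj h => (isHeavy_sqrt h1 h2).edges hsx hW hij hi hj h⟩⟩
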